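/- **Setting.** Let $A\in\mathbb R^{m\times n}$, $b\in\mathbb R^m$, $c\in\mathbb R^n$, $W=\ker A$, and consider the primal-dual pair of linear programs $\min\{\langle c,x\rangle: Ax=b,\ x\ge 0\}$ and $\max\{\langle b,y\rangle: A^\top y+s=c,\ s\ge 0\}$. Let $\mathcal P_{++}$ and $\mathcal D_{++}$ be the sets of strictly positive feasible $x$ and $s$. Products, quotients and powers of vectors are entrywise, $\|\cdot\|$ is the Euclidean norm, and $\Pi$ denotes orthogonal projection. For $z=(x,s)$ put $\overline\mu(z)=\langle x,s\rangle/n$ and $$\mathcal N^2(\beta)=\{z=(x,s)\in\mathcal P_{++}\times\mathcal D_{++}:\ \|xs/\overline\mu(z)-\mathbf 1\|\le\beta\},\qquad \overline{\mathcal N}^2(\beta)=\operatorname{cl}\mathcal N^2(\beta).$$ For $\mu>0$ the central path point $z^{\rm cp}(\mu)=(x^{\rm cp}(\mu),s^{\rm cp}(\mu))$ is the point of $\mathcal P_{++}\times\mathcal D_{++}$ with $x_is_i=\mu$ for all $i$, and $z^{\rm cp}(0)=\lim_{\mu\searrow0}z^{\rm cp}(\mu)$. The segment $\mathrm{CP}[\mu_1,\mu_0]$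 is *$\gamma$-polarized* if there is a partition $B\cup N=[n]$ such that for all $\mu\in[\mu_1,\mu_0]$: $x^{\rm cp}_i(\mu)\ge\gamma x^{\rm cp}_i(\mu_0)$ for $i\in B$ and $s^{\rm cp}_i(\mu)\ge\gamma s^{\rm cp}_i(\mu_0)$ for $i\in N$. **Lifting maps.** For a subspace $W'\subseteq\mathbb R^n$ and a partition $I\cup J=[n]$, let $\pi_I$ be the coordinate projection, let $L_I^{W'}(u)=\arg\min\{\|w\|:w\in W',\ w_I=\Pi_{\pi_I(W')}(u)\}$ for $u\in\mathbb R^I$, and $\ell_I^{W'}(u)=(L_I^{W'}(u))_J$. **Approx-SVD.** For a linear map $M:\mathbb R^k\to\mathbb R^l$, start with the $k\times k$ matrix $V=\mathrm{I}$ (its columns may be listed in any order) and for $i=1,\dots,k$: replace $V$ by $\textsc{Orthogonalize}(\mathrm I,V)$; replace the columns $V_{\ge i}$ by $\textsc{Orthogonalize}(M,V_{\ge i})$; swap column $i$ with a column $j\ge i$ that minimizes $\|MV_j\|/\|V_j\|$ over $j\ge i$. The final $V$ is the output. Here $\textsc{Orthogonalize}(N,V)$ is any matrix $\widehat V$ whose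 first $j$ columns span the same space as the first $j$ columns of $V$, for every $j$, and whose columns have pairwise orthogonal images under $N$. **The algorithm** (IPM with subspace LLS, parameter $\beta\in(0,1/6]$). Let $\tau=\beta/(16\sqrt n)$. While $\langle x,s\rangle>0$, one iteration at $z=(x,s)$, with $\mu=\overline\mu(z)$, $\xi=(xs/\mu)^{1/2}$, $\hat x=x/\xi$, $\hat s=s/\xi$, is as follows. 1. Compute the affine scaling direction: $\Delta x^a\in W$, $\Delta s^a\in W^\perp$, $s\Delta x^a+x\Delta s^a=-xs$. Choose a step-length $\alpha^a\ge\max\{\beta/\sqrt n,\ 1-\|\Delta x^a\Delta s^a\|/(\beta\mu)\}$ with $\alpha^a\le\sup\{\alpha\in[0,1]: z+\alpha'\Delta z^a\in\mathcal N^2(2\beta)\ \forall\alpha'\in[0,\alpha]\}$. 2. Let $\widetilde B=\{i:|\Delta x^a_i/x_i|<|\Delta s^a_i/s_i|\}$, $\widetilde N=[n]\setminus\widetilde B$. 3. Let $M=\ell_{\widetilde N}^{\hat x^{-1}W}$, let $V$ be the output of Approx-SVD on $M$, $i=\max\{j:\|MV_j\|/\|V_j\|\le\tau/n\}$, and $\widetilde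 V=\operatorname{span}(V_1,\dots,V_i)\cap\pi_{\widetilde N}(\hat x^{-1}W)$ (so $\widetilde V=0$ if there is no such $j$). Let $\widetilde U\subseteq\pi_{\widetilde B}(\hat s^{-1}W^\perp)$ be obtained in the same way from $\ell_{\widetilde B}^{\hat s^{-1}W^\perp}$. 4. Let $\delta_{\widetilde N}=\arg\min_{\delta\in\widetilde V}\|\xi_{\widetilde N}+\delta\|$ and $\Delta x^\ell=\hat x\,(\ell_{\widetilde N}^{\hat x^{-1}W}(\delta_{\widetilde N}),\delta_{\widetilde N})$; let $\eta_{\widetilde B}=\arg\min_{\eta\in\widetilde U}\|\xi_{\widetilde B}+\eta\|$ and $\Delta s^\ell=\hat s\,(\eta_{\widetilde B},\ell_{\widetilde B}^{\hat s^{-1}W^\perp}(\eta_{\widetilde B}))$. If $\widetilde N=\emptyset$ put instead $(\Delta x^\ell,\Delta s^\ell)=(0,\Delta s^a)$; if $\widetilde B=\emptyset$ put $(\Delta x^\ell,\Delta s^\ell)=(\Delta x^a,0)$. Let $\alpha^\ell=1-\frac4\beta\|(x+\Delta x^\ell)(s+\Delta s^\ell)\|/\mu$ if $\|\Delta x^\ell\Delta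 s^\ell\|\le\beta\mu/4$, and $\alpha^\ell=0$ otherwise. 5. If $\alpha^a>\alpha^\ell$ replace $z$ by $z+\alpha^a\Delta z^a$, otherwise by $z+\alpha^\ell\Delta z^\ell$. If now $\langle x,s\rangle>0$, make a corrector step: replace $z$ by $z+\Delta z^c$, where $\Delta x^c\in W$, $\Delta s^c\in W^\perp$, $s\Delta x^c+x\Delta s^c=\overline\mu(z)\mathbf 1-xs$. **Theorem.** For every $\beta\in(0,1/6]$ there is a constant $C>0$, depending only on $\beta$, such that the following holds for all linear programs as above. Let $\mu_0>\mu_1\ge0$, $\gamma\in(0,1]$, and let $\mathrm{CP}[\mu_1,\mu_0]$ be $\gamma$-polarized. Then, from any $z\in\mathcal N^2(\beta)$ with $\overline\mu(z)\in(\mu_1,\mu_0)$, the algorithm (for every way of making the choices left open above, and without getting stuck) finds within at most $C\,(1+n^{1.5}\log(n/\gamma))$ iterations (that is, $O(n^{1.5}\log(n/\gamma))$ for $n\ge2$) a point $z'$ with $\overline\mu(z')\le\mu_1$ such that either $z'\in\mathcal N^2(\beta)$, or $\overline\mu(z')=0$ and $z'\in\overline{\mathcal N}^2(2\beta)$. 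-/

import Mathlib

open Filter Topology

noncomputable section

namespace SubspaceIPM

/-- `ℝ^ι` with the Euclidean norm. -/
abbrev Vec (ι : Type) [Fintype ι] : Type := EuclideanSpace ℝ ι

/-- A primal-dual pair `z = (x, s)`. -/
abbrev Pt (n : ℕ) : Type := Vec (Fin n) × Vec (Fin n)

/-- The Hadamard product by `u`, as a linear map. -/
def hadL {n : ℕ} (u : Vec (Fin n)) : Vec (Fin n) →ₗ[ℝ] Vec (Fin n) where
  toFun v := WithLp.toLp 2 (fun i => u i * v i)
  map_add' v w := by ext i; simp [mul_add]
  map_smul' a v := by ext i; simp [mul_left_comm]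

/-- The Hadamard product. -/
def had {n : ℕ} (u v : Vec (Fin n)) : Vec (Fin n) := hadL u v

/-- The entrywise inverse. -/
def hinv {n : ℕ} (u : Vec (Fin n)) : Vec (Fin n) := WithLp.toLp 2 (fun i => (u i)⁻¹)

/-- The all-ones vector. -/
def ones (n : ℕ) : Vec (Fin n) := WithLp.toLp 2 (fun _ => 1)

/-- The coordinate projection onto the index set `I`. -/
def coordProj {n : ℕ} (I : Finset (Fin n)) : Vec (Fin n) →ₗ[ℝ] Vec I where
  toFun v := WithLp.toLp 2 (fun i => v i)
  map_add' v w := by ext i; simp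
  map_smul' a v := by ext i; simp

/-! ### The linear program, the central path and its neighbourhoods -/

/-- The data of `min ⟨c, x⟩, A x = b, x ≥ 0` and of its dual
`max ⟨b, y⟩, Aᵀ y + s = c, s ≥ 0`. -/
structure LPData (m n : ℕ) where
  A : Matrix (Fin m) (Fin n) ℝ
  b : Fin m → ℝ
  c : Fin n → ℝ

variable {m n : ℕ}

/-- The strictly feasible primal solutions. -/
def LPData.primalPos (P : LPData m n) : Set (Vec (Fin n)) :=
  {x | P.A.mulVec (fun i => x i) = P.b ∧ ∀ i, 0 < x i}

/-- The strictly feasible dual slacks. -/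
def LPData.dualPos (P : LPData m n) : Set (Vec (Fin n)) :=
  {s | (∃ y : Fin m → ℝ, P.A.transpose.mulVec y + (fun i => s i) = P.c) ∧ ∀ i, 0 < s i}

/-- `W = ker A`. -/
def LPData.W (P : LPData m n) : Submodule ℝ (Vec (Fin n)) where
  carrier := {x | P.A.mulVec (fun i => x i) = 0}
  add_mem' {x y} hx hy := by
    have h : (fun i => (x + y) i) = (fun i => x i) + (fun i => y i) := by ext i; simp
    simp only [Set.mem_ofPred_eq] at hx hy ⊢
    rw [h, Matrix.mulVec_add, hx, hy, add_zero]
  zero_mem' := by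
    have h : (fun i => (0 : Vec (Fin n)) i) = (0 : Fin n → ℝ) := by ext i; simp
    simp only [Set.mem_ofPred_eq]
    rw [h, Matrix.mulVec_zero]
  smul_mem' a x hx := by
    have h : (fun i => (a • x) i) = a • (fun i => x i) := by ext i; simp
    simp only [Set.mem_ofPred_eq] at hx ⊢
    rw [h, Matrix.mulVec_smul, hx, smul_zero]

/-- The normalized duality gap `⟨x, s⟩ / n`. -/
def gap (z : Pt n) : ℝ := inner ℝ z.1 z.2 / n

/-- The neighbourhood `N²(β)` of the central path. -/
def LPData.N2 (P : LPData m n) (β : ℝ) : Set (Pt n) :=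
  {z | z.1 ∈ P.primalPos ∧ z.2 ∈ P.dualPos ∧ ‖(gap z)⁻¹ • had z.1 z.2 - ones n‖ ≤ β}

/-- `z` is a central path point with parameter `μ > 0`. -/
def LPData.IsCentral (P : LPData m n) (μ : ℝ) (z : Pt n) : Prop :=
  0 < μ ∧ z.1 ∈ P.primalPos ∧ z.2 ∈ P.dualPos ∧ ∀ i, z.1 i * z.2 i = μ

/-- `z = z^cp(μ)` for `μ ≥ 0`, where `z^cp(0)` is the limit of `z^cp(ν)` as `ν ↘ 0`. -/
def LPData.IsCP (P : LPData m n) (μ : ℝ) (z : Pt n) : Prop :=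
  P.IsCentral μ z ∨
    (μ = 0 ∧ ∃ p : ℝ → Pt n, (∀ ν, 0 < ν → P.IsCentral ν (p ν)) ∧ Tendsto p (𝓝[>] 0) (𝓝 z))

/-- The segment `CP[μ₁, μ₀]` of the central path is `γ`-polarized (the partition is
`B ∪ Bᶜ`; either part may be empty). -/
def LPData.Polarized (P : LPData m n) (γ μ₁ μ₀ : ℝ) : Prop :=
  ∃ B : Finset (Fin n), ∀ μ ∈ Set.Icc μ₁ μ₀, ∀ z z₀ : Pt n, P.IsCP μ z → P.IsCP μ₀ z₀ →
    (∀ i ∈ B, γ * z₀.1 i ≤ z.1 i) ∧ (∀ i ∈ Bᶜ, γ * z₀.2 i ≤ z.2 i)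

/-- `d = (Δx, Δs)` solves `Δx ∈ W`, `Δs ∈ W^⊥`, `s Δx + x Δs = ν μ 1 - x s` with `μ` the gap of
`z`. The affine scaling direction is `ν = 0`, the corrector (centrality) direction is `ν = 1`. -/
def LPData.IsNewtonDir (P : LPData m n) (ν : ℝ) (z d : Pt n) : Prop :=
  d.1 ∈ P.W ∧ d.2 ∈ P.Wᗮ ∧
    had z.2 d.1 + had z.1 d.2 = (ν * gap z) • ones n - had z.1 z.2

/-- `ξ(z) = x^{1/2} s^{1/2} / μ^{1/2}`. -/
def xi (z : Pt n) : Vec (Fin n) :=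
  WithLp.toLp 2 (fun i => √(z.1 i) * √(z.2 i) / √(gap z))

/-- `x̂ = x ξ⁻¹`. -/
def xhat (z : Pt n) : Vec (Fin n) := had z.1 (hinv (xi z))

/-- `ŝ = s ξ⁻¹`. -/
def shat (z : Pt n) : Vec (Fin n) := had z.2 (hinv (xi z))

/-- The rescaled subspace `x̂⁻¹ W`. -/
def LPData.Wx (P : LPData m n) (z : Pt n) : Submodule ℝ (Vec (Fin n)) :=
  P.W.map (hadL (hinv (xhat z)))

/-- The rescaled subspace `ŝ⁻¹ W^⊥`. -/
def LPData.Ws (P : LPData m n) (z : Pt n) : Submodule ℝ (Vec (Fin n)) :=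
  P.Wᗮ.map (hadL (hinv (shat z)))

/-! ### Lifting maps -/

/-- `w` is the minimizer of `‖w‖` over `w ∈ W` with `w_I = Π_{π_I(W)}(x)`. -/
def IsLift (W : Submodule ℝ (Vec (Fin n))) (I : Finset (Fin n)) (x : Vec I)
    (w : Vec (Fin n)) : Prop :=
  w ∈ W ∧ coordProj I w = (W.map (coordProj I)).starProjection x ∧
    ∀ w' ∈ W, coordProj I w' = (W.map (coordProj I)).starProjection x → ‖w‖ ≤ ‖w'‖

/-- The minimizer is the solution orthogonal to all `u ∈ W` with `u_I = 0`. -/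
theorem isLift_iff (W : Submodule ℝ (Vec (Fin n))) (I : Finset (Fin n)) (x : Vec I)
    (w : Vec (Fin n)) :
    IsLift W I x w ↔ w ∈ W ∧ coordProj I w = (W.map (coordProj I)).starProjection x ∧
      w ∈ (W ⊓ LinearMap.ker (coordProj I))ᗮ := by
  set K := W ⊓ LinearMap.ker (coordProj I) with hK
  constructor
  · rintro ⟨h1, h2, h3⟩
    refine ⟨h1, h2, ?_⟩
    set q := K.starProjection w with hq
    have hqK : q ∈ K := Submodule.starProjection_apply_mem K w
    have hqK' := Submodule.mem_inf.1 hqK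
    have hperp : w - q ∈ Kᗮ := Submodule.sub_starProjection_mem_orthogonal w
    have hle := h3 (w - q) (W.sub_mem h1 hqK'.1) (by
      rw [map_sub, LinearMap.mem_ker.1 hqK'.2, sub_zero, h2])
    have hin : inner ℝ q (w - q) = 0 := (Submodule.mem_orthogonal K _).1 hperp q hqK
    have hpy : ‖w‖ * ‖w‖ = ‖q‖ * ‖q‖ + ‖w - q‖ * ‖w - q‖ := by
      have := norm_add_sq_eq_norm_sq_add_norm_sq_of_inner_eq_zero q (w - q) hin
      rwa [add_sub_cancel] at this
    have hq0 : ‖q‖ = 0 := by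
      nlinarith [norm_nonneg w, norm_nonneg q, norm_nonneg (w - q)]
    have : q = 0 := norm_eq_zero.1 hq0
    rwa [this, sub_zero] at hperp
  · rintro ⟨h1, h2, h3⟩
    refine ⟨h1, h2, fun w' h1' h2' => ?_⟩
    have hd : w' - w ∈ K := Submodule.mem_inf.2
      ⟨W.sub_mem h1' h1, by rw [LinearMap.mem_ker, map_sub, h2, h2', sub_self]⟩
    have hin : inner ℝ (w' - w) w = 0 := (Submodule.mem_orthogonal K _).1 h3 _ hd
    have hpy := norm_add_sq_eq_norm_sq_add_norm_sq_of_inner_eq_zero (w' - w) w hin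
    rw [sub_add_cancel] at hpy
    nlinarith [norm_nonneg w, norm_nonneg w', norm_nonneg (w' - w)]

theorem exists_isLift (W : Submodule ℝ (Vec (Fin n))) (I : Finset (Fin n)) (x : Vec I) :
    ∃ w, IsLift W I x w := by
  obtain ⟨w, hw, hwx⟩ := Submodule.mem_map.1
    (Submodule.starProjection_apply_mem (W.map (coordProj I)) x)
  set K := W ⊓ LinearMap.ker (coordProj I) with hK
  have hqK' := Submodule.mem_inf.1 (Submodule.starProjection_apply_mem K w)
  refine ⟨w - K.starProjection w, (isLift_iff W I x _).2 ⟨W.sub_mem hw hqK'.1, ?_,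
    Submodule.sub_starProjection_mem_orthogonal w⟩⟩
  rw [map_sub, LinearMap.mem_ker.1 hqK'.2, sub_zero, hwx]

theorem IsLift.unique {W : Submodule ℝ (Vec (Fin n))} {I : Finset (Fin n)} {x : Vec I}
    {w w' : Vec (Fin n)} (h : IsLift W I x w) (h' : IsLift W I x w') : w = w' := by
  obtain ⟨h1, h2, h3⟩ := (isLift_iff W I x w).1 h
  obtain ⟨h1', h2', h3'⟩ := (isLift_iff W I x w').1 h'
  have hd : w - w' ∈ W ⊓ LinearMap.ker (coordProj I) := Submodule.mem_inf.2
    ⟨W.sub_mem h1 h1', by rw [LinearMap.mem_ker, map_sub, h2, h2', sub_self]⟩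
  have := (Submodule.mem_orthogonal _ _).1 (Submodule.sub_mem _ h3 h3') _ hd
  exact sub_eq_zero.1 (inner_self_eq_zero.1 this)

/-- The lifting map `L_I^W : ℝ^I → W ⊆ ℝ^n`. -/
def liftL (W : Submodule ℝ (Vec (Fin n))) (I : Finset (Fin n)) : Vec I →ₗ[ℝ] Vec (Fin n) where
  toFun x := Classical.choose (exists_isLift W I x)
  map_add' x y := by
    refine (Classical.choose_spec (exists_isLift W I (x + y))).unique ?_
    obtain ⟨h1, h2, h3⟩ := (isLift_iff W I x _).1 (Classical.choose_spec (exists_isLift W I x))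
    obtain ⟨h1', h2', h3'⟩ := (isLift_iff W I y _).1 (Classical.choose_spec (exists_isLift W I y))
    exact (isLift_iff W I _ _).2
      ⟨W.add_mem h1 h1', by rw [map_add, h2, h2', map_add], Submodule.add_mem _ h3 h3'⟩
  map_smul' a x := by
    refine (Classical.choose_spec (exists_isLift W I (a • x))).unique ?_
    obtain ⟨h1, h2, h3⟩ := (isLift_iff W I x _).1 (Classical.choose_spec (exists_isLift W I x))
    exact (isLift_iff W I _ _).2
      ⟨W.smul_mem a h1, by rw [map_smul, h2, map_smul]; rfl, Submodule.smul_mem _ a h3⟩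

/-- The lifting map `ℓ_I^W : ℝ^I → ℝ^J`, used for partitions `I ∪ J = [n]`. -/
def lift (W : Submodule ℝ (Vec (Fin n))) (I J : Finset (Fin n)) : Vec I →ₗ[ℝ] Vec J :=
  coordProj J ∘ₗ liftL W I

/-! ### The approximate singular value decomposition -/

section SVD

variable {κ ι : Type} [Fintype κ] [DecidableEq κ] [Fintype ι] {k : ℕ}

/-- The columns `a, …, k-1` of `V` are replaced by an output of `Orthogonalize(N, V_{≥ a})`:
leading spans are kept and the images under `N` of the new columns are pairwise orthogonal.
The other columns are unchanged. -/
def IsOrthogonalization {ι' : Type} [Fintype ι'] (N : Vec κ →ₗ[ℝ] Vec ι') (a : ℕ)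
    (V V' : Fin k → Vec κ) : Prop :=
  (∀ j : Fin k, (j : ℕ) < a → V' j = V j) ∧
  (∀ j : Fin k, a ≤ (j : ℕ) →
    Submodule.span ℝ (V' '' {l | a ≤ (l : ℕ) ∧ l ≤ j}) =
      Submodule.span ℝ (V '' {l | a ≤ (l : ℕ) ∧ l ≤ j})) ∧
  (∀ j l : Fin k, a ≤ (j : ℕ) → a ≤ (l : ℕ) → j ≠ l → inner ℝ (N (V' j)) (N (V' l)) = 0)

/-- The quotient `‖M v‖ / ‖v‖`. -/
def ratio (M : Vec κ →ₗ[ℝ] Vec ι) (v : Vec κ) : ℝ := ‖M v‖ / ‖v‖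

/-- The `i`-th pass of the loop of Approx-SVD turns the columns `V` into `V'`. Ties in the
`argmin` are broken arbitrarily. -/
def SVDPass (M : Vec κ →ₗ[ℝ] Vec ι) (i : Fin k) (V V' : Fin k → Vec κ) : Prop :=
  ∃ (V₁ V₂ : Fin k → Vec κ) (c : Fin k),
    IsOrthogonalization LinearMap.id 0 V V₁ ∧
    IsOrthogonalization M (i : ℕ) V₁ V₂ ∧
    i ≤ c ∧ (∀ j, i ≤ j → ratio M (V₂ c) ≤ ratio M (V₂ j)) ∧
    V' = V₂ ∘ Equiv.swap i c

/-- `V` is an output of Approx-SVD on the input `M`; the columns of `V`, and those of the initial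
identity matrix, are listed in some order by `Fin k`, where `k` is the size of `κ`. -/
def IsApproxSVD (M : Vec κ →ₗ[ℝ] Vec ι) (V : Fin k → Vec κ) : Prop :=
  ∃ (e : Fin k ≃ κ) (S : ℕ → Fin k → Vec κ),
    (S 0 = fun j => EuclideanSpace.single (e j) (1 : ℝ)) ∧
    (∀ i : Fin k, SVDPass M i (S i) (S ((i : ℕ) + 1))) ∧
    V = S k

/-- `im(V_{≤ i})` for `i = max {j | ‖M V_j‖ / ‖V_j‖ ≤ t}` (the zero space if there is no such
`j`). -/
def cheapSpan (M : Vec κ →ₗ[ℝ] Vec ι) (V : Fin k → Vec κ) (t : ℝ) : Submodule ℝ (Vec κ) :=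
  Submodule.span ℝ (V '' {l | ∃ j, l ≤ j ∧ ratio M (V j) ≤ t})

end SVD

/-! ### The algorithm -/

/-- `δ ∈ ℝ^n` is `(ℓ(δ_I), δ_I)` with `δ_I = argmin_{η ∈ V} ‖ξ_I + η‖` and `ℓ = ℓ_I^W`, for a
partition `I ∪ J = [n]`. -/
def IsLayeredDir (W : Submodule ℝ (Vec (Fin n))) (I J : Finset (Fin n)) (V : Submodule ℝ (Vec I))
    (ξ δ : Vec (Fin n)) : Prop :=
  coordProj I δ ∈ V ∧
  (∀ η ∈ V, ‖coordProj I ξ + coordProj I δ‖ ≤ ‖coordProj I ξ + η‖) ∧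
  coordProj J δ = lift W I J (coordProj I δ)

/-- `d` is the subspace LLS direction at `z` for `(B, N, U, V)`; `da` is the affine scaling
direction at `z`. -/
def LPData.IsLLSDir (P : LPData m n) (z da : Pt n) (B N : Finset (Fin n))
    (U : Submodule ℝ (Vec B)) (V : Submodule ℝ (Vec N)) (d : Pt n) : Prop :=
  (B.Nonempty → N.Nonempty → ∃ δp δd : Vec (Fin n),
    IsLayeredDir (P.Wx z) N B V (xi z) δp ∧ IsLayeredDir (P.Ws z) B N U (xi z) δd ∧
    d = (had (xhat z) δp, had (shat z) δd)) ∧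
  (N = ∅ → d = (0, da.2)) ∧
  (B = ∅ → d = (da.1, 0))

/-- The part `B̃` of the partition associated to `z`; `da` is the affine scaling direction. -/
def assocB (z da : Pt n) : Finset (Fin n) := {i | |da.1 i / z.1 i| < |da.2 i / z.2 i|}

/-- The threshold `τ = β / (16 √n)`. -/
def tau (β : ℝ) (n : ℕ) : ℝ := β / (16 * √n)

/-- `α` is an admissible affine scaling step-length: moving along `da` stays in `N²(2β)` before
`α`, and `α ≥ max {β / √n, 1 - ‖Δx Δs‖ / (β μ)}`. -/
def LPData.IsAffineStep (P : LPData m n) (β : ℝ) (z da : Pt n) (α : ℝ) : Prop :=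
  α ≤ sSup {a : ℝ | a ∈ Set.Icc 0 1 ∧ ∀ a' ∈ Set.Icc 0 a, z + a' • da ∈ P.N2 (2 * β)} ∧
  max (β / √n) (1 - ‖had da.1 da.2‖ / (β * gap z)) ≤ α

open Classical in
/-- The step-length for the subspace LLS direction `d`: it is `1 - 4 γ / β` with
`γ = ‖(x + Δx) (s + Δs)‖ / μ` if `‖Δx Δs‖ ≤ β μ / 4`, and no step is made along `d` otherwise. -/
def llsStep (β : ℝ) (z d : Pt n) : ℝ :=
  if ‖had d.1 d.2‖ ≤ β * gap z / 4 then
    1 - 4 * (‖had (z.1 + d.1) (z.2 + d.2)‖ / gap z) / β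
  else 0

open Classical in
/-- `z'` is a possible next iterate of the algorithm (IPM with subspace LLS) after `z`: one pass
of its `while` loop. The relation leaves open the affine step-length within its admissible range
and the choices inside Approx-SVD. -/
def LPData.Step (P : LPData m n) (β : ℝ) (z z' : Pt n) : Prop :=
  ∃ (da : Pt n) (αa : ℝ) (B N : Finset (Fin n)) (CV : Fin N.card → Vec N)
    (CU : Fin B.card → Vec B) (d zp : Pt n),
    P.IsNewtonDir 0 z da ∧ P.IsAffineStep β z da αa ∧
    B = assocB z da ∧ N = Bᶜ ∧
    IsApproxSVD (lift (P.Wx z) N B) CV ∧ IsApproxSVD (lift (P.Ws z) B N) CU ∧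
    P.IsLLSDir z da B N
      (cheapSpan (lift (P.Ws z) B N) CU (tau β n / n) ⊓ (P.Ws z).map (coordProj B))
      (cheapSpan (lift (P.Wx z) N B) CV (tau β n / n) ⊓ (P.Wx z).map (coordProj N)) d ∧
    zp = (if llsStep β z d < αa then z + αa • da else z + llsStep β z d • d) ∧
    (if 0 < inner ℝ zp.1 zp.2 then ∃ dc : Pt n, P.IsNewtonDir 1 zp dc ∧ z' = zp + dc
      else z' = zp)

/-- Every execution of the algorithm from `z` reaches `goal` after at most `k` iterations: as long
as `goal` does not hold, the algorithm has not stopped (the gap is positive), an iteration can be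
carried out, and every outcome of it reaches `goal` within the remaining iterations. -/
def LPData.ReachesWithin (P : LPData m n) (β : ℝ) (goal : Pt n → Prop) : ℕ → Pt n → Prop
  | 0, z => goal z
  | k + 1, z => goal z ∨
      (0 < inner ℝ z.1 z.2 ∧ (∃ z', P.Step β z z') ∧
        ∀ z', P.Step β z z' → LPData.ReachesWithin P β goal k z')

end SubspaceIPM

end

namespace SubspaceIPM

variable {m n : ℕ}

/-! ### Coordinates and norms -/

/-! Fix the polarizing partition `B ∪ N` and measure everything in the scaling `x̂, ŝ` of an
iterate. For any two iterates in the range of the segment, `x` on `B` and `s` on `N` agree up to a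
factor `K` polynomial in `n/γ` (`Polarized.exists_ratio_le`). Since `x̂ ŝ = μ`, the entries of `x̂`
on `N` and of `ŝ` on `B` must then shrink like the gap. So when the gap drops by a factor `r`, a
vector of `x̂⁻¹W` has its ratio of `B`-part to `N`-part multiplied by at most `K² r`, and dually for
`ŝ⁻¹W^⊥` with the roles of `B` and `N` exchanged (`Comparable.cone_Wx`, `Comparable.cone_Ws`).
`Cone` counts such cheap directions at the fixed threshold `τ/n²`. The two counts `a`, `b` are at
most `n`, and they survive any drop of the gap by more than `K²`.

Compare `z` with a later iterate `z'` whose gap is smaller by a factor `r`, and suppose neither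
count is larger at `z'`. Then at `z` there is no `(a+1)`-dimensional cheap subspace even at the much
larger threshold `(τ/n²)/(K² r)`. But `(x' - x)/x̂` lies in `x̂⁻¹W`, nearly equals `-ξ` on `N` and
is bounded on `B`. Adjoining it to a cheap subspace would enlarge the count, unless that subspace
nearly contains `ξ_N` already (`dist_le_of_not_cone`). The subspace found by Approx-SVD is large and
cheap enough for this argument, so the layered direction cancels `ξ_N` up to an error proportional
to `r` at small cost on `B`; the dual side is symmetric. The same near-solutions force `B̃ = B`. One
iteration from `z` therefore brings the gap down to a polynomial in `n/γ` times the gap of `z'`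
(`Step.gap_le_of_not_cone`).

Every iteration also multiplies the gap by at most `1 - β/(2√n)`, so `T = O(√n log(n/γ))` further
iterations gain more than that polynomial. Taking for `z'` the iterate after `1 + T` iterations
gives a contradiction unless a count has grown. As `a + b ≤ 2n`, there are at most `2n + 1` rounds
of `T + 1` iterations (`reachesWithin_of_cone`). -/

@[simp] theorem had_apply (u v : Vec (Fin n)) (i : Fin n) : had u v i = u i * v i := rfl

@[simp] theorem hadL_apply (u v : Vec (Fin n)) (i : Fin n) : hadL u v i = u i * v i := rfl

@[simp] theorem hinv_apply (u : Vec (Fin n)) (i : Fin n) : hinv u i = (u i)⁻¹ := rfl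

@[simp] theorem ones_apply (i : Fin n) : ones n i = 1 := rfl

@[simp] theorem coordProj_apply (I : Finset (Fin n)) (v : Vec (Fin n)) (i : I) :
    coordProj I v i = v i := rfl

theorem inner_eq_sum {ι : Type} [Fintype ι] (u v : Vec ι) : inner ℝ u v = ∑ i, u i * v i := by
  simp [PiLp.inner_apply, mul_comm]

theorem norm_sq_eq_sum {ι : Type} [Fintype ι] (u : Vec ι) : ‖u‖ ^ 2 = ∑ i, u i ^ 2 := by
  rw [EuclideanSpace.norm_sq_eq]; simp

theorem abs_apply_le_norm {ι : Type} [Fintype ι] (u : Vec ι) (i : ι) : |u i| ≤ ‖u‖ := by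
  simpa using PiLp.norm_apply_le u i

theorem norm_le_of_forall_abs_le {ι κ : Type} [Fintype ι] [Fintype κ] (u : Vec ι) (v : Vec κ)
    {c : ℝ} (hc : 0 ≤ c) (h : ∑ i, u i ^ 2 ≤ c ^ 2 * ∑ i, v i ^ 2) : ‖u‖ ≤ c * ‖v‖ := by
  apply le_of_sq_le_sq _ (by positivity)
  rw [mul_pow, norm_sq_eq_sum, norm_sq_eq_sum]; exact h

theorem norm_le_mul_norm {ι : Type} [Fintype ι] (u v : Vec ι) {c : ℝ} (hc : 0 ≤ c)
    (h : ∀ i, |u i| ≤ c * |v i|) : ‖u‖ ≤ c * ‖v‖ := by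
  refine norm_le_of_forall_abs_le u v hc ?_
  rw [Finset.mul_sum]
  refine Finset.sum_le_sum fun i _ => ?_
  rw [← sq_abs (u i), ← sq_abs (v i), ← mul_pow]
  exact pow_le_pow_left₀ (abs_nonneg _) (h i) 2

theorem norm_le_sqrt_card {ι : Type} [Fintype ι] (u : Vec ι) {c : ℝ} (hc : 0 ≤ c)
    (h : ∀ i, |u i| ≤ c) {N : ℕ} (hN : Fintype.card ι ≤ N) : ‖u‖ ≤ c * √N := by
  apply le_of_sq_le_sq _ (by positivity)
  rw [mul_pow, Real.sq_sqrt (by positivity), norm_sq_eq_sum]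
  calc ∑ i, u i ^ 2 ≤ ∑ _i : ι, c ^ 2 := Finset.sum_le_sum fun i _ => by
        rw [← sq_abs]; exact pow_le_pow_left₀ (abs_nonneg _) (h i) 2
    _ = Fintype.card ι * c ^ 2 := by simp
    _ ≤ c ^ 2 * N := by
        rw [mul_comm]; gcongr

theorem norm_had_le {ι : Type} [Fintype ι] (u v w : Vec ι) {c : ℝ} (hc : 0 ≤ c)
    (h : ∀ i, |w i| ≤ |u i| * |v i|) (hu : ∀ i, |u i| ≤ c) : ‖w‖ ≤ c * ‖v‖ :=
  norm_le_mul_norm _ _ hc fun i => (h i).trans (by gcongr; exact hu i)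

theorem sum_coe_compl (I : Finset (Fin n)) (f : Fin n → ℝ) :
    ∑ i, f i = ∑ i : I, f i + ∑ i : (Iᶜ : Finset (Fin n)), f i := by
  rw [Finset.sum_coe_sort I f, Finset.sum_coe_sort Iᶜ f, Finset.sum_add_sum_compl]

theorem norm_sq_coordProj_add (I : Finset (Fin n)) (v : Vec (Fin n)) :
    ‖v‖ ^ 2 = ‖coordProj I v‖ ^ 2 + ‖coordProj Iᶜ v‖ ^ 2 := by
  simp only [norm_sq_eq_sum, coordProj_apply]
  exact sum_coe_compl I fun i => v i ^ 2

theorem norm_coordProj_le (I : Finset (Fin n)) (v : Vec (Fin n)) : ‖coordProj I v‖ ≤ ‖v‖ := by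
  apply le_of_sq_le_sq _ (by positivity)
  rw [norm_sq_coordProj_add I v]; nlinarith [sq_nonneg ‖coordProj Iᶜ v‖]

theorem norm_le_coordProj_add (I : Finset (Fin n)) (v : Vec (Fin n)) :
    ‖v‖ ≤ ‖coordProj I v‖ + ‖coordProj Iᶜ v‖ := by
  apply le_of_sq_le_sq _ (by positivity)
  rw [norm_sq_coordProj_add I v]
  nlinarith [norm_nonneg (coordProj I v), norm_nonneg (coordProj Iᶜ v)]

theorem eq_of_coordProj_eq (I : Finset (Fin n)) {u v : Vec (Fin n)}
    (h : coordProj I u = coordProj I v) (h' : coordProj Iᶜ u = coordProj Iᶜ v) : u = v := by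
  have := norm_le_coordProj_add I (u - v)
  simp only [map_sub, h, h', sub_self, norm_zero, add_zero] at this
  exact sub_eq_zero.1 (norm_le_zero_iff.1 this)

/-- `‖a b‖ ≤ (‖a‖² + ‖b‖²) / 2`. -/
theorem norm_had_le_half (a b : Vec (Fin n)) : ‖had a b‖ ≤ (‖a‖ ^ 2 + ‖b‖ ^ 2) / 2 := by
  have h : ‖had a b‖ ≤ ‖a‖ * ‖b‖ := norm_le_mul_norm _ _ (norm_nonneg _) fun i => by
    rw [had_apply, abs_mul]; gcongr; exact abs_apply_le_norm a i
  nlinarith [sq_nonneg (‖a‖ - ‖b‖)]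

/-! ### Rescaled subspaces -/

theorem inner_hadL_left (g u v : Vec (Fin n)) : inner ℝ (hadL g u) v = inner ℝ u (hadL g v) := by
  simp only [inner_eq_sum, hadL_apply]
  exact Finset.sum_congr rfl fun i _ => by ring

theorem mem_map_hadL {g h : Vec (Fin n)} (hg : ∀ i, g i * h i = 1) (W : Submodule ℝ (Vec (Fin n)))
    (v : Vec (Fin n)) : v ∈ W.map (hadL g) ↔ had h v ∈ W := by
  rw [Submodule.mem_map]
  constructor
  · rintro ⟨w, hw, rfl⟩
    convert hw using 1
    ext i
    simp only [had_apply, hadL_apply]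
    rw [← mul_assoc, mul_comm (h i), hg, one_mul]
  · intro hv
    refine ⟨_, hv, ?_⟩
    ext i
    simp only [had_apply, hadL_apply]
    rw [← mul_assoc, hg, one_mul]

/-- Diagonal scalings are self-adjoint, so the orthogonal complement of a scaled subspace carries
the inverse scaling. -/
theorem orthogonal_map_hadL {g h : Vec (Fin n)} (hg : ∀ i, g i * h i = 1)
    (W : Submodule ℝ (Vec (Fin n))) : (W.map (hadL g))ᗮ = Wᗮ.map (hadL h) := by
  ext v
  rw [mem_map_hadL (fun i => by rw [mul_comm]; exact hg i), Submodule.mem_orthogonal,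
    Submodule.mem_orthogonal]
  constructor
  · intro H u hu
    rw [← H (hadL g u) (Submodule.mem_map_of_mem hu), inner_hadL_left]; rfl
  · intro H u hu
    obtain ⟨w, hw, rfl⟩ := Submodule.mem_map.1 hu
    rw [inner_hadL_left]; exact H w hw

/-! ### Feasibility -/

theorem LPData.mem_W (P : LPData m n) (v : Vec (Fin n)) :
    v ∈ P.W ↔ P.A.mulVec (fun i => v i) = 0 := Iff.rfl

theorem LPData.W_eq_ker (P : LPData m n) : P.W = LinearMap.ker (Matrix.toEuclideanLin P.A) := by
  ext v
  rw [P.mem_W, LinearMap.mem_ker]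
  constructor
  · intro h; ext i
    exact congrFun h i
  · intro h; funext i
    exact congrArg (fun u : Vec (Fin m) => u i) h

theorem LPData.mem_W_orthogonal (P : LPData m n) (v : Vec (Fin n)) :
    v ∈ P.Wᗮ ↔ ∃ y : Fin m → ℝ, P.A.transpose.mulVec y = fun i => v i := by
  rw [P.W_eq_ker, LinearMap.orthogonal_ker, ← Matrix.toEuclideanLin_conjTranspose_eq_adjoint,
    LinearMap.mem_range]
  constructor
  · rintro ⟨y, rfl⟩
    exact ⟨fun i => y i, by simp [Matrix.conjTranspose]; rfl⟩
  · rintro ⟨y, hy⟩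
    refine ⟨WithLp.toLp 2 y, ?_⟩
    ext i
    rw [← congrFun hy i]
    simp [Matrix.conjTranspose]; rfl

theorem LPData.primalPos_sub_mem {P : LPData m n} {x x' : Vec (Fin n)} (hx : x ∈ P.primalPos)
    (hx' : x' ∈ P.primalPos) : x - x' ∈ P.W := by
  rw [P.mem_W]
  have h : (fun i => (x - x') i) = (fun i => x i) - (fun i => x' i) := by ext i; simp
  rw [h, Matrix.mulVec_sub, hx.1, hx'.1, sub_self]

theorem LPData.primalPos_of_sub_mem {P : LPData m n} {x x' : Vec (Fin n)} (hx : x ∈ P.primalPos)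
    (h : x' - x ∈ P.W) (hpos : ∀ i, 0 < x' i) : x' ∈ P.primalPos := by
  refine ⟨?_, hpos⟩
  rw [P.mem_W] at h
  have h' : (fun i => x' i) = (fun i => (x' - x) i) + (fun i => x i) := by ext i; simp
  rw [h', Matrix.mulVec_add, h, hx.1, zero_add]

theorem LPData.dualPos_sub_mem {P : LPData m n} {s s' : Vec (Fin n)} (hs : s ∈ P.dualPos)
    (hs' : s' ∈ P.dualPos) : s - s' ∈ P.Wᗮ := by
  rw [P.mem_W_orthogonal]
  obtain ⟨⟨y, hy⟩, -⟩ := hs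
  obtain ⟨⟨y', hy'⟩, -⟩ := hs'
  refine ⟨y' - y, ?_⟩
  rw [Matrix.mulVec_sub]
  funext i
  have h1 := congrFun hy i
  have h2 := congrFun hy' i
  simp only [Pi.add_apply, Pi.sub_apply, PiLp.sub_apply] at *
  linarith

theorem LPData.dualPos_of_sub_mem {P : LPData m n} {s s' : Vec (Fin n)} (hs : s ∈ P.dualPos)
    (h : s' - s ∈ P.Wᗮ) (hpos : ∀ i, 0 < s' i) : s' ∈ P.dualPos := by
  refine ⟨?_, hpos⟩
  obtain ⟨⟨y, hy⟩, -⟩ := hs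
  obtain ⟨y', hy'⟩ := (P.mem_W_orthogonal _).1 h
  refine ⟨y - y', ?_⟩
  rw [Matrix.mulVec_sub]
  funext i
  have h1 := congrFun hy i
  have h2 := congrFun hy' i
  simp only [Pi.add_apply, Pi.sub_apply, PiLp.sub_apply] at *
  linarith

theorem LPData.inner_eq_zero {P : LPData m n} {u v : Vec (Fin n)} (hu : u ∈ P.W) (hv : v ∈ P.Wᗮ) :
    ∑ i, u i * v i = 0 := by
  rw [← inner_eq_sum]; exact (Submodule.mem_orthogonal _ _).1 hv u hu

theorem gap_eq (z : Pt n) : gap z = (∑ i, z.1 i * z.2 i) / n := by rw [gap, inner_eq_sum]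

theorem sum_eq_gap (hn : 0 < n) (z : Pt n) : ∑ i, z.1 i * z.2 i = n * gap z := by
  rw [gap_eq]; field_simp

theorem gap_pos_of_pos (hn : 0 < n) {z : Pt n} (hx : ∀ i, 0 < z.1 i) (hs : ∀ i, 0 < z.2 i) :
    0 < gap z := by
  rw [gap_eq]
  have : Nonempty (Fin n) := ⟨⟨0, hn⟩⟩
  have : 0 < ∑ i, z.1 i * z.2 i :=
    Finset.sum_pos (fun i _ => mul_pos (hx i) (hs i)) Finset.univ_nonempty
  positivity

theorem pos_of_gap_ne_zero {z : Pt n} (h : gap z ≠ 0) : 0 < n := by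
  rcases Nat.eq_zero_or_pos n with rfl | hn
  · simp [gap] at h
  · exact hn

/-- Duality: `⟨x, s'⟩ + ⟨x', s⟩ = ⟨x, s⟩ + ⟨x', s'⟩` for feasible pairs. -/
theorem LPData.sum_cross {P : LPData m n} {z z' : Pt n} (hx : z.1 ∈ P.primalPos)
    (hs : z.2 ∈ P.dualPos) (hx' : z'.1 ∈ P.primalPos) (hs' : z'.2 ∈ P.dualPos) (hn : 0 < n) :
    ∑ i, (z.1 i * z'.2 i + z'.1 i * z.2 i) = n * (gap z + gap z') := by
  have h := P.inner_eq_zero (P.primalPos_sub_mem hx hx') (P.dualPos_sub_mem hs hs')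
  have e : ∑ i, (z.1 i * z'.2 i + z'.1 i * z.2 i) =
      ∑ i, z.1 i * z.2 i + ∑ i, z'.1 i * z'.2 i - ∑ i, (z.1 - z'.1) i * (z.2 - z'.2) i := by
    rw [← Finset.sum_add_distrib, ← Finset.sum_sub_distrib]
    exact Finset.sum_congr rfl fun i _ => by simp; ring
  rw [e, h, sum_eq_gap hn, sum_eq_gap hn]; ring

/-! ### The neighbourhood -/

theorem norm_smul_sub_ones_le_iff {z : Pt n} (h : 0 < gap z) (β : ℝ) :
    ‖(gap z)⁻¹ • had z.1 z.2 - ones n‖ ≤ β ↔ ‖had z.1 z.2 - gap z • ones n‖ ≤ β * gap z := by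
  have e : had z.1 z.2 - gap z • ones n = gap z • ((gap z)⁻¹ • had z.1 z.2 - ones n) := by
    rw [smul_sub, smul_inv_smul₀ h.ne']
  rw [e, norm_smul, Real.norm_of_nonneg h.le, mul_comm β, mul_le_mul_iff_right₀ h]

theorem LPData.mem_N2_iff (P : LPData m n) (hn : 0 < n) (β : ℝ) (z : Pt n) :
    z ∈ P.N2 β ↔ z.1 ∈ P.primalPos ∧ z.2 ∈ P.dualPos ∧
      ‖had z.1 z.2 - gap z • ones n‖ ≤ β * gap z := by
  constructor
  · rintro ⟨h1, h2, h3⟩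
    exact ⟨h1, h2, (norm_smul_sub_ones_le_iff (gap_pos_of_pos hn h1.2 h2.2) β).1 h3⟩
  · rintro ⟨h1, h2, h3⟩
    exact ⟨h1, h2, (norm_smul_sub_ones_le_iff (gap_pos_of_pos hn h1.2 h2.2) β).2 h3⟩

theorem LPData.N2_mul_bounds {P : LPData m n} (hn : 0 < n) {β : ℝ} {z : Pt n} (hz : z ∈ P.N2 β)
    (i : Fin n) : (1 - β) * gap z ≤ z.1 i * z.2 i ∧ z.1 i * z.2 i ≤ (1 + β) * gap z := by
  have h := (abs_apply_le_norm _ i).trans ((P.mem_N2_iff hn β z).1 hz).2.2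
  simp only [PiLp.sub_apply, PiLp.smul_apply, had_apply, ones_apply, smul_eq_mul, mul_one] at h
  rw [abs_le] at h
  constructor <;> linarith [h.1, h.2]

/-! ### Newton directions -/

/-- Scaling the primal part by `√(s/x)` and the dual part by `√(x/s)` turns the two spaces into
orthogonal complements. The system becomes the orthogonal decomposition of `h / √(x s)`. -/
theorem LPData.exists_newton (P : LPData m n) {x s : Vec (Fin n)} (hx : ∀ i, 0 < x i)
    (hs : ∀ i, 0 < s i) (h : Vec (Fin n)) :
    ∃ d : Pt n, d.1 ∈ P.W ∧ d.2 ∈ P.Wᗮ ∧ had s d.1 + had x d.2 = h := by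
  set g : Vec (Fin n) := WithLp.toLp 2 fun i => √(s i) / √(x i) with hg
  set g' : Vec (Fin n) := WithLp.toLp 2 fun i => √(x i) / √(s i) with hg'
  have hx' : ∀ i, 0 < √(x i) := fun i => Real.sqrt_pos.2 (hx i)
  have hs' : ∀ i, 0 < √(s i) := fun i => Real.sqrt_pos.2 (hs i)
  have hgg : ∀ i, g i * g' i = 1 := fun i => by
    simp only [hg, hg']; have := hx' i; have := hs' i; field_simp
  set r : Vec (Fin n) := WithLp.toLp 2 fun i => h i / (√(x i) * √(s i)) with hr
  set K := P.W.map (hadL g) with hK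
  obtain ⟨a, h1, b, h2, hab⟩ : ∃ a ∈ K, ∃ b ∈ Kᗮ, a + b = r :=
    ⟨_, Submodule.starProjection_apply_mem K r, _, Submodule.sub_starProjection_mem_orthogonal r,
      add_sub_cancel _ _⟩
  rw [hK, orthogonal_map_hadL hgg, mem_map_hadL (fun i => by rw [mul_comm]; exact hgg i)] at h2
  rw [hK, mem_map_hadL hgg] at h1
  refine ⟨(_, _), h1, h2, ?_⟩
  ext i
  simp only [PiLp.add_apply, had_apply, hadL_apply]
  have e1 : x i = √(x i) ^ 2 := (Real.sq_sqrt (hx i).le).symm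
  have e2 : s i = √(s i) ^ 2 := (Real.sq_sqrt (hs i).le).symm
  have e3 : h i = r i * (√(x i) * √(s i)) := by
    simp only [hr]; have := hx' i; have := hs' i; field_simp
  have e4 : s i * g' i = √(x i) * √(s i) := by
    simp only [hg']; have := hs' i; nth_rewrite 1 [e2]; field_simp
  have e5 : x i * g i = √(x i) * √(s i) := by
    simp only [hg]; have := hx' i; nth_rewrite 1 [e1]; field_simp
  change s i * (g' i * a i) + x i * (g i * b i) = h i
  rw [← mul_assoc, ← mul_assoc, e4, e5, e3, ← hab, PiLp.add_apply]; ring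

theorem LPData.exists_isNewtonDir (P : LPData m n) (ν : ℝ) {z : Pt n} (hx : ∀ i, 0 < z.1 i)
    (hs : ∀ i, 0 < z.2 i) : ∃ d, P.IsNewtonDir ν z d := P.exists_newton hx hs _

/-- `‖Δx Δs‖ ≤ ½ ∑ hᵢ² / (xᵢ sᵢ)` when `s Δx + x Δs = h`. -/
theorem norm_had_newton_le {x s h : Vec (Fin n)} {d : Pt n} (hx : ∀ i, 0 < x i)
    (hs : ∀ i, 0 < s i) (hd : ∑ i, d.1 i * d.2 i = 0) (hh : had s d.1 + had x d.2 = h) :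
    ‖had d.1 d.2‖ ≤ (∑ i, h i ^ 2 / (x i * s i)) / 2 := by
  -- The scaled parts `a`, `b` have product `Δx Δs`, are orthogonal, and sum to `h / √(x s)`; the
  -- claim is then Pythagoras.
  set a : Vec (Fin n) := WithLp.toLp 2 fun i => √(s i / x i) * d.1 i with ha
  set b : Vec (Fin n) := WithLp.toLp 2 fun i => √(x i / s i) * d.2 i with hb
  have hab : ∀ i, a i * b i = d.1 i * d.2 i := fun i => by
    simp only [ha, hb]
    have := hx i; have := hs i
    rw [mul_mul_mul_comm, ← Real.sqrt_mul (by positivity)]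
    have : s i / x i * (x i / s i) = 1 := by field_simp
    rw [this, Real.sqrt_one, one_mul]
  have e : had d.1 d.2 = had a b := by ext i; rw [had_apply, had_apply, hab]
  rw [e]
  refine (norm_had_le_half a b).trans (le_of_eq ?_)
  congr 1
  have : ‖a‖ ^ 2 + ‖b‖ ^ 2 = ∑ i, (a i ^ 2 + b i ^ 2) + 2 * ∑ i, d.1 i * d.2 i := by
    rw [hd, norm_sq_eq_sum, norm_sq_eq_sum, Finset.sum_add_distrib]; ring
  rw [this, Finset.mul_sum, ← Finset.sum_add_distrib]
  refine Finset.sum_congr rfl fun i _ => ?_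
  have h0 := hx i
  have h1 := hs i
  have ea : a i ^ 2 = s i / x i * d.1 i ^ 2 := by
    simp only [ha]; rw [mul_pow, Real.sq_sqrt (by positivity)]
  have eb : b i ^ 2 = x i / s i * d.2 i ^ 2 := by
    simp only [hb]; rw [mul_pow, Real.sq_sqrt (by positivity)]
  have eh : h i = s i * d.1 i + x i * d.2 i := by rw [← hh]; rfl
  rw [ea, eb, eh]; field_simp; ring

/-! ### Moving along a direction -/

@[simp] theorem add_smul_fst_apply (z d : Pt n) (α : ℝ) (i : Fin n) :
    (z + α • d).1 i = z.1 i + α * d.1 i := rfl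

@[simp] theorem add_smul_snd_apply (z d : Pt n) (α : ℝ) (i : Fin n) :
    (z + α • d).2 i = z.2 i + α * d.2 i := rfl

/-- The deviation of `x s` from its mean. -/
noncomputable def dev (z : Pt n) : Vec (Fin n) := had z.1 z.2 - gap z • ones n

@[simp] theorem dev_apply (z : Pt n) (i : Fin n) : dev z i = z.1 i * z.2 i - gap z := by
  simp [dev]

theorem continuous_line (z d : Pt n) : Continuous fun α : ℝ => z + α • d := by fun_prop

theorem continuous_gap : Continuous (gap : Pt n → ℝ) := by
  unfold gap; fun_prop

theorem continuous_dev : Continuous (dev : Pt n → Vec (Fin n)) := by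
  rw [show (dev : Pt n → Vec (Fin n)) = fun z => WithLp.toLp 2 fun i => z.1 i * z.2 i - gap z from
    funext fun z => by ext i; simp]
  refine (PiLp.continuous_toLp 2 _).comp (continuous_pi fun i => ?_)
  have := continuous_gap (n := n)
  fun_prop

/-- Since `θ < 1`, the deviation bound keeps every product `xᵢ sᵢ` positive, so no coordinate of `x`
or `s` can vanish on the way. Only the gap and the deviation have to be controlled along a line. -/
theorem LPData.mem_N2_of_path {P : LPData m n} (hn : 0 < n) {z d : Pt n} {α₀ θ : ℝ}
    (hθ : θ < 1) (hx : z.1 ∈ P.primalPos) (hs : z.2 ∈ P.dualPos) (hd1 : d.1 ∈ P.W)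
    (hd2 : d.2 ∈ P.Wᗮ)
    (h : ∀ α ∈ Set.Icc 0 α₀, 0 < gap (z + α • d) ∧ ‖dev (z + α • d)‖ ≤ θ * gap (z + α • d)) :
    ∀ α ∈ Set.Icc 0 α₀, z + α • d ∈ P.N2 θ := by
  have hprod : ∀ α ∈ Set.Icc 0 α₀, ∀ i, 0 < (z.1 i + α * d.1 i) * (z.2 i + α * d.2 i) := by
    intro α hα i
    obtain ⟨h1, h2⟩ := h α hα
    have h3 := (abs_le.1 ((abs_apply_le_norm _ i).trans h2)).1
    rw [dev_apply, add_smul_fst_apply, add_smul_snd_apply] at h3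
    nlinarith
  have key : ∀ (a b : ℝ), 0 < a → ∀ α ∈ Set.Icc 0 α₀, (∀ α' ∈ Set.Icc 0 α₀, a + α' * b ≠ 0) →
      0 < a + α * b := by
    intro a b ha α hα hne
    by_contra! hle
    have hb : b < 0 := by
      by_contra! hb
      nlinarith [mul_nonneg hα.1 hb]
    refine hne (a / -b) ⟨by apply div_nonneg ha.le; linarith, ?_⟩ ?_
    · refine le_trans ?_ hα.2
      rw [div_le_iff₀ (by linarith)]; linarith
    · have : b ≠ 0 := hb.ne
      field_simp; ring
  intro α hα
  have px : ∀ i, 0 < (z + α • d).1 i := fun i => key _ _ (hx.2 i) α hα fun α' hα' (h0 : z.1 i + α' * d.1 i = 0) => by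
    have := hprod α' hα' i
    rw [h0, zero_mul] at this; exact this.false
  have ps : ∀ i, 0 < (z + α • d).2 i := fun i => key _ _ (hs.2 i) α hα fun α' hα' (h0 : z.2 i + α' * d.2 i = 0) => by
    have := hprod α' hα' i
    rw [h0, mul_zero] at this; exact this.false
  rw [P.mem_N2_iff hn]
  refine ⟨P.primalPos_of_sub_mem hx ?_ px, P.dualPos_of_sub_mem hs ?_ ps, (h α hα).2⟩
  · have : (z + α • d).1 - z.1 = α • d.1 := by simp
    rw [this]; exact P.W.smul_mem _ hd1
  · have : (z + α • d).2 - z.2 = α • d.2 := by simp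
    rw [this]; exact P.Wᗮ.smul_mem _ hd2

/-- The quadratic term of `⟨x, s⟩` along the line is `⟨Δx, Δs⟩ = 0`. -/
theorem gap_line {z d : Pt n} (hd : ∑ i, d.1 i * d.2 i = 0) (α : ℝ) :
    gap (z + α • d) = (1 - α) * gap z + α * gap (z + d) := by
  have h1 : ∑ i, (z + α • d).1 i * (z + α • d).2 i =
      (1 - α) * ∑ i, z.1 i * z.2 i + α * ∑ i, (z + d).1 i * (z + d).2 i
        - α * (1 - α) * ∑ i, d.1 i * d.2 i := by
    rw [Finset.mul_sum, Finset.mul_sum, Finset.mul_sum, ← Finset.sum_add_distrib,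
      ← Finset.sum_sub_distrib]
    refine Finset.sum_congr rfl fun i _ => ?_
    rw [add_smul_fst_apply, add_smul_snd_apply]
    simp only [Prod.fst_add, Prod.snd_add, PiLp.add_apply]
    ring
  rw [gap_eq, gap_eq, gap_eq, h1, hd]; ring

theorem dev_line {z d : Pt n} (hd : ∑ i, d.1 i * d.2 i = 0) (α : ℝ) :
    dev (z + α • d) =
      (1 - α) • dev z + α • dev (z + d) - (α * (1 - α)) • had d.1 d.2 := by
  ext i
  simp only [dev_apply, PiLp.sub_apply, PiLp.add_apply, PiLp.smul_apply, gap_line hd α, smul_eq_mul,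
    had_apply, Prod.fst_add, Prod.snd_add, Prod.smul_fst, Prod.smul_snd]
  ring

/-- Subtracting the mean is the orthogonal projection along the all-ones vector. -/
theorem norm_dev_le (z : Pt n) : ‖dev z‖ ≤ ‖had z.1 z.2‖ := by
  rcases Nat.eq_zero_or_pos n with rfl | hn
  · simp [Subsingleton.elim (dev z) 0]
  apply le_of_sq_le_sq _ (by positivity)
  rw [norm_sq_eq_sum, norm_sq_eq_sum]
  have h : ∑ i, dev z i ^ 2 = ∑ i, had z.1 z.2 i ^ 2 - 2 * gap z * ∑ i, z.1 i * z.2 i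
      + n * gap z ^ 2 := by
    rw [Finset.mul_sum, ← Finset.sum_sub_distrib]
    have : (n : ℝ) * gap z ^ 2 = ∑ _i : Fin n, gap z ^ 2 := by simp
    rw [this, ← Finset.sum_add_distrib]
    refine Finset.sum_congr rfl fun i _ => ?_
    simp only [dev_apply, had_apply]; ring
  rw [h, sum_eq_gap hn]
  have : 0 ≤ n * gap z ^ 2 := by positivity
  nlinarith

theorem abs_gap_le (hn : 0 < n) (z : Pt n) : |gap z| ≤ ‖had z.1 z.2‖ / √n := by
  have hn' : (0 : ℝ) < n := by exact_mod_cast hn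
  rw [le_div_iff₀ (Real.sqrt_pos.2 hn')]
  apply le_of_sq_le_sq _ (norm_nonneg _)
  rw [mul_pow, sq_abs, Real.sq_sqrt hn'.le, norm_sq_eq_sum, gap_eq, div_pow]
  have h := sq_sum_le_card_mul_sum_sq (s := Finset.univ) (f := fun i => z.1 i * z.2 i)
  rw [Finset.card_univ, Fintype.card_fin] at h
  simp only [had_apply]
  rw [div_mul_eq_mul_div, div_le_iff₀ (by positivity)]
  nlinarith

/-! ### The affine scaling step -/

theorem LPData.IsNewtonDir.apply_zero {P : LPData m n} {z d : Pt n} (h : P.IsNewtonDir 0 z d)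
    (i : Fin n) : z.2 i * d.1 i + z.1 i * d.2 i = - (z.1 i * z.2 i) := by
  have := congrArg (fun v : Vec (Fin n) => v i) h.2.2
  simpa using this

theorem LPData.IsNewtonDir.apply_one {P : LPData m n} {z d : Pt n} (h : P.IsNewtonDir 1 z d)
    (i : Fin n) : z.2 i * d.1 i + z.1 i * d.2 i = gap z - z.1 i * z.2 i := by
  have := congrArg (fun v : Vec (Fin n) => v i) h.2.2
  simpa using this

theorem LPData.IsNewtonDir.had_add_eq {P : LPData m n} {z d : Pt n} (h : P.IsNewtonDir 0 z d) :
    had (z + d).1 (z + d).2 = had d.1 d.2 := by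
  ext i
  have := h.apply_zero i
  simp only [had_apply, Prod.fst_add, Prod.snd_add, PiLp.add_apply]
  linarith

theorem LPData.IsNewtonDir.sum_eq_zero {P : LPData m n} {ν : ℝ} {z d : Pt n}
    (h : P.IsNewtonDir ν z d) : ∑ i, d.1 i * d.2 i = 0 := P.inner_eq_zero h.1 h.2.1

theorem LPData.IsNewtonDir.gap_line_zero {P : LPData m n} {z d : Pt n} (h : P.IsNewtonDir 0 z d)
    (α : ℝ) : gap (z + α • d) = (1 - α) * gap z := by
  rw [gap_line h.sum_eq_zero, gap_eq (z + d)]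
  have := congrArg (fun v : Vec (Fin n) => ∑ i, v i) h.had_add_eq
  simp only [had_apply] at this
  rw [this, h.sum_eq_zero]; ring

theorem LPData.IsNewtonDir.dev_line_zero {P : LPData m n} {z d : Pt n} (h : P.IsNewtonDir 0 z d)
    (α : ℝ) : dev (z + α • d) = (1 - α) • dev z + α ^ 2 • had d.1 d.2 := by
  have hg := h.gap_line_zero 1
  rw [one_smul, sub_self, zero_mul] at hg
  have : dev (z + d) = had d.1 d.2 := by rw [dev, hg, zero_smul, sub_zero, h.had_add_eq]
  rw [dev_line h.sum_eq_zero, this, add_sub_assoc, ← sub_smul]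
  congr 2; ring

/-- Along the affine direction the gap is `(1-α)μ` and the deviation is `(1-α) dev z + α² Δx Δs`.
The first term uses one half of the allowance `2β`; the hypothesis, which is hardest at `α₀`, lets
the second use the other half. -/
theorem LPData.IsNewtonDir.mem_N2_of_le {P : LPData m n} (hn : 0 < n) {β : ℝ} (hβ₀ : 0 < β)
    (hβ : β ≤ 1 / 6) {z d : Pt n} (hz : z ∈ P.N2 β) (h : P.IsNewtonDir 0 z d) {α₀ : ℝ}
    (h1 : α₀ < 1) (hα : α₀ ^ 2 * ‖had d.1 d.2‖ ≤ β * gap z * (1 - α₀)) :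
    ∀ α ∈ Set.Icc 0 α₀, z + α • d ∈ P.N2 (2 * β) := by
  have hz' := (P.mem_N2_iff hn β z).1 hz
  have hg := gap_pos_of_pos hn hz'.1.2 hz'.2.1.2
  refine P.mem_N2_of_path hn (by linarith) hz'.1 hz'.2.1 h.1 h.2.1 fun α ha => ?_
  have ha1 : 0 < 1 - α := by linarith [ha.2]
  rw [h.gap_line_zero, h.dev_line_zero]
  refine ⟨by positivity, (norm_add_le _ _).trans ?_⟩
  rw [norm_smul, norm_smul, Real.norm_of_nonneg ha1.le, Real.norm_of_nonneg (sq_nonneg α)]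
  have e1 : (1 - α) * ‖dev z‖ ≤ (1 - α) * (β * gap z) :=
    mul_le_mul_of_nonneg_left hz'.2.2 ha1.le
  have e2 : α ^ 2 * ‖had d.1 d.2‖ ≤ β * gap z * (1 - α) := by
    calc α ^ 2 * ‖had d.1 d.2‖ ≤ α₀ ^ 2 * ‖had d.1 d.2‖ := by
          gcongr
          · exact ha.1
          · exact ha.2
      _ ≤ β * gap z * (1 - α₀) := hα
      _ ≤ β * gap z * (1 - α) := by gcongr; exact ha.2
  linarith

theorem LPData.IsNewtonDir.norm_had_le {P : LPData m n} (hn : 0 < n) {z d : Pt n}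
    (hx : ∀ i, 0 < z.1 i) (hs : ∀ i, 0 < z.2 i) (h : P.IsNewtonDir 0 z d) :
    ‖had d.1 d.2‖ ≤ n * gap z / 2 := by
  refine (norm_had_newton_le hx hs h.sum_eq_zero h.2.2).trans (le_of_eq ?_)
  rw [← sum_eq_gap hn]
  congr 1
  refine Finset.sum_congr rfl fun i _ => ?_
  have := hx i; have := hs i
  simp only [zero_mul, zero_smul, zero_sub, PiLp.neg_apply, had_apply, neg_sq]
  field_simp

theorem LPData.bddAbove_affine (P : LPData m n) (θ : ℝ) (z d : Pt n) :
    BddAbove {a : ℝ | a ∈ Set.Icc 0 1 ∧ ∀ a' ∈ Set.Icc 0 a, z + a' • d ∈ P.N2 θ} :=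
  ⟨1, fun _ ha => ha.1.2⟩

/-- The supremum itself is admissible; the bound `β/√n` comes from `‖Δx Δs‖ ≤ nμ/2`. -/
theorem LPData.exists_isAffineStep {P : LPData m n} (hn : 0 < n) {β : ℝ} (hβ₀ : 0 < β)
    (hβ : β ≤ 1 / 6) {z d : Pt n} (hz : z ∈ P.N2 β) (h : P.IsNewtonDir 0 z d) :
    ∃ α, P.IsAffineStep β z d α := by
  refine ⟨_, le_rfl, max_le ?_ ?_⟩
  all_goals have hz' := (P.mem_N2_iff hn β z).1 hz
  all_goals have hg := gap_pos_of_pos hn hz'.1.2 hz'.2.1.2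
  · have hn1 : (1 : ℝ) ≤ √n := Real.one_le_sqrt.2 (by exact_mod_cast hn)
    have hb : β / √n ≤ β := div_le_self hβ₀.le hn1
    have hb0 : 0 ≤ β / √n := by positivity
    refine le_csSup (P.bddAbove_affine _ z d) ⟨⟨hb0, by linarith⟩, ?_⟩
    refine h.mem_N2_of_le hn hβ₀ hβ hz (by linarith) ?_
    have h1 := h.norm_had_le hn hz'.1.2 hz'.2.1.2
    have hn' : (0 : ℝ) < n := by exact_mod_cast hn
    calc (β / √n) ^ 2 * ‖had d.1 d.2‖ ≤ (β / √n) ^ 2 * (n * gap z / 2) := by gcongr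
      _ = β * gap z * (β / 2) := by
        rw [div_pow, Real.sq_sqrt hn'.le]; field_simp
      _ ≤ β * gap z * (1 - β / √n) := by gcongr; linarith
  -- The bound is approached from below: `mem_N2_of_le` needs a step less than `1`, whereas the
  -- bound equals `1` when `Δx Δs = 0`.
  · refine le_of_forall_lt fun c hc => ?_
    rcases lt_or_ge c 0 with hc0 | hc0
    · refine hc0.trans_le (le_csSup (P.bddAbove_affine _ z d) ⟨⟨le_rfl, zero_le_one⟩, ?_⟩)
      exact h.mem_N2_of_le hn hβ₀ hβ hz zero_lt_one (by
        have : 0 ≤ β * gap z := by positivity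
        simpa using this)
    · obtain ⟨c', hcc', hc'⟩ := exists_between hc
      have hpos : 0 < β * gap z := by positivity
      have hc1 : c' < 1 := hc'.trans_le (by
        have : 0 ≤ ‖had d.1 d.2‖ / (β * gap z) := by positivity
        linarith)
      refine hcc'.trans_le (le_csSup (P.bddAbove_affine _ z d) ⟨⟨by linarith, hc1.le⟩, ?_⟩)
      refine h.mem_N2_of_le hn hβ₀ hβ hz hc1 ?_
      have : ‖had d.1 d.2‖ / (β * gap z) ≤ 1 - c' := by linarith
      rw [div_le_iff₀ hpos] at this
      calc c' ^ 2 * ‖had d.1 d.2‖ ≤ 1 * ‖had d.1 d.2‖ := by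
            gcongr
            exact pow_le_one₀ (by linarith) hc1.le
        _ ≤ β * gap z * (1 - c') := by linarith

/-- An admissible step is bounded only by a supremum, which need not be attained. The deviation
condition is closed, and a positive gap at the endpoint keeps the limit in the interior. -/
theorem LPData.mem_N2_of_lt {P : LPData m n} (hn : 0 < n) {z d : Pt n} {α θ : ℝ} (hθ : θ < 1)
    (hx : z.1 ∈ P.primalPos) (hs : z.2 ∈ P.dualPos) (hd1 : d.1 ∈ P.W)
    (hd2 : d.2 ∈ P.Wᗮ) (hα : 0 < α) (hg : 0 < gap (z + α • d))
    (h : ∀ α' ∈ Set.Ico 0 α, z + α' • d ∈ P.N2 θ) : z + α • d ∈ P.N2 θ := by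
  refine P.mem_N2_of_path hn (α₀ := α) hθ hx hs hd1 hd2 (fun α' hα' => ?_) α ⟨hα.le, le_rfl⟩
  rcases hα'.2.lt_or_eq with hlt | rfl
  · have := (P.mem_N2_iff hn _ _).1 (h α' ⟨hα'.1, hlt⟩)
    exact ⟨gap_pos_of_pos hn this.1.2 this.2.1.2, this.2.2⟩
  · refine ⟨hg, ?_⟩
    have ht : Tendsto (fun a : ℝ => z + a • d) (𝓝[<] α') (𝓝 (z + α' • d)) :=
      (continuous_line z d).continuousAt.tendsto.mono_left nhdsWithin_le_nhds
    refine le_of_tendsto_of_tendsto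
      ((continuous_dev.norm.continuousAt.tendsto).comp ht)
      (((continuous_const.mul continuous_gap).continuousAt.tendsto).comp ht) ?_
    filter_upwards [Ioo_mem_nhdsLT hα] with a ha
    exact ((P.mem_N2_iff hn _ _).1 (h a ⟨ha.1.le, ha.2⟩)).2.2

theorem LPData.mem_closure_N2_of_lt {P : LPData m n} {z d : Pt n} {α θ : ℝ} (hα : 0 < α)
    (h : ∀ α' ∈ Set.Ico 0 α, z + α' • d ∈ P.N2 θ) : z + α • d ∈ closure (P.N2 θ) := by
  have ht : Tendsto (fun a : ℝ => z + a • d) (𝓝[<] α) (𝓝 (z + α • d)) :=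
    (continuous_line z d).continuousAt.tendsto.mono_left nhdsWithin_le_nhds
  refine mem_closure_of_tendsto ht ?_
  filter_upwards [Ioo_mem_nhdsLT hα] with a ha
  exact h a ⟨ha.1.le, ha.2⟩

theorem LPData.IsAffineStep.bounds {P : LPData m n} (hn : 0 < n) {β : ℝ} (hβ₀ : 0 < β)
    {z d : Pt n} {α : ℝ} (h : P.IsAffineStep β z d α) :
    β / √n ≤ α ∧ 0 < α ∧ α ≤ 1 ∧ ∀ α' ∈ Set.Ico 0 α, z + α' • d ∈ P.N2 (2 * β) := by
  have hn' : (0 : ℝ) < √n := Real.sqrt_pos.2 (by exact_mod_cast hn)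
  have h1 : β / √n ≤ α := (le_max_left _ _).trans h.2
  have h0 : 0 < α := lt_of_lt_of_le (by positivity) h1
  have hne : {a : ℝ | a ∈ Set.Icc 0 1 ∧ ∀ a' ∈ Set.Icc 0 a, z + a' • d ∈ P.N2 (2 * β)}.Nonempty := by
    -- An empty set would have `sSup` equal to the default value `0`, below the positive lower bound
    -- on `α`.
    rw [Set.nonempty_iff_ne_empty]
    intro he
    have := h.1
    rw [he, Real.sSup_empty] at this
    linarith
  refine ⟨h1, h0, h.1.trans (csSup_le hne fun a ha => ha.1.2), fun α' hα' => ?_⟩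
  obtain ⟨a, ha, hlt⟩ := exists_lt_of_lt_csSup hne (hα'.2.trans_le h.1)
  exact ha.2 α' ⟨hα'.1, hlt.le⟩

/-! ### The layered step -/

theorem llsStep_bounds {β : ℝ} (hβ₀ : 0 < β) {z d : Pt n} (hg : 0 < gap z)
    (h0 : 0 < llsStep β z d) : ‖had d.1 d.2‖ ≤ β * gap z / 4 ∧ llsStep β z d ≤ 1 ∧
      ‖had (z + d).1 (z + d).2‖ = (1 - llsStep β z d) * (β / 4) * gap z := by
  unfold llsStep at h0 ⊢
  split_ifs at h0 ⊢ with hc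
  · refine ⟨hc, ?_, ?_⟩
    · have : 0 ≤ 4 * (‖had (z.1 + d.1) (z.2 + d.2)‖ / gap z) / β := by positivity
      linarith
    · rw [Prod.fst_add, Prod.snd_add]; field_simp; ring
  · exact absurd h0 (lt_irrefl _)

/-- For `α` below the layered step-length, the products after a full step have norm at most
`(1-α)βμ/4`. So the deviation at `α` is at most `(1-α)μ(β + β/4 + β/4)` while the gap is at least
`(1-α)μ(1 - β/4)`, and the quotient is below `2β`. -/
theorem LPData.lls_mem_N2 {P : LPData m n} (hn : 0 < n) {β : ℝ} (hβ₀ : 0 < β)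
    (hβ : β ≤ 1 / 6) {z d : Pt n} (hz : z ∈ P.N2 β) (hd1 : d.1 ∈ P.W) (hd2 : d.2 ∈ P.Wᗮ)
    (h0 : 0 < llsStep β z d) :
    ∀ α ∈ Set.Ico 0 (llsStep β z d), z + α • d ∈ P.N2 (2 * β) := by
  have hz' := (P.mem_N2_iff hn β z).1 hz
  have hg := gap_pos_of_pos hn hz'.1.2 hz'.2.1.2
  obtain ⟨hc, h1, hG⟩ := llsStep_bounds hβ₀ hg h0
  set α₀ := llsStep β z d
  intro α₁ hα₁
  refine P.mem_N2_of_path hn (α₀ := α₁) (by linarith) hz'.1 hz'.2.1 hd1 hd2 (fun α ha => ?_) α₁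
    ⟨hα₁.1, le_rfl⟩
  have hlt : α < α₀ := ha.2.trans_lt hα₁.2
  have ha1 : 0 < 1 - α := by linarith
  have hle1 : α ≤ 1 := by linarith
  have hsum := P.inner_eq_zero hd1 hd2
  have hn1 : (1 : ℝ) ≤ √n := Real.one_le_sqrt.2 (by exact_mod_cast hn)
  have hG' : ‖had (z + d).1 (z + d).2‖ ≤ (1 - α) * (β / 4) * gap z := by
    rw [hG]; gcongr
  have hgd : |gap (z + d)| ≤ (1 - α) * (β / 4) * gap z :=
    (abs_gap_le hn _).trans ((div_le_self (norm_nonneg _) hn1).trans hG')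
  have hdd : ‖dev (z + d)‖ ≤ (1 - α) * (β / 4) * gap z := (norm_dev_le _).trans hG'
  have hpos : 0 < (1 - α) * gap z := by positivity
  have hgap : (1 - α) * gap z * (1 - β / 4) ≤ gap (z + α • d) := by
    rw [gap_line hsum]
    have h2 := (abs_le.1 hgd).1
    nlinarith [ha.1, mul_nonneg ha.1 (by linarith : 0 ≤ gap (z + d) + (1 - α) * (β / 4) * gap z),
      mul_nonneg ha1.le (mul_nonneg hpos.le hβ₀.le)]
  refine ⟨lt_of_lt_of_le (by nlinarith) hgap, ?_⟩
  rw [dev_line hsum]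
  have e : ‖(1 - α) • dev z + α • dev (z + d) - (α * (1 - α)) • had d.1 d.2‖ ≤
      (1 - α) * (β * gap z) + 1 * ((1 - α) * (β / 4) * gap z)
        + (1 * (1 - α)) * (β * gap z / 4) := by
    refine (norm_sub_le _ _).trans (add_le_add ((norm_add_le _ _).trans (add_le_add ?_ ?_)) ?_)
    · rw [norm_smul, Real.norm_of_nonneg ha1.le]
      gcongr; exact hz'.2.2
    · rw [norm_smul, Real.norm_of_nonneg ha.1]
      gcongr
    · rw [norm_smul, Real.norm_of_nonneg (mul_nonneg ha.1 ha1.le)]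
      gcongr
  refine e.trans ?_
  have : (1 - α) * gap z * (1 - β / 4) * (2 * β) ≤ 2 * β * gap (z + α • d) := by
    rw [mul_comm]; gcongr
  nlinarith [mul_pos hpos hβ₀]

theorem LPData.lls_gap_le {P : LPData m n} (hn : 0 < n) {β : ℝ} (hβ₀ : 0 < β)
    {z d : Pt n} (hg : 0 < gap z) (hd1 : d.1 ∈ P.W) (hd2 : d.2 ∈ P.Wᗮ)
    (h0 : 0 < llsStep β z d) :
    gap (z + llsStep β z d • d) ≤ (1 - llsStep β z d) * (1 + β / (4 * √n)) * gap z := by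
  obtain ⟨hc, h1, hG⟩ := llsStep_bounds hβ₀ hg h0
  set α₀ := llsStep β z d
  have hn1 : (0 : ℝ) < √n := Real.sqrt_pos.2 (by exact_mod_cast hn)
  rw [gap_line (P.inner_eq_zero hd1 hd2)]
  have h2 := (le_abs_self _).trans (abs_gap_le hn (z + d))
  rw [hG] at h2
  have h3 : α₀ * gap (z + d) ≤ 1 * ((1 - α₀) * (β / 4) * gap z / √n) := by
    have : 0 ≤ (1 - α₀) * (β / 4) * gap z / √n := by
      have : 0 ≤ 1 - α₀ := by linarith
      positivity
    calc α₀ * gap (z + d) ≤ α₀ * ((1 - α₀) * (β / 4) * gap z / √n) := by gcongr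
      _ ≤ _ := by gcongr
  calc _ ≤ (1 - α₀) * gap z + 1 * ((1 - α₀) * (β / 4) * gap z / √n) := by gcongr
    _ = _ := by field_simp

/-! ### The corrector step -/

/-- The corrector preserves the gap, and the new deviation is exactly `Δx Δs`. This is quadratic in
the old deviation: at most `3β²μ`, hence at most `βμ/2` because `β ≤ 1/6`. The factor `2/3` below is
a lower bound for `1 - 2β`. -/
theorem LPData.IsNewtonDir.corrector {P : LPData m n} (hn : 0 < n) {β : ℝ} (hβ₀ : 0 < β)
    (hβ : β ≤ 1 / 6) {z d : Pt n} (hz : z ∈ P.N2 (2 * β)) (h : P.IsNewtonDir 1 z d) :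
    z + d ∈ P.N2 β ∧ gap (z + d) = gap z := by
  have hz' := (P.mem_N2_iff hn _ z).1 hz
  have hg := gap_pos_of_pos hn hz'.1.2 hz'.2.1.2
  have hn' : (n : ℝ) ≠ 0 := by positivity
  have hsum := h.sum_eq_zero
  have hgd : gap (z + d) = gap z := by
    rw [gap_eq (z + d)]
    have : ∑ i, (z + d).1 i * (z + d).2 i = ∑ i, (gap z + d.1 i * d.2 i) :=
      Finset.sum_congr rfl fun i _ => by
        have := h.apply_one i
        simp only [Prod.fst_add, Prod.snd_add, PiLp.add_apply]; linarith
    rw [this, Finset.sum_add_distrib, hsum]; simp; field_simp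
  have hdd : dev (z + d) = had d.1 d.2 := by
    ext i
    have := h.apply_one i
    rw [dev_apply, hgd]
    simp only [Prod.fst_add, Prod.snd_add, PiLp.add_apply, had_apply]; linarith
  have hnorm : ‖had d.1 d.2‖ ≤ β / 2 * gap z := by
    refine (norm_had_newton_le hz'.1.2 hz'.2.1.2 hsum h.2.2).trans ?_
    have h23 : 0 < 2 / 3 * gap z := by positivity
    have : ∑ i, ((1 * gap z) • ones n - had z.1 z.2) i ^ 2 / (z.1 i * z.2 i) ≤
        ∑ i, dev z i ^ 2 / (2 / 3 * gap z) := by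
      refine Finset.sum_le_sum fun i _ => ?_
      have e : ((1 * gap z) • ones n - had z.1 z.2) i = - dev z i := by simp
      rw [e, neg_sq]
      refine div_le_div_of_nonneg_left (sq_nonneg _) h23 ?_
      have := (P.N2_mul_bounds hn hz i).1
      nlinarith
    rw [← Finset.sum_div, ← norm_sq_eq_sum] at this
    have h3 : ‖dev z‖ ^ 2 ≤ (2 * β * gap z) ^ 2 := by gcongr; exact hz'.2.2
    have h4 : ‖dev z‖ ^ 2 / (2 / 3 * gap z) ≤ β * gap z := by
      rw [div_le_iff₀ h23]
      nlinarith [mul_pos hβ₀ (mul_pos hg hg)]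
    linarith
  -- The cruder bound along the whole segment serves only to carry positivity to the endpoint.
  have key : ∀ α ∈ Set.Icc (0 : ℝ) 1, 0 < gap (z + α • d) ∧
      ‖dev (z + α • d)‖ ≤ 2 * β * gap (z + α • d) := by
    intro α ha
    have hga : gap (z + α • d) = gap z := by rw [gap_line hsum, hgd]; ring
    rw [hga]
    refine ⟨hg, ?_⟩
    have ha1 : 0 ≤ 1 - α := by linarith [ha.2]
    have e : dev (z + α • d) = (1 - α) • dev z + α ^ 2 • had d.1 d.2 := by
      rw [dev_line hsum, hdd, add_sub_assoc, ← sub_smul]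
      congr 2; ring
    rw [e]
    refine (norm_add_le _ _).trans ?_
    rw [norm_smul, norm_smul, Real.norm_of_nonneg ha1, Real.norm_of_nonneg (sq_nonneg α)]
    have e1 : (1 - α) * ‖dev z‖ ≤ (1 - α) * (2 * β * gap z) := by gcongr; exact hz'.2.2
    have e2 : α ^ 2 * ‖had d.1 d.2‖ ≤ α * (β / 2 * gap z) := by
      refine mul_le_mul ?_ hnorm (norm_nonneg _) ha.1
      nlinarith [ha.1, ha.2]
    nlinarith [mul_nonneg ha.1 (mul_pos hβ₀ hg).le]
  have hmem := P.mem_N2_of_path hn (by linarith) hz'.1 hz'.2.1 h.1 h.2.1 key 1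
    ⟨zero_le_one, le_rfl⟩
  rw [one_smul, P.mem_N2_iff hn] at hmem
  refine ⟨(P.mem_N2_iff hn _ _).2 ⟨hmem.1, hmem.2.1, ?_⟩, hgd⟩
  change ‖dev (z + d)‖ ≤ _
  rw [hgd, hdd]
  nlinarith [mul_pos hβ₀ hg]

/-! ### The approximate singular value decomposition -/

section SVD

variable {κ ι : Type} [Fintype κ] [Fintype ι] {k : ℕ}

theorem norm_sq_sum_le {E α : Type*} [SeminormedAddCommGroup E] [Fintype α] (u : α → E) :
    ‖∑ l, u l‖ ^ 2 ≤ Fintype.card α * ∑ l, ‖u l‖ ^ 2 := by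
  calc ‖∑ l, u l‖ ^ 2 ≤ (∑ l, ‖u l‖) ^ 2 := by gcongr; exact norm_sum_le _ _
    _ ≤ _ := by
      have := sq_sum_le_card_mul_sum_sq (s := Finset.univ) (f := fun l => ‖u l‖)
      rwa [Finset.card_univ] at this

theorem norm_sq_sum_eq {E α : Type*} [NormedAddCommGroup E] [InnerProductSpace ℝ E] [Fintype α]
    (u : α → E) (h : ∀ i j, i ≠ j → inner ℝ (u i) (u j) = 0) :
    ‖∑ l, u l‖ ^ 2 = ∑ l, ‖u l‖ ^ 2 := by
  classical
  rw [← real_inner_self_eq_norm_sq, sum_inner]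
  refine Finset.sum_congr rfl fun i _ => ?_
  rw [inner_sum, Finset.sum_eq_single i (fun j _ hj => h i j hj.symm) (by simp),
    real_inner_self_eq_norm_sq]

theorem exists_fun_of_mem_span_image {E α : Type*} [AddCommGroup E] [Module ℝ E] {V : α → E}
    {A : Set α} [Fintype A] {v : E} (hv : v ∈ Submodule.span ℝ (V '' A)) :
    ∃ a : A → ℝ, v = ∑ l : A, a l • V l := by
  rw [Set.image_eq_range] at hv
  obtain ⟨a, ha⟩ := (Submodule.mem_span_range_iff_exists_fun ℝ).1 hv
  exact ⟨a, ha.symm⟩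

theorem inner_eq_zero_of_mem_span {E : Type*} [NormedAddCommGroup E] [InnerProductSpace ℝ E]
    {s : Set E} {v w : E} (hv : v ∈ Submodule.span ℝ s) (h : ∀ u ∈ s, inner ℝ u w = 0) :
    inner ℝ v w = 0 := by
  have : Submodule.span ℝ s ≤ (Submodule.span ℝ {w})ᗮ := by
    rw [Submodule.span_le]
    intro u hu
    rw [SetLike.mem_coe, Submodule.mem_orthogonal_singleton_iff_inner_left]
    exact h u hu
  exact (Submodule.mem_orthogonal_singleton_iff_inner_left).1 (this hv)

/-- Gram–Schmidt for the form `⟨N ·, N ·⟩`. The form may be degenerate, so the correction of a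
column is any preimage of the projection of its image onto the image of the earlier span. -/
theorem exists_isOrthogonalization {ι' : Type} [Fintype ι'] (N : Vec κ →ₗ[ℝ] Vec ι') (a : ℕ)
    (V : Fin k → Vec κ) : ∃ V', IsOrthogonalization N a V V' := by
  have hex : ∀ j : Fin k, ∃ u ∈ Submodule.span ℝ (V '' {l | a ≤ (l : ℕ) ∧ l < j}),
      ∀ w ∈ Submodule.span ℝ (V '' {l | a ≤ (l : ℕ) ∧ l < j}), inner ℝ (N w) (N (V j - u)) = 0 := by
    intro j
    set S := Submodule.span ℝ (V '' {l | a ≤ (l : ℕ) ∧ l < j})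
    obtain ⟨u, hu, hu'⟩ := Submodule.mem_map.1
      (Submodule.starProjection_apply_mem (S.map N) (N (V j)))
    refine ⟨u, hu, fun w hw => ?_⟩
    rw [map_sub, hu']
    exact (Submodule.mem_orthogonal _ _).1 (Submodule.sub_starProjection_mem_orthogonal _) _
      (Submodule.mem_map_of_mem hw)
  choose u hu hu' using hex
  set V' : Fin k → Vec κ := fun j => if (j : ℕ) < a then V j else V j - u j with hV'
  have e : ∀ j : Fin k, a ≤ (j : ℕ) → V' j = V j - u j := fun j hj => by
    simp [hV', not_lt.2 hj]
  have hmono : ∀ i j : Fin k, i ≤ j → ∀ U : Fin k → Vec κ,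
      Submodule.span ℝ (U '' {l | a ≤ (l : ℕ) ∧ l ≤ i}) ≤
        Submodule.span ℝ (U '' {l | a ≤ (l : ℕ) ∧ l ≤ j}) := fun i j hij U =>
    Submodule.span_mono (Set.image_mono fun l (hl : a ≤ (l : ℕ) ∧ l ≤ i) =>
      (⟨hl.1, hl.2.trans hij⟩ : a ≤ (l : ℕ) ∧ l ≤ j))
  have hlt : ∀ j : Fin k, Submodule.span ℝ (V '' {l | a ≤ (l : ℕ) ∧ l < j}) ≤
      Submodule.span ℝ (V '' {l | a ≤ (l : ℕ) ∧ l ≤ j}) := fun j =>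
    Submodule.span_mono (Set.image_mono fun l (hl : a ≤ (l : ℕ) ∧ l < j) =>
      (⟨hl.1, hl.2.le⟩ : a ≤ (l : ℕ) ∧ l ≤ j))
  have hle : ∀ j : Fin k, a ≤ (j : ℕ) →
      V' j ∈ Submodule.span ℝ (V '' {l | a ≤ (l : ℕ) ∧ l ≤ j}) := fun j hj => by
    rw [e j hj]
    exact Submodule.sub_mem _ (Submodule.subset_span ⟨j, ⟨hj, le_rfl⟩, rfl⟩)
      (hlt j (hu j))
  have hge : ∀ (p : ℕ) (j : Fin k), (j : ℕ) = p → a ≤ (j : ℕ) →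
      V j ∈ Submodule.span ℝ (V' '' {l | a ≤ (l : ℕ) ∧ l ≤ j}) := by
    intro p
    induction p using Nat.strong_induction_on with
    | _ p ih =>
      intro j hjp hj
      have : V j = V' j + u j := by rw [e j hj]; abel
      rw [this]
      refine Submodule.add_mem _ (Submodule.subset_span ⟨j, ⟨hj, le_rfl⟩, rfl⟩) ?_
      refine (Submodule.span_le.2 ?_ : _ ≤ _) (hu j)
      rintro _ ⟨l, hl, rfl⟩
      exact hmono l j hl.2.le V' (ih l (hjp ▸ hl.2) l rfl hl.1)
  have horth : ∀ j l : Fin k, a ≤ (j : ℕ) → a ≤ (l : ℕ) → l < j →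
      inner ℝ (N (V' l)) (N (V' j)) = 0 := fun j l hj hl hlt => by
    rw [e j hj]
    refine hu' j _ (Submodule.span_mono (Set.image_mono fun i hi => ?_) (hle l hl))
    exact ⟨hi.1, hi.2.trans_lt hlt⟩
  refine ⟨V', fun j hj => by simp [hV', hj], fun j _ => le_antisymm ?_ ?_, fun j l hj hl hne => ?_⟩
  · rw [Submodule.span_le]
    rintro _ ⟨l, hl, rfl⟩
    exact hmono l j hl.2 V (hle l hl.1)
  · rw [Submodule.span_le]
    rintro _ ⟨l, hl, rfl⟩
    exact hmono l j hl.2 V' (hge l l rfl hl.1)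
  · rcases lt_or_gt_of_ne hne with h | h
    · exact horth l j hl hj h
    · rw [real_inner_comm]; exact horth j l hj hl h

theorem exists_svdPass (M : Vec κ →ₗ[ℝ] Vec ι) (i : Fin k) (V : Fin k → Vec κ) :
    ∃ V', SVDPass M i V V' := by
  obtain ⟨V₁, h₁⟩ := exists_isOrthogonalization (LinearMap.id : Vec κ →ₗ[ℝ] Vec κ) 0 V
  obtain ⟨V₂, h₂⟩ := exists_isOrthogonalization M (i : ℕ) V₁
  obtain ⟨c, hc, hmin⟩ := Finset.exists_min_image (Finset.Ici i) (fun j => ratio M (V₂ j))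
    ⟨i, Finset.mem_Ici.2 le_rfl⟩
  exact ⟨_, V₁, V₂, c, h₁, h₂, Finset.mem_Ici.1 hc, fun j hj => hmin j (Finset.mem_Ici.2 hj), rfl⟩

theorem exists_isApproxSVD [DecidableEq κ] (M : Vec κ →ₗ[ℝ] Vec ι) (e : Fin k ≃ κ) :
    ∃ V : Fin k → Vec κ, IsApproxSVD M V := by
  choose f hf using fun (i : Fin k) (V : Fin k → Vec κ) => exists_svdPass M i V
  let S : ℕ → Fin k → Vec κ := fun p => Nat.rec
    (fun j => EuclideanSpace.single (e j) (1 : ℝ)) (fun p V => if h : p < k then f ⟨p, h⟩ V else V) p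
  refine ⟨S k, e, S, rfl, fun i => ?_, rfl⟩
  have : S ((i : ℕ) + 1) = f i (S i) := by
    change (if h : (i : ℕ) < k then f ⟨i, h⟩ (S i) else S i) = _
    rw [dif_pos i.2]
  rw [this]; exact hf i _

/-! ### Guarantees for the output of Approx-SVD -/

theorem ratio_smul (M : Vec κ →ₗ[ℝ] Vec ι) {c : ℝ} (hc : c ≠ 0) (v : Vec κ) :
    ratio M (c • v) = ratio M v := by
  rw [ratio, ratio, map_smul, norm_smul, norm_smul, mul_div_mul_left _ _ (norm_ne_zero_iff.2 hc)]

theorem ratio_nonneg (M : Vec κ →ₗ[ℝ] Vec ι) (v : Vec κ) : 0 ≤ ratio M v := by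
  unfold ratio; positivity

theorem ratio_mul_norm (M : Vec κ →ₗ[ℝ] Vec ι) (v : Vec κ) : ratio M v * ‖v‖ = ‖M v‖ := by
  rcases eq_or_ne v 0 with rfl | hv
  · simp
  · rw [ratio, div_mul_cancel₀ _ (norm_ne_zero_iff.2 hv)]

/-- The state before pass `p` of the loop: the first `p` columns are pairwise orthogonal, and each
has nearly minimal ratio among the vectors orthogonal to the columns before it. -/
def PartialSVD (M : Vec κ →ₗ[ℝ] Vec ι) (p : ℕ) (V : Fin k → Vec κ) : Prop :=
  Submodule.span ℝ (Set.range V) = ⊤ ∧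
  (∀ i j : Fin k, (i : ℕ) < p → j < i → inner ℝ (V j) (V i) = 0) ∧
  ∀ i : Fin k, (i : ℕ) < p → ∀ v, (∀ j < i, inner ℝ (V j) v = 0) →
    ratio M (V i) * ‖v‖ ≤ √k * ‖M v‖

theorem linearIndependent_of_span_eq_top (e : Fin k ≃ κ) {V : Fin k → Vec κ}
    (h : Submodule.span ℝ (Set.range V) = ⊤) : LinearIndependent ℝ V := by
  apply linearIndependent_of_top_le_span_of_card_eq_finrank h.ge
  rw [finrank_euclideanSpace, Fintype.card_congr e]

/-- The finished columns are already orthogonal, so reorthogonalizing only rescales them. The new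
column has minimal ratio `ϱ` among tail columns with orthogonal images: for `v = ∑ a_l V_l` in their
span, `‖M v‖² = ∑ ‖M (a_l V_l)‖² ≥ ϱ² ∑ ‖a_l V_l‖² ≥ ϱ² ‖v‖² / k`. The loss `√k` occurs because the
tail columns themselves need not be orthogonal. -/
theorem PartialSVD.pass (e : Fin k ≃ κ) {M : Vec κ →ₗ[ℝ] Vec ι} {p : Fin k} {V V' : Fin k → Vec κ}
    (h : PartialSVD M p V) (hp : SVDPass M p V V') : PartialSVD M ((p : ℕ) + 1) V' := by
  obtain ⟨hspan, horth, hratio⟩ := h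
  obtain ⟨V₁, V₂, c, ⟨-, hs1, ho1⟩, ⟨heq2, hs2, ho2⟩, hpc, hmin, rfl⟩ := hp
  have ho1' : ∀ i j, i ≠ j → inner ℝ (V₁ i) (V₁ j) = 0 := fun i j hij =>
    ho1 i j (Nat.zero_le _) (Nat.zero_le _) hij
  have hs1' : ∀ j : Fin k, Submodule.span ℝ (V₁ '' Set.Iic j) = Submodule.span ℝ (V '' Set.Iic j) :=
    fun j => by
      have := hs1 j (Nat.zero_le _)
      simpa [Set.Iic] using this
  have hspan1 : Submodule.span ℝ (Set.range V₁) = ⊤ := by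
    rw [eq_top_iff, ← hspan, Submodule.span_le]
    rintro _ ⟨j, rfl⟩
    have : V j ∈ Submodule.span ℝ (V₁ '' Set.Iic j) := by
      rw [hs1' j]; exact Submodule.subset_span ⟨j, Set.mem_Iic.2 le_rfl, rfl⟩
    exact Submodule.span_mono (Set.image_subset_range _ _) this
  have hspan2 : Submodule.span ℝ (Set.range V₂) = ⊤ := by
    rw [eq_top_iff, ← hspan1, Submodule.span_le]
    rintro _ ⟨j, rfl⟩
    rcases lt_or_ge (j : ℕ) p with hj | hj
    · rw [← heq2 j hj]; exact Submodule.subset_span ⟨j, rfl⟩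
    · have : V₁ j ∈ Submodule.span ℝ (V₂ '' {l | (p : ℕ) ≤ (l : ℕ) ∧ l ≤ j}) := by
        rw [hs2 j hj]; exact Submodule.subset_span ⟨j, ⟨hj, le_rfl⟩, rfl⟩
      exact Submodule.span_mono (Set.image_subset_range _ _) this
  -- Write `V₁ i = a V i + u` with `u` in the span of the earlier columns. Both `V₁ i` and `V i` are
  -- orthogonal to that span, so `u = 0`; independence gives `a ≠ 0`.
  have hsmul : ∀ i : Fin k, i < p → ∃ a : ℝ, a ≠ 0 ∧ V₁ i = a • V i := by
    intro i hi
    have h1 : V₁ i ∈ Submodule.span ℝ (V '' Set.Iic i) := by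
      rw [← hs1' i]; exact Submodule.subset_span ⟨i, Set.mem_Iic.2 le_rfl, rfl⟩
    have hins : Set.Iic i = insert i (Set.Iio i) := Set.Iio_insert.symm
    rw [hins, Set.image_insert_eq, Submodule.mem_span_insert] at h1
    obtain ⟨a, u, hu, hau⟩ := h1
    have hu1 : u ∈ Submodule.span ℝ (V₁ '' Set.Iio i) := by
      refine (Submodule.span_le.2 ?_ : _ ≤ _) hu
      rintro _ ⟨j, hj, rfl⟩
      have : V j ∈ Submodule.span ℝ (V₁ '' Set.Iic j) := by
        rw [hs1' j]; exact Submodule.subset_span ⟨j, Set.mem_Iic.2 le_rfl, rfl⟩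
      exact Submodule.span_mono (Set.image_mono fun l (hl : l ≤ j) => hl.trans_lt hj) this
    have hu0 : u = 0 := by
      have e1 : inner ℝ u (V₁ i) = 0 := inner_eq_zero_of_mem_span hu1 (by
        rintro _ ⟨j, hj, rfl⟩; exact ho1' j i (ne_of_lt hj))
      have e2 : inner ℝ u (V i) = 0 := inner_eq_zero_of_mem_span hu (by
        rintro _ ⟨j, hj, rfl⟩; exact horth i j hi hj)
      rw [hau, inner_add_right, inner_smul_right, e2, mul_zero, zero_add] at e1
      exact inner_self_eq_zero.1 e1
    rw [hu0, add_zero] at hau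
    refine ⟨a, ?_, hau⟩
    rintro rfl
    exact (linearIndependent_of_span_eq_top e hspan1).ne_zero i (by rw [hau, zero_smul])
  have hV' : ∀ i : Fin k, i < p → (V₂ ∘ Equiv.swap p c) i = V₁ i := fun i hi => by
    rw [Function.comp_apply, Equiv.swap_apply_of_ne_of_ne hi.ne (hi.trans_le hpc).ne, heq2 i hi]
  have hV'p : (V₂ ∘ Equiv.swap p c) p = V₂ c := by simp
  have hV2 : ∀ l : Fin k, p ≤ l → ∀ j < p, inner ℝ (V₁ j) (V₂ l) = 0 := by
    intro l hl j hj
    have : V₂ l ∈ Submodule.span ℝ (V₁ '' {i | (p : ℕ) ≤ (i : ℕ) ∧ i ≤ l}) := by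
      rw [← hs2 l hl]; exact Submodule.subset_span ⟨l, ⟨hl, le_rfl⟩, rfl⟩
    rw [real_inner_comm]
    refine inner_eq_zero_of_mem_span this ?_
    rintro _ ⟨i, hi, rfl⟩
    exact ho1' i j (ne_of_gt (hj.trans_le hi.1))
  refine ⟨?_, fun i j hi hj => ?_, fun i hi v hv => ?_⟩
  · rw [(Equiv.swap p c).surjective.range_comp]; exact hspan2
  · rcases (Nat.lt_succ_iff.1 hi).lt_or_eq with hi' | hi'
    · rw [hV' i hi', hV' j (hj.trans hi')]; exact ho1' j i hj.ne
    · have : i = p := Fin.ext hi'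
      subst this
      rw [hV'p, hV' j hj]; exact hV2 c hpc j hj
  · rcases (Nat.lt_succ_iff.1 hi).lt_or_eq with hi' | hi'
    · rw [hV' i hi']
      obtain ⟨a, ha, hai⟩ := hsmul i hi'
      rw [hai, ratio_smul M ha]
      refine hratio i hi' v fun j hj => ?_
      obtain ⟨b, hb, hbj⟩ := hsmul j (hj.trans hi')
      have := hv j hj
      rw [hV' j (hj.trans hi'), hbj, real_inner_smul_left] at this
      exact (mul_eq_zero.1 this).resolve_left hb
    · have : i = p := Fin.ext hi'
      subst this
      rw [hV'p]
      have hv1 : ∀ j < i, inner ℝ (V₁ j) v = 0 := fun j hj => by rw [← hV' j hj]; exact hv j hj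
      -- The tail of `V₂` has leading spans inside the tail of `V₁`, hence is orthogonal to the
      -- finished columns. A vector orthogonal to those columns thus has no component along them.
      have hvmem : v ∈ Submodule.span ℝ (V₂ '' Set.Ici i) := by
        have hsup : v ∈ Submodule.span ℝ (V₂ '' Set.Iio i) ⊔ Submodule.span ℝ (V₂ '' Set.Ici i) := by
          rw [← Submodule.span_union, ← Set.image_union, Set.Iio_union_Ici, Set.image_univ, hspan2]
          trivial
        obtain ⟨u, hu, w, hw, rfl⟩ := Submodule.mem_sup.1 hsup
        have huw : inner ℝ u w = 0 := by
          refine inner_eq_zero_of_mem_span hu ?_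
          rintro _ ⟨j, hj, rfl⟩
          rw [heq2 j hj, real_inner_comm]
          refine inner_eq_zero_of_mem_span hw ?_
          rintro _ ⟨l, hl, rfl⟩
          rw [real_inner_comm]; exact hV2 l hl j hj
        have huv : inner ℝ u (u + w) = 0 := by
          refine inner_eq_zero_of_mem_span hu ?_
          rintro _ ⟨j, hj, rfl⟩
          rw [heq2 j hj]; exact hv1 j hj
        rw [inner_add_right, huw, add_zero] at huv
        rw [inner_self_eq_zero.1 huv, zero_add]; exact hw
      classical
      obtain ⟨a, rfl⟩ := exists_fun_of_mem_span_image hvmem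
      apply le_of_sq_le_sq _ (by positivity)
      rw [mul_pow, mul_pow, Real.sq_sqrt (Nat.cast_nonneg k), map_sum,
        norm_sq_sum_eq (fun l => M (a l • V₂ l))]
      · calc ratio M (V₂ c) ^ 2 * ‖∑ l : Set.Ici i, a l • V₂ l‖ ^ 2
            ≤ ratio M (V₂ c) ^ 2 * (Fintype.card (Set.Ici i) * ∑ l, ‖a l • V₂ l‖ ^ 2) := by
              gcongr; exact norm_sq_sum_le _
          _ ≤ ratio M (V₂ c) ^ 2 * (k * ∑ l, ‖a l • V₂ l‖ ^ 2) := by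
              gcongr
              have := set_fintype_card_le_univ (Set.Ici i)
              rwa [Fintype.card_fin] at this
          _ = k * ∑ l, (ratio M (V₂ c) * ‖a l • V₂ l‖) ^ 2 := by
              simp_rw [mul_pow]; rw [← Finset.mul_sum]; ring
          _ ≤ k * ∑ l, ‖M (a l • V₂ l)‖ ^ 2 := by
              refine mul_le_mul_of_nonneg_left (Finset.sum_le_sum fun l _ => ?_) (Nat.cast_nonneg k)
              refine pow_le_pow_left₀ (mul_nonneg (ratio_nonneg _ _) (norm_nonneg _)) ?_ 2
              rw [← ratio_mul_norm M (a l • V₂ l)]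
              rcases eq_or_ne (a l) 0 with h0 | h0
              · simp [h0]
              · rw [ratio_smul M h0]
                gcongr
                exact hmin l l.2
      · intro l l' hne
        rw [map_smul, map_smul, real_inner_smul_left, real_inner_smul_right,
          ho2 l l' l.2 l'.2 (fun h => hne (Subtype.ext h))]
        simp

theorem IsApproxSVD.partialSVD [DecidableEq κ] {M : Vec κ →ₗ[ℝ] Vec ι} {V : Fin k → Vec κ}
    (h : IsApproxSVD M V) : PartialSVD M k V ∧ LinearIndependent ℝ V := by
  obtain ⟨e, S, h0, hS, rfl⟩ := h
  have key : ∀ p ≤ k, PartialSVD M p (S p) := by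
    intro p
    induction p with
    | zero =>
      intro _
      refine ⟨?_, fun i j hi => absurd hi (Nat.not_lt_zero _),
        fun i hi => absurd hi (Nat.not_lt_zero _)⟩
      rw [h0]
      have := (EuclideanSpace.basisFun κ ℝ).toBasis.span_eq
      rw [← this]
      congr 1
      ext v
      simp only [Set.mem_range, OrthonormalBasis.coe_toBasis, EuclideanSpace.basisFun_apply]
      exact ⟨fun ⟨j, hj⟩ => ⟨e j, hj⟩, fun ⟨j, hj⟩ => ⟨e.symm j, by rw [e.apply_symm_apply, hj]⟩⟩
    | succ p ih =>
      intro hp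
      exact (ih (by omega)).pass e (p := ⟨p, hp⟩) (hS ⟨p, hp⟩)
  exact ⟨key k le_rfl, linearIndependent_of_span_eq_top e (key k le_rfl).1⟩

/-- A column preceding one of ratio at most `t` has ratio at most `√k t`, by near-minimality tested
on the later column. The images of the final columns need not be orthogonal, which costs a second
`√k`. -/
theorem IsApproxSVD.norm_le_of_mem_cheapSpan [DecidableEq κ] {M : Vec κ →ₗ[ℝ] Vec ι} {V : Fin k → Vec κ}
    (h : IsApproxSVD M V) {t : ℝ} (ht : 0 ≤ t) {v : Vec κ} (hv : v ∈ cheapSpan M V t) :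
    ‖M v‖ ≤ k * t * ‖v‖ := by
  classical
  obtain ⟨⟨-, horth, hratio⟩, hli⟩ := h.partialSVD
  have hne := hli.ne_zero
  have horth' : ∀ i j, i ≠ j → inner ℝ (V i) (V j) = 0 := fun i j hij => by
    rcases lt_or_gt_of_ne hij with h | h
    · exact horth j i j.2 h
    · rw [real_inner_comm]; exact horth i j i.2 h
  obtain ⟨a, rfl⟩ := exists_fun_of_mem_span_image hv
  have hcol : ∀ l ∈ {l : Fin k | ∃ j, l ≤ j ∧ ratio M (V j) ≤ t}, ratio M (V l) ≤ √k * t := by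
    rintro l ⟨j, hlj, hj⟩
    have h1 := hratio l l.2 (V j) fun i hi => horth' i j (hi.trans_le hlj).ne
    rw [← ratio_mul_norm M (V j), ← mul_assoc] at h1
    exact (le_of_mul_le_mul_right h1 (norm_pos_iff.2 (hne j))).trans (by gcongr)
  apply le_of_sq_le_sq _ (by positivity)
  rw [mul_pow, map_sum, norm_sq_sum_eq (fun l => a l • V l)]
  · refine (norm_sq_sum_le _).trans ?_
    have hcard : (Fintype.card {l : Fin k | ∃ j, l ≤ j ∧ ratio M (V j) ≤ t} : ℝ) ≤ k := by
      have := set_fintype_card_le_univ {l : Fin k | ∃ j, l ≤ j ∧ ratio M (V j) ≤ t}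
      rw [Fintype.card_fin] at this
      exact_mod_cast this
    refine (mul_le_mul_of_nonneg_right hcard (by positivity)).trans ?_
    have hkt : ((k : ℝ) * t) ^ 2 = k * (√k * t) ^ 2 := by
      rw [mul_pow, mul_pow, Real.sq_sqrt (Nat.cast_nonneg k)]; ring
    rw [hkt, mul_assoc, Finset.mul_sum _ _ ((√k * t) ^ 2)]
    gcongr ?_ * ?_
    refine Finset.sum_le_sum fun l _ => ?_
    rw [← mul_pow, map_smul, norm_smul, norm_smul, ← ratio_mul_norm M (V l), mul_left_comm]
    have hr := ratio_nonneg M (V l)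
    refine pow_le_pow_left₀ (by positivity) ?_ 2
    gcongr
    exact hcol l l.2
  · intro l l' hll
    rw [real_inner_smul_left, real_inner_smul_right, horth' l l' fun h => hll (Subtype.ext h)]
    simp

/-- A min-max argument: a `d`-dimensional `F` contains a nonzero vector orthogonal to the first `d -
1` columns. Near-minimality then bounds the ratio of the next column, of index `d - 1`, by `√k σ ≤
t`, so the first `d` columns all enter the cheap span. -/
theorem IsApproxSVD.finrank_le_cheapSpan [DecidableEq κ] {M : Vec κ →ₗ[ℝ] Vec ι} {V : Fin k → Vec κ}
    (h : IsApproxSVD M V) {t σ : ℝ} (hσ : √k * σ ≤ t) {F : Submodule ℝ (Vec κ)}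
    (hF : ∀ v ∈ F, ‖M v‖ ≤ σ * ‖v‖) :
    Module.finrank ℝ F ≤ Module.finrank ℝ (cheapSpan M V t) := by
  classical
  obtain ⟨⟨hspan, -, hratio⟩, hli⟩ := h.partialSVD
  have hk : Module.finrank ℝ (Vec κ) = k := by
    rw [← finrank_top, ← hspan, finrank_span_eq_card hli, Fintype.card_fin]
  have hFk : Module.finrank ℝ F ≤ k := hk ▸ Submodule.finrank_le F
  rcases Nat.eq_zero_or_pos (Module.finrank ℝ F) with h0 | h0
  · omega
  set d := Module.finrank ℝ F with hd
  let i : Fin k := ⟨d - 1, by omega⟩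
  have hi : ratio M (V i) ≤ t := by
    set K := Submodule.span ℝ (V '' Set.Iio i)
    have hK : Module.finrank ℝ K ≤ d - 1 := by
      refine (finrank_span_le_card _).trans ?_
      rw [Set.toFinset_image]
      refine Finset.card_image_le.trans ?_
      rw [Set.toFinset_Iio, Fin.card_Iio]
    have h1 := Submodule.finrank_add_finrank_orthogonal K
    have h2 := Submodule.finrank_sup_add_finrank_inf_eq F Kᗮ
    have h3 := Submodule.finrank_le (F ⊔ Kᗮ)
    have h4 : F ⊓ Kᗮ ≠ ⊥ := fun hbot => by
      rw [hbot, finrank_bot] at h2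
      omega
    obtain ⟨v, hv, hv0⟩ := Submodule.exists_mem_ne_zero_of_ne_bot h4
    have h5 := hratio i i.2 v fun j hj =>
      (Submodule.mem_orthogonal _ _).1 hv.2 _ (Submodule.subset_span ⟨j, hj, rfl⟩)
    have h6 : √k * ‖M v‖ ≤ t * ‖v‖ := by
      calc √k * ‖M v‖ ≤ √k * (σ * ‖v‖) := by gcongr; exact hF v hv.1
        _ ≤ t * ‖v‖ := by rw [← mul_assoc]; gcongr
    exact le_of_mul_le_mul_right (h5.trans h6) (norm_pos_iff.2 hv0)
  have hsub : Submodule.span ℝ (V '' Set.Iic i) ≤ cheapSpan M V t :=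
    Submodule.span_mono (Set.image_mono fun l hl => ⟨i, hl, hi⟩)
  refine le_trans (le_of_eq ?_) (Submodule.finrank_mono hsub)
  have hcard := finrank_span_eq_card
    (hli.comp (Subtype.val : Set.Iic i → Fin k) Subtype.val_injective)
  rw [Set.image_eq_range]
  refine Eq.trans ?_ hcard.symm
  rw [← Set.toFinset_card, Set.toFinset_Iic, Fin.card_Iic]
  change d = d - 1 + 1
  omega

end SVD

/-! ### Orthogonal projections -/

section Proj

variable {E : Type*} [NormedAddCommGroup E] [InnerProductSpace ℝ E]

theorem norm_sub_starProjection_le [FiniteDimensional ℝ E] (K : Submodule ℝ E) (v : E) {w : E} (hw : w ∈ K) :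
    ‖v - K.starProjection v‖ ≤ ‖v - w‖ := by
  rw [K.starProjection_minimal v]
  exact ciInf_le ⟨0, by rintro _ ⟨x, rfl⟩; positivity⟩ (⟨w, hw⟩ : K)

theorem norm_starProjection_le [FiniteDimensional ℝ E] (K : Submodule ℝ E) (v : E) : ‖K.starProjection v‖ ≤ ‖v‖ := by
  have := K.starProjection.le_opNorm v
  have h1 := K.starProjection_norm_le
  nlinarith [norm_nonneg v]

theorem norm_le_norm_add_of_mem_orthogonal {K : Submodule ℝ E} {v w : E} (hv : v ∈ K)
    (hw : w ∈ Kᗮ) : ‖v‖ ≤ ‖v + w‖ := by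
  have h := norm_add_sq_eq_norm_sq_add_norm_sq_of_inner_eq_zero v w
    ((Submodule.mem_orthogonal _ _).1 hw v hv)
  nlinarith [norm_nonneg v, norm_nonneg (v + w), mul_self_nonneg ‖w‖]

theorem finrank_map_eq_of_injOn {F : Type*} [AddCommGroup F] [Module ℝ F] (f : E →ₗ[ℝ] F)
    (K : Submodule ℝ E) (h : ∀ v ∈ K, f v = 0 → v = 0) :
    Module.finrank ℝ (K.map f) = Module.finrank ℝ K := by
  rw [← LinearMap.range_domRestrict]
  refine LinearMap.finrank_range_of_inj ?_
  rw [← LinearMap.ker_eq_bot, LinearMap.ker_eq_bot']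
  intro v hv
  exact Subtype.ext (h v v.2 hv)

end Proj

/-! ### Lifts -/

theorem liftL_isLift (W : Submodule ℝ (Vec (Fin n))) (I : Finset (Fin n)) (x : Vec I) :
    IsLift W I x (liftL W I x) := Classical.choose_spec (exists_isLift W I x)

theorem liftL_mem (W : Submodule ℝ (Vec (Fin n))) (I : Finset (Fin n)) (x : Vec I) :
    liftL W I x ∈ W := (liftL_isLift W I x).1

theorem coordProj_liftL {W : Submodule ℝ (Vec (Fin n))} {I : Finset (Fin n)} {x : Vec I}
    (hx : x ∈ W.map (coordProj I)) : coordProj I (liftL W I x) = x := by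
  rw [(liftL_isLift W I x).2.1, Submodule.starProjection_eq_self_iff.2 hx]

theorem liftL_eq_zero {W : Submodule ℝ (Vec (Fin n))} {I : Finset (Fin n)} {x : Vec I}
    (hx : x ∈ (W.map (coordProj I))ᗮ) : liftL W I x = 0 := by
  refine (liftL_isLift W I x).unique ⟨W.zero_mem, ?_, fun w _ _ => by simp⟩
  rw [map_zero, (Submodule.starProjection_apply_eq_zero_iff _).2 hx]

/-- The vector `w` competes in the minimization defining the lift of its own `I`-part. -/
theorem norm_lift_le {W : Submodule ℝ (Vec (Fin n))} {I J : Finset (Fin n)} (hIJ : Iᶜ = J)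
    {w : Vec (Fin n)} (hw : w ∈ W) : ‖lift W I J (coordProj I w)‖ ≤ ‖coordProj J w‖ := by
  subst hIJ
  have hmem : coordProj I w ∈ W.map (coordProj I) := Submodule.mem_map_of_mem hw
  have h := (liftL_isLift W I (coordProj I w)).2.2 w hw
    (Submodule.starProjection_eq_self_iff.2 hmem).symm
  have h1 := norm_sq_coordProj_add I w
  have h2 := norm_sq_coordProj_add I (liftL W I (coordProj I w))
  rw [coordProj_liftL hmem] at h2
  change ‖coordProj Iᶜ (liftL W I (coordProj I w))‖ ≤ _
  apply le_of_sq_le_sq _ (norm_nonneg _)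
  have : ‖liftL W I (coordProj I w)‖ ^ 2 ≤ ‖w‖ ^ 2 := by gcongr
  linarith

theorem IsLayeredDir.eq_liftL {W : Submodule ℝ (Vec (Fin n))} {I J : Finset (Fin n)}
    (hIJ : Iᶜ = J) {V : Submodule ℝ (Vec I)} (hV : V ≤ W.map (coordProj I)) {ξ δ : Vec (Fin n)}
    (h : IsLayeredDir W I J V ξ δ) : δ = liftL W I (coordProj I δ) := by
  subst hIJ
  exact eq_of_coordProj_eq I (coordProj_liftL (hV h.1)).symm h.2.2

theorem exists_isLayeredDir {W : Submodule ℝ (Vec (Fin n))} {I J : Finset (Fin n)}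
    {V : Submodule ℝ (Vec I)} (hV : V ≤ W.map (coordProj I)) (ξ : Vec (Fin n)) :
    ∃ δ, IsLayeredDir W I J V ξ δ := by
  set p := V.starProjection (coordProj I ξ) with hp
  have hpV : - p ∈ V := V.neg_mem (Submodule.starProjection_apply_mem V _)
  have e : coordProj I (liftL W I (-p)) = -p := coordProj_liftL (hV hpV)
  refine ⟨liftL W I (-p), ?_, fun η hη => ?_, ?_⟩
  · rw [e]; exact hpV
  · rw [e, ← sub_eq_add_neg]
    simpa using norm_sub_starProjection_le V (coordProj I ξ) (V.neg_mem hη)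
  · rw [e]; rfl

/-! ### Subspaces on which the lift is cheap -/

/-- `W` has a `d`-dimensional subspace whose vectors have `J`-part at most `σ` times the
`I`-part. -/
def Cone (W : Submodule ℝ (Vec (Fin n))) (I J : Finset (Fin n)) (σ : ℝ) (d : ℕ) : Prop :=
  ∃ F ≤ W, d ≤ Module.finrank ℝ F ∧ ∀ w ∈ F, ‖coordProj J w‖ ≤ σ * ‖coordProj I w‖

theorem cone_zero (W : Submodule ℝ (Vec (Fin n))) (I J : Finset (Fin n)) (σ : ℝ) :
    Cone W I J σ 0 :=
  ⟨⊥, bot_le, Nat.zero_le _, fun w hw => by rw [(Submodule.mem_bot ℝ).1 hw]; simp⟩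

theorem Cone.le {W : Submodule ℝ (Vec (Fin n))} {I J : Finset (Fin n)} {σ : ℝ} {d : ℕ}
    (h : Cone W I J σ d) : d ≤ n := by
  obtain ⟨F, -, hd, -⟩ := h
  have := Submodule.finrank_le F
  rw [finrank_euclideanSpace, Fintype.card_fin] at this
  exact hd.trans this

theorem Cone.mono {W : Submodule ℝ (Vec (Fin n))} {I J : Finset (Fin n)} {σ σ' : ℝ} {d : ℕ}
    (h : Cone W I J σ d) (hσ : σ ≤ σ') : Cone W I J σ' d := by
  obtain ⟨F, hF, hd, hc⟩ := h
  exact ⟨F, hF, hd, fun w hw => (hc w hw).trans (by gcongr)⟩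

theorem eq_zero_of_cone {I J : Finset (Fin n)} (hIJ : Iᶜ = J) {σ : ℝ} {w : Vec (Fin n)}
    (h : ‖coordProj J w‖ ≤ σ * ‖coordProj I w‖) (h0 : coordProj I w = 0) : w = 0 := by
  subst hIJ
  rw [h0, norm_zero, mul_zero] at h
  refine eq_of_coordProj_eq I (by rw [h0, map_zero]) ?_
  rw [map_zero]; exact norm_le_zero_iff.1 h

theorem norm_sq_hadL_coordProj_le {I : Finset (Fin n)} {g w : Vec (Fin n)} {a : ℝ} (ha : 0 ≤ a)
    (h : ∀ i ∈ I, |g i| ≤ a) : ‖coordProj I (hadL g w)‖ ≤ a * ‖coordProj I w‖ :=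
  norm_le_mul_norm _ _ ha fun i => by
    rw [coordProj_apply, coordProj_apply, hadL_apply, abs_mul]
    gcongr; exact h i i.2

/-- Scaling enlarges `J`-parts at most by `a` and shrinks `I`-parts at most by `b`. This transfers
cheap directions between iterates. -/
theorem Cone.map_hadL {W : Submodule ℝ (Vec (Fin n))} {I J : Finset (Fin n)} {σ : ℝ} {d : ℕ}
    (h : Cone W I J σ d) (hσ : 0 ≤ σ) {g : Vec (Fin n)} {a b : ℝ} (ha : 0 ≤ a) (hb : 0 ≤ b)
    (hg : ∀ i, 0 < g i) (hJ : ∀ i ∈ J, g i ≤ a) (hI : ∀ i ∈ I, 1 ≤ b * g i) :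
    Cone (W.map (hadL g)) I J (a * σ * b) d := by
  obtain ⟨F, hF, hd, hc⟩ := h
  refine ⟨F.map (hadL g), Submodule.map_mono hF, ?_, ?_⟩
  · rwa [finrank_map_eq_of_injOn]
    intro v _ hv
    ext i
    have := congrArg (fun u : Vec (Fin n) => u i) hv
    exact (mul_eq_zero.1 this).resolve_left (hg i).ne'
  · intro w hw
    obtain ⟨v, hv, rfl⟩ := Submodule.mem_map.1 hw
    have h1 : ‖coordProj J (hadL g v)‖ ≤ a * ‖coordProj J v‖ :=
      norm_sq_hadL_coordProj_le ha fun i hi => by rw [abs_of_pos (hg i)]; exact hJ i hi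
    have h2 : ‖coordProj I v‖ ≤ b * ‖coordProj I (hadL g v)‖ :=
      norm_le_mul_norm _ _ hb fun i => by
        rw [coordProj_apply, coordProj_apply, hadL_apply, abs_mul, abs_of_pos (hg i), ← mul_assoc]
        exact le_mul_of_one_le_left (abs_nonneg _) (hI i i.2)
    calc _ ≤ a * ‖coordProj J v‖ := h1
      _ ≤ a * (σ * ‖coordProj I v‖) := by gcongr; exact hc v hv
      _ ≤ a * (σ * (b * ‖coordProj I (hadL g v)‖)) := by gcongr
      _ = _ := by ring

/-- The lift vanishes on `Qᗮ`, where `Q` is the projection of `W`. So `G ⊔ Qᗮ` is as cheap as the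
projection `G` of `F`, and the cheap span has dimension at least `dim G + dim Qᗮ`. Intersecting with
`Q` loses at most `dim Qᗮ`. -/
theorem finrank_le_cheapSpan_inf {W : Submodule ℝ (Vec (Fin n))} {I J : Finset (Fin n)}
    (hIJ : Iᶜ = J) {σ t : ℝ} (hσ : 0 ≤ σ) (ht : √(I.card : ℝ) * σ ≤ t)
    {F : Submodule ℝ (Vec (Fin n))} (hF : F ≤ W)
    (hc : ∀ w ∈ F, ‖coordProj J w‖ ≤ σ * ‖coordProj I w‖) {CV : Fin I.card → Vec I}
    (hCV : IsApproxSVD (lift W I J) CV) :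
    Module.finrank ℝ F ≤
      Module.finrank ℝ (cheapSpan (lift W I J) CV t ⊓ W.map (coordProj I) : Submodule ℝ (Vec I)) := by
  set Q := W.map (coordProj I) with hQ
  set G := F.map (coordProj I) with hG
  have hGQ : G ≤ Q := Submodule.map_mono hF
  have hGF : Module.finrank ℝ G = Module.finrank ℝ F :=
    finrank_map_eq_of_injOn _ _ fun v hv => eq_zero_of_cone hIJ (hc v hv)
  have hinf : G ⊓ Qᗮ = ⊥ := by
    rw [eq_bot_iff, ← Submodule.inf_orthogonal_eq_bot Q]
    exact inf_le_inf_right _ hGQ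
  have h1 := Submodule.finrank_sup_add_finrank_inf_eq G Qᗮ
  rw [hinf, finrank_bot, add_zero] at h1
  have h2 : Module.finrank ℝ (G ⊔ Qᗮ : Submodule ℝ (Vec I)) ≤
      Module.finrank ℝ (cheapSpan (lift W I J) CV t) := by
    refine hCV.finrank_le_cheapSpan ht fun v hv => ?_
    obtain ⟨u, hu, q, hq, rfl⟩ := Submodule.mem_sup.1 hv
    obtain ⟨w, hw, rfl⟩ := Submodule.mem_map.1 hu
    have hq0 : lift W I J q = 0 := by
      change coordProj J (liftL W I q) = 0
      rw [liftL_eq_zero hq, map_zero]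
    rw [map_add, hq0, add_zero]
    calc _ ≤ ‖coordProj J w‖ := norm_lift_le hIJ (hF hw)
      _ ≤ σ * ‖coordProj I w‖ := hc w hw
      _ ≤ _ := by
        gcongr; exact norm_le_norm_add_of_mem_orthogonal (hGQ hu) hq
  have h3 := Submodule.finrank_sup_add_finrank_inf_eq (cheapSpan (lift W I J) CV t) Q
  have h4 := Submodule.finrank_le (cheapSpan (lift W I J) CV t ⊔ Q)
  have h5 := Submodule.finrank_add_finrank_orthogonal Q
  omega

/-- A vector of `W` close to `-ξ` on `I` extends a cheap subspace unless the latter nearly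
contains `ξ`. -/
theorem dist_le_of_not_cone {W : Submodule ℝ (Vec (Fin n))} {I J : Finset (Fin n)}
    {σ ρ e R R' ε₀ : ℝ} {d : ℕ} (hσ : 0 ≤ σ) (hR : 0 ≤ R) (hR' : 0 ≤ R') (hε : 0 < ε₀)
    (he : 2 * e ≤ ε₀) (hρ : σ + (σ * R' + R) * (2 / ε₀) ≤ ρ)
    {F : Submodule ℝ (Vec (Fin n))} (hF : F ≤ W) (hd : d ≤ Module.finrank ℝ F)
    (hc : ∀ w ∈ F, ‖coordProj J w‖ ≤ σ * ‖coordProj I w‖)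
    {w ξ : Vec (Fin n)} (hw : w ∈ W) (h1 : ‖coordProj I w + coordProj I ξ‖ ≤ e)
    (h2 : ‖coordProj J w‖ ≤ R) (h3 : ‖coordProj I w‖ ≤ R') (hnot : ¬ Cone W I J ρ (d + 1)) :
    ‖coordProj I ξ - (F.map (coordProj I)).starProjection (coordProj I ξ)‖ ≤ ε₀ := by
  by_contra! hlt
  set V := F.map (coordProj I) with hV
  have hdist : ∀ f ∈ F, ∀ a : ℝ, |a| * ε₀ ≤ ‖a • coordProj I ξ - coordProj I f‖ := by
    intro f hf a
    refine le_trans ?_ (norm_sub_starProjection_le V _ (Submodule.mem_map_of_mem hf))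
    rw [map_smul, ← smul_sub, norm_smul, Real.norm_eq_abs]
    gcongr
  -- The `I`-part of `f` is at distance at least `|a| ε₀` from `a ξ_I`, and `-w_I` approximates
  -- `ξ_I` within `ε₀/2`. Hence no cancellation in `(f + a w)_I` can hide a large coefficient `a`.
  have key : ∀ f ∈ F, ∀ a : ℝ, |a| * ε₀ ≤ 2 * ‖coordProj I (f + a • w)‖ := by
    intro f hf a
    have h4 := hdist f hf a
    have e1 : a • coordProj I ξ - coordProj I f =
        a • (coordProj I w + coordProj I ξ) - coordProj I (f + a • w) := by
      rw [map_add, map_smul, smul_add]; abel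
    rw [e1] at h4
    have h5 := h4.trans (norm_sub_le _ _)
    rw [norm_smul, Real.norm_eq_abs] at h5
    have h6 : |a| * ‖coordProj I w + coordProj I ξ‖ ≤ |a| * e := by gcongr
    nlinarith [abs_nonneg a]
  -- With `f = -w` and `a = 1` the bound would read `ε₀ ≤ 0`; so adjoining `w` raises the dimension.
  have hwF : w ∉ F := fun hwF => by
    have := key (-w) (F.neg_mem hwF) 1
    rw [one_smul, neg_add_cancel, map_zero, norm_zero, abs_one] at this
    linarith
  refine hnot ⟨F ⊔ Submodule.span ℝ {w}, sup_le hF ?_, ?_, ?_⟩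
  · rw [Submodule.span_singleton_le_iff_mem]; exact hw
  · rw [Submodule.finrank_sup_span_singleton hwF]; omega
  · intro u hu
    obtain ⟨f, hf, y, hy, rfl⟩ := Submodule.mem_sup.1 hu
    obtain ⟨a, rfl⟩ := Submodule.mem_span_singleton.1 hy
    have h4 := key f hf a
    have ha : |a| ≤ 2 / ε₀ * ‖coordProj I (f + a • w)‖ := by
      rw [div_mul_eq_mul_div, le_div_iff₀ hε]; exact h4
    have h5 : ‖coordProj I f‖ ≤ ‖coordProj I (f + a • w)‖ + |a| * R' := by
      have e1 : coordProj I f = coordProj I (f + a • w) - a • coordProj I w := by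
        rw [map_add, map_smul]; abel
      rw [e1]
      refine (norm_sub_le _ _).trans ?_
      rw [norm_smul, Real.norm_eq_abs]
      gcongr
    calc ‖coordProj J (f + a • w)‖ ≤ ‖coordProj J f‖ + |a| * ‖coordProj J w‖ := by
          rw [map_add, map_smul]
          refine (norm_add_le _ _).trans ?_
          rw [norm_smul, Real.norm_eq_abs]
      _ ≤ σ * (‖coordProj I (f + a • w)‖ + |a| * R') + |a| * R := by
          gcongr
          exact (hc f hf).trans (by gcongr)
      _ = σ * ‖coordProj I (f + a • w)‖ + (σ * R' + R) * |a| := by ring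
      _ ≤ σ * ‖coordProj I (f + a • w)‖
          + (σ * R' + R) * (2 / ε₀ * ‖coordProj I (f + a • w)‖) := by gcongr
      _ = (σ + (σ * R' + R) * (2 / ε₀)) * ‖coordProj I (f + a • w)‖ := by ring
      _ ≤ ρ * ‖coordProj I (f + a • w)‖ := by gcongr

/-- The layered direction removes almost all of `ξ_I` at a small cost on `J`. -/
theorem IsLayeredDir.bounds {W : Submodule ℝ (Vec (Fin n))} {I J : Finset (Fin n)}
    (hIJ : Iᶜ = J) {σ₀ τ ρ e R R' ε₀ : ℝ} {d : ℕ} (hσ₀ : 0 ≤ σ₀) (hτ : 0 ≤ τ) (hR : 0 ≤ R)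
    (hR' : 0 ≤ R') (hε : 0 < ε₀) (he : 2 * e ≤ ε₀) (hρ : τ + (τ * R' + R) * (2 / ε₀) ≤ ρ)
    {w ξ δ : Vec (Fin n)} (hw : w ∈ W) (h1 : ‖coordProj I w + coordProj I ξ‖ ≤ e)
    (h2 : ‖coordProj J w‖ ≤ R) (h3 : ‖coordProj I w‖ ≤ R') (hnot : ¬ Cone W I J ρ (d + 1))
    (hcone : Cone W I J σ₀ d) (hn : 0 < n) (hσ₀τ : √n * σ₀ ≤ τ / n) {CV : Fin I.card → Vec I}
    (hCV : IsApproxSVD (lift W I J) CV)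
    (hδ : IsLayeredDir W I J (cheapSpan (lift W I J) CV (τ / n) ⊓ W.map (coordProj I)) ξ δ) :
    ‖coordProj I ξ + coordProj I δ‖ ≤ ε₀ ∧ ‖coordProj J δ‖ ≤ τ * ‖coordProj I δ‖ := by
  have hn' : (0 : ℝ) < n := by exact_mod_cast hn
  have hcard : (I.card : ℝ) ≤ n := by
    exact_mod_cast (Finset.card_le_univ I).trans (Fintype.card_fin n).le
  set V := cheapSpan (lift W I J) CV (τ / n) ⊓ W.map (coordProj I) with hV
  have hVQ : V ≤ W.map (coordProj I) := inf_le_right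
  -- The Approx-SVD guarantee loses a factor `|I| ≤ n`, which is why the algorithm truncates at
  -- `τ/n`.
  have hVτ : ∀ v ∈ V, ‖lift W I J v‖ ≤ τ * ‖v‖ := fun v hv => by
    refine (hCV.norm_le_of_mem_cheapSpan (by positivity) hv.1).trans ?_
    gcongr
    rw [mul_div_assoc', div_le_iff₀ hn', mul_comm]
    gcongr
  obtain ⟨F₀, hF₀, hd₀, hc₀⟩ := hcone
  have hdV : d ≤ Module.finrank ℝ V := hd₀.trans <|
    finrank_le_cheapSpan_inf hIJ hσ₀ (le_trans (by gcongr) hσ₀τ) hF₀ hc₀ hCV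
  -- Lifted to `W`, the subspace used by the algorithm is cheap at threshold `τ` and has dimension
  -- at least `d`, so `dist_le_of_not_cone` applies to it.
  set F := V.map (liftL W I) with hF
  have hFW : F ≤ W := by
    rw [hF, Submodule.map_le_iff_le_comap]
    exact fun v _ => liftL_mem W I v
  have hFd : Module.finrank ℝ F = Module.finrank ℝ V :=
    finrank_map_eq_of_injOn _ _ fun v hv h0 => by
      rw [← coordProj_liftL (hVQ hv), h0, map_zero]
  have hFc : ∀ w ∈ F, ‖coordProj J w‖ ≤ τ * ‖coordProj I w‖ := by
    intro w hw
    obtain ⟨v, hv, rfl⟩ := Submodule.mem_map.1 hw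
    rw [coordProj_liftL (hVQ hv)]
    exact hVτ v hv
  have hFV : F.map (coordProj I) ≤ V := by
    rintro _ ⟨_, ⟨v, hv, rfl⟩, rfl⟩
    rw [coordProj_liftL (hVQ hv)]; exact hv
  have hdist := dist_le_of_not_cone hτ hR hR' hε he hρ hFW (hdV.trans hFd.ge) hFc hw h1 h2 h3 hnot
  refine ⟨?_, ?_⟩
  · refine (hδ.2.1 (-((F.map (coordProj I)).starProjection (coordProj I ξ)))
      (V.neg_mem (hFV (Submodule.starProjection_apply_mem _ _)))).trans ?_
    rw [← sub_eq_add_neg]; exact hdist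
  · rw [hδ.2.2]; exact hVτ _ hδ.1

/-! ### The rescaled iterate -/

/-- The entries of `x`, `s` are positive. -/
def PosPt (z : Pt n) : Prop := (∀ i, 0 < z.1 i) ∧ ∀ i, 0 < z.2 i

theorem LPData.N2_posPt {P : LPData m n} {β : ℝ} {z : Pt n} (h : z ∈ P.N2 β) : PosPt z :=
  ⟨h.1.2, h.2.1.2⟩

theorem PosPt.gap_pos {z : Pt n} (h : PosPt z) (hn : 0 < n) : 0 < gap z :=
  gap_pos_of_pos hn h.1 h.2

theorem xi_apply (z : Pt n) (i : Fin n) : xi z i = √(z.1 i) * √(z.2 i) / √(gap z) := rfl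

theorem PosPt.xi_pos {z : Pt n} (h : PosPt z) (hn : 0 < n) (i : Fin n) : 0 < xi z i := by
  have := Real.sqrt_pos.2 (h.gap_pos hn)
  have := Real.sqrt_pos.2 (h.1 i)
  have := Real.sqrt_pos.2 (h.2 i)
  rw [xi_apply]; positivity

theorem PosPt.xi_sq {z : Pt n} (h : PosPt z) (hn : 0 < n) (i : Fin n) :
    xi z i ^ 2 = z.1 i * z.2 i / gap z := by
  rw [xi_apply, div_pow, mul_pow, Real.sq_sqrt (h.1 i).le, Real.sq_sqrt (h.2 i).le,
    Real.sq_sqrt (h.gap_pos hn).le]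

theorem PosPt.norm_xi_sq {z : Pt n} (h : PosPt z) (hn : 0 < n) : ‖xi z‖ ^ 2 = n := by
  have := (h.gap_pos hn).ne'
  rw [norm_sq_eq_sum]
  simp_rw [h.xi_sq hn]
  rw [← Finset.sum_div, sum_eq_gap hn, mul_div_cancel_right₀ _ this]

theorem PosPt.norm_xi {z : Pt n} (h : PosPt z) (hn : 0 < n) : ‖xi z‖ = √n := by
  rw [← h.norm_xi_sq hn, Real.sqrt_sq (norm_nonneg _)]

theorem xhat_apply (z : Pt n) (i : Fin n) : xhat z i = z.1 i * (xi z i)⁻¹ := rfl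

theorem shat_apply (z : Pt n) (i : Fin n) : shat z i = z.2 i * (xi z i)⁻¹ := rfl

theorem PosPt.xhat_pos {z : Pt n} (h : PosPt z) (hn : 0 < n) (i : Fin n) : 0 < xhat z i := by
  have := h.xi_pos hn i
  have := h.1 i
  rw [xhat_apply]; positivity

theorem PosPt.shat_pos {z : Pt n} (h : PosPt z) (hn : 0 < n) (i : Fin n) : 0 < shat z i := by
  have := h.xi_pos hn i
  have := h.2 i
  rw [shat_apply]; positivity

theorem PosPt.xhat_mul_xi {z : Pt n} (h : PosPt z) (hn : 0 < n) (i : Fin n) :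
    xhat z i * xi z i = z.1 i := by
  rw [xhat_apply, inv_mul_cancel_right₀ (h.xi_pos hn i).ne']

theorem PosPt.shat_mul_xi {z : Pt n} (h : PosPt z) (hn : 0 < n) (i : Fin n) :
    shat z i * xi z i = z.2 i := by
  rw [shat_apply, inv_mul_cancel_right₀ (h.xi_pos hn i).ne']

theorem PosPt.xhat_mul_shat {z : Pt n} (h : PosPt z) (hn : 0 < n) (i : Fin n) :
    xhat z i * shat z i = gap z := by
  have h1 := h.xi_sq hn i
  have h2 := h.gap_pos hn
  have h3 := h.xi_pos hn i
  rw [eq_div_iff h2.ne'] at h1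
  rw [xhat_apply, shat_apply]
  field_simp
  linarith

theorem PosPt.mem_Wx {z : Pt n} (h : PosPt z) (hn : 0 < n) (P : LPData m n) (v : Vec (Fin n)) :
    v ∈ P.Wx z ↔ had (xhat z) v ∈ P.W :=
  mem_map_hadL (fun i => inv_mul_cancel₀ (h.xhat_pos hn i).ne') _ _

theorem PosPt.mem_Ws {z : Pt n} (h : PosPt z) (hn : 0 < n) (P : LPData m n) (v : Vec (Fin n)) :
    v ∈ P.Ws z ↔ had (shat z) v ∈ P.Wᗮ :=
  mem_map_hadL (fun i => inv_mul_cancel₀ (h.shat_pos hn i).ne') _ _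

/-- Since `x̂ ŝ` is the constant `μ`, scaling by `ŝ⁻¹` agrees up to a constant with scaling by `x̂`,
the inverse of the scaling applied to `W`. -/
theorem PosPt.Ws_eq {z : Pt n} (h : PosPt z) (hn : 0 < n) (P : LPData m n) :
    P.Ws z = (P.Wx z)ᗮ := by
  have hg := h.gap_pos hn
  ext v
  rw [h.mem_Ws hn, LPData.Wx,
    orthogonal_map_hadL (h := xhat z) (fun i => inv_mul_cancel₀ (h.xhat_pos hn i).ne'),
    mem_map_hadL (h := hinv (xhat z)) (fun i => mul_inv_cancel₀ (h.xhat_pos hn i).ne')]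
  have e : had (shat z) v = gap z • had (hinv (xhat z)) v := by
    ext i
    rw [PiLp.smul_apply, had_apply, had_apply, hinv_apply, smul_eq_mul, ← h.xhat_mul_shat hn i]
    have := (h.xhat_pos hn i).ne'
    field_simp
  rw [e, Submodule.smul_mem_iff _ hg.ne']

theorem PosPt.map_Wx {z z' : Pt n} (h : PosPt z) (hn : 0 < n) (P : LPData m n) :
    (P.Wx z).map (hadL (WithLp.toLp 2 fun i => xhat z i / xhat z' i)) = P.Wx z' := by
  rw [LPData.Wx, LPData.Wx, ← Submodule.map_comp]
  congr 1
  ext v i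
  have := (h.xhat_pos hn i).ne'
  simp only [LinearMap.comp_apply, hadL_apply, hinv_apply]
  field_simp

theorem PosPt.map_Ws {z z' : Pt n} (h : PosPt z) (hn : 0 < n) (P : LPData m n) :
    (P.Ws z).map (hadL (WithLp.toLp 2 fun i => shat z i / shat z' i)) = P.Ws z' := by
  rw [LPData.Ws, LPData.Ws, ← Submodule.map_comp]
  congr 1
  ext v i
  have := (h.shat_pos hn i).ne'
  simp only [LinearMap.comp_apply, hadL_apply, hinv_apply]
  field_simp

theorem LPData.hinv_xhat_mem {P : LPData m n} (z : Pt n)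
    {v : Vec (Fin n)} (hv : v ∈ P.W) : had (hinv (xhat z)) v ∈ P.Wx z :=
  Submodule.mem_map_of_mem (f := hadL (hinv (xhat z))) hv

theorem LPData.hinv_shat_mem {P : LPData m n} (z : Pt n)
    {v : Vec (Fin n)} (hv : v ∈ P.Wᗮ) : had (hinv (shat z)) v ∈ P.Ws z :=
  Submodule.mem_map_of_mem (f := hadL (hinv (shat z))) hv

/-! ### One iteration -/

theorem LPData.IsLLSDir.mem {P : LPData m n} (hn : 0 < n) {z da d : Pt n} (hz : PosPt z)
    (hda : P.IsNewtonDir 0 z da) {B N : Finset (Fin n)} (hN : N = Bᶜ)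
    {U : Submodule ℝ (Vec B)} {V : Submodule ℝ (Vec N)} (hU : U ≤ (P.Ws z).map (coordProj B))
    (hV : V ≤ (P.Wx z).map (coordProj N)) (h : P.IsLLSDir z da B N U V d) :
    d.1 ∈ P.W ∧ d.2 ∈ P.Wᗮ := by
  rcases N.eq_empty_or_nonempty with hN0 | hN0
  · rw [h.2.1 hN0]
    exact ⟨P.W.zero_mem, hda.2.1⟩
  rcases B.eq_empty_or_nonempty with hB0 | hB0
  · rw [h.2.2 hB0]
    exact ⟨hda.1, P.Wᗮ.zero_mem⟩
  obtain ⟨δp, δd, hp, hd, rfl⟩ := h.1 hB0 hN0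
  constructor
  · rw [← hz.mem_Wx hn, hp.eq_liftL (by rw [hN, compl_compl]) hV]
    exact liftL_mem _ _ _
  · rw [← hz.mem_Ws hn, hd.eq_liftL hN.symm hU]
    exact liftL_mem _ _ _

theorem LPData.exists_isLLSDir {P : LPData m n} (hn : 0 < n) {z da : Pt n}
    {B N : Finset (Fin n)} (hN : N = Bᶜ)
    {U : Submodule ℝ (Vec B)} {V : Submodule ℝ (Vec N)} (hU : U ≤ (P.Ws z).map (coordProj B))
    (hV : V ≤ (P.Wx z).map (coordProj N)) : ∃ d, P.IsLLSDir z da B N U V d := by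
  rcases N.eq_empty_or_nonempty with hN0 | hN0
  · refine ⟨(0, da.2), fun _ h => absurd hN0 h.ne_empty, fun _ => rfl, fun hB => ?_⟩
    rw [hB] at hN
    rw [hN] at hN0
    exact absurd (Finset.mem_compl.2 (Finset.notMem_empty (⟨0, hn⟩ : Fin n)))
      (by rw [hN0]; exact Finset.notMem_empty _)
  rcases B.eq_empty_or_nonempty with hB0 | hB0
  · exact ⟨(da.1, 0), fun h _ => absurd hB0 h.ne_empty, fun h => absurd h hN0.ne_empty,
      fun _ => rfl⟩
  obtain ⟨δp, hp⟩ := exists_isLayeredDir (J := B) hV (xi z)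
  obtain ⟨δd, hd⟩ := exists_isLayeredDir (J := N) hU (xi z)
  exact ⟨_, fun _ _ => ⟨δp, δd, hp, hd, rfl⟩, fun h => absurd h hN0.ne_empty,
    fun h => absurd h hB0.ne_empty⟩

/-- The outcome of the predictor part of an iteration. -/
theorem LPData.predictor_outcome {P : LPData m n} (hn : 0 < n) {β : ℝ} (hβ₀ : 0 < β) (hβ : β ≤ 1 / 6)
    {z da d zp : Pt n} {αa : ℝ} (hz : z ∈ P.N2 β) (hda : P.IsNewtonDir 0 z da)
    (hαa : P.IsAffineStep β z da αa) (hd1 : d.1 ∈ P.W) (hd2 : d.2 ∈ P.Wᗮ)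
    (hzp : zp = if llsStep β z d < αa then z + αa • da else z + llsStep β z d • d) :
    (zp ∈ P.N2 (2 * β) ∨ (gap zp = 0 ∧ zp ∈ closure (P.N2 (2 * β)))) ∧
      gap zp ≤ (1 - β / (2 * √n)) * gap z ∧
      gap zp ≤ (1 - llsStep β z d) * (1 + β / 4) * gap z := by
  have hg := (P.N2_posPt hz).gap_pos hn
  have hz1 := (P.mem_N2_iff hn β z).1 hz
  have hn1 : (1 : ℝ) ≤ √n := Real.one_le_sqrt.2 (by exact_mod_cast hn)
  have hn0 : (0 : ℝ) < √n := by linarith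
  have hn' : (0 : ℝ) < n := by exact_mod_cast hn
  obtain ⟨hα1, hα0, hαle, hαmem⟩ := hαa.bounds hn hβ₀
  have hb : β / (4 * √n) ≤ β / 4 := by
    gcongr; linarith
  have hb2 : β / (2 * √n) = β / √n / 2 := by field_simp
  have hb4 : β / (4 * √n) = β / √n / 4 := by field_simp
  have hbpos : 0 < β / √n := by positivity
  split_ifs at hzp with hlt
  · subst hzp
    rw [hda.gap_line_zero]
    refine ⟨?_, ?_, ?_⟩
    -- A full step makes the gap vanish, so its endpoint is only in the closure.
    · rcases hαle.lt_or_eq with h1 | h1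
      · refine Or.inl (P.mem_N2_of_lt hn (by linarith) hz1.1 hz1.2.1 hda.1 hda.2.1 hα0 ?_ hαmem)
        rw [hda.gap_line_zero]
        exact mul_pos (by linarith) hg
      · exact Or.inr ⟨by rw [h1]; ring, P.mem_closure_N2_of_lt hα0 hαmem⟩
    · gcongr; rw [hb2]; linarith
    · gcongr
      nlinarith
  · subst hzp
    have hle := not_lt.1 hlt
    have h0 : 0 < llsStep β z d := hα0.trans_le hle
    obtain ⟨hc, h1, hG⟩ := llsStep_bounds hβ₀ hg h0
    have hmem := P.lls_mem_N2 hn hβ₀ hβ hz hd1 hd2 h0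
    have hgle := P.lls_gap_le hn hβ₀ hg hd1 hd2 h0
    have habs := (abs_le.1 (abs_gap_le hn (z + d))).1
    have hline := gap_line (P.inner_eq_zero hd1 hd2) (z := z) (llsStep β z d)
    rw [hG] at habs
    set α := llsStep β z d
    refine ⟨?_, hgle.trans ?_, hgle.trans ?_⟩
    · rcases h1.lt_or_eq with h1 | h1
      · refine Or.inl (P.mem_N2_of_lt hn (by linarith) hz1.1 hz1.2.1 hd1 hd2 h0 ?_ hmem)
        rw [hline]
        have hpos : 0 < (1 - α) * gap z := mul_pos (by linarith) hg
        have h3 : (1 - α) * (β / 4) * gap z / √n ≤ (1 - α) * gap z * (β / 4) := by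
          rw [mul_right_comm]
          exact div_le_self (by positivity) hn1
        have h4 : α * -((1 - α) * gap z * (β / 4)) ≤ α * gap (z + d) := by
          gcongr; linarith
        nlinarith [mul_pos hpos hβ₀]
      · refine Or.inr ⟨?_, P.mem_closure_N2_of_lt h0 hmem⟩
        rw [h1] at hG
        have := abs_gap_le hn (z + d)
        rw [hG, sub_self, zero_mul, zero_mul, zero_div] at this
        rw [hline, h1, abs_nonpos_iff.1 this]; ring
    -- Here `α ≥ αa ≥ β/√n`; the factor `1 + β/(4√n)` eats part of this progress, and `β/(2√n)` is
    -- safely left.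
    · gcongr
      rw [hb2, hb4]
      nlinarith [mul_nonneg (sub_nonneg.2 h1) hbpos.le]
    · have : 0 ≤ 1 - α := by linarith
      gcongr

/-- What one iteration of the algorithm produces. -/
theorem LPData.next_iterate {P : LPData m n} (hn : 0 < n) {β : ℝ} (hβ₀ : 0 < β) (hβ : β ≤ 1 / 6)
    {z da d zp z' : Pt n} {αa : ℝ} (hz : z ∈ P.N2 β) (hda : P.IsNewtonDir 0 z da)
    (hαa : P.IsAffineStep β z da αa) (hd1 : d.1 ∈ P.W) (hd2 : d.2 ∈ P.Wᗮ)
    (hzp : zp = if llsStep β z d < αa then z + αa • da else z + llsStep β z d • d)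
    (hz' : if 0 < (inner ℝ zp.1 zp.2 : ℝ) then ∃ dc : Pt n, P.IsNewtonDir 1 zp dc ∧ z' = zp + dc
      else z' = zp) :
    (z' ∈ P.N2 β ∨ (gap z' = 0 ∧ z' ∈ closure (P.N2 (2 * β)))) ∧
      gap z' ≤ (1 - β / (2 * √n)) * gap z ∧
      gap z' ≤ (1 - llsStep β z d) * (1 + β / 4) * gap z := by
  obtain ⟨hzpm, hzp1, hzp2⟩ := P.predictor_outcome hn hβ₀ hβ hz hda hαa hd1 hd2 hzp
  rcases hzpm with hm | ⟨h0, hcl⟩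
  · have hgp := (P.N2_posPt hm).gap_pos hn
    have hin : 0 < (inner ℝ zp.1 zp.2 : ℝ) := by
      rw [inner_eq_sum, sum_eq_gap hn]; positivity
    rw [if_pos hin] at hz'
    obtain ⟨dc, hdc, rfl⟩ := hz'
    obtain ⟨h1, h2⟩ := hdc.corrector hn hβ₀ hβ hm
    rw [h2]
    exact ⟨Or.inl h1, hzp1, hzp2⟩
  · have hin : ¬ 0 < (inner ℝ zp.1 zp.2 : ℝ) := by
      rw [inner_eq_sum, sum_eq_gap hn, h0]; simp
    rw [if_neg hin] at hz'
    subst hz'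
    exact ⟨Or.inr ⟨h0, hcl⟩, hzp1, hzp2⟩

/-- The algorithm never gets stuck: a corrector is requested only if the gap is positive, and then
the predictor point lies in `N²(2β)` and is positive. -/
theorem LPData.exists_step {P : LPData m n} (hn : 0 < n) {β : ℝ} (hβ₀ : 0 < β) (hβ : β ≤ 1 / 6)
    {z : Pt n} (hz : z ∈ P.N2 β) : ∃ z', P.Step β z z' := by
  have hpos := P.N2_posPt hz
  obtain ⟨da, hda⟩ := P.exists_isNewtonDir 0 hpos.1 hpos.2
  obtain ⟨αa, hαa⟩ := LPData.exists_isAffineStep hn hβ₀ hβ hz hda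
  set B := assocB z da with hB
  obtain ⟨CV, hCV⟩ := exists_isApproxSVD (lift (P.Wx z) Bᶜ B) (Bᶜ).equivFin.symm
  obtain ⟨CU, hCU⟩ := exists_isApproxSVD (lift (P.Ws z) B Bᶜ) B.equivFin.symm
  obtain ⟨d, hd⟩ := P.exists_isLLSDir hn (z := z) (da := da) (B := B) rfl
    (U := cheapSpan (lift (P.Ws z) B Bᶜ) CU (tau β n / n) ⊓ (P.Ws z).map (coordProj B))
    (V := cheapSpan (lift (P.Wx z) Bᶜ B) CV (tau β n / n) ⊓ (P.Wx z).map (coordProj Bᶜ))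
    inf_le_right inf_le_right
  have hdm := hd.mem hn hpos hda rfl inf_le_right inf_le_right
  set zp := if llsStep β z d < αa then z + αa • da else z + llsStep β z d • d with hzp
  by_cases hin : 0 < (inner ℝ zp.1 zp.2 : ℝ)
  · have hzpos : PosPt zp := by
      rcases (P.predictor_outcome hn hβ₀ hβ hz hda hαa hdm.1 hdm.2 hzp).1 with h | ⟨h, -⟩
      · exact P.N2_posPt h
      · rw [inner_eq_sum, sum_eq_gap hn, h, mul_zero] at hin
        exact absurd hin (lt_irrefl _)
    obtain ⟨dc, hdc⟩ := P.exists_isNewtonDir 1 hzpos.1 hzpos.2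
    exact ⟨zp + dc, da, αa, B, Bᶜ, CV, CU, d, zp, hda, hαa, rfl, rfl, hCV, hCU, hd, rfl, by
      rw [if_pos hin]; exact ⟨dc, hdc, rfl⟩⟩
  · exact ⟨zp, da, αa, B, Bᶜ, CV, CU, d, zp, hda, hαa, rfl, rfl, hCV, hCU, hd, rfl, by
      rw [if_neg hin]⟩

/-! ### The central path -/

theorem log_le_mul_sub {c t : ℝ} (hc : 0 < c) (ht : 0 < t) :
    Real.log t ≤ c * t - 1 - Real.log c := by
  have h := Real.log_le_sub_one_of_pos (mul_pos hc ht)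
  rw [Real.log_mul hc.ne' ht.ne'] at h
  linarith

/-- Minimize the barrier function `⟨s₀, x⟩ - μ ∑ log xᵢ` over the positive part of `x₀ + W`. Its
sublevel set lies in a compact box of positive vectors. Stationarity says `s₀ - μ/x ⊥ W`, so `s =
μ/x` is a dual slack. -/
theorem LPData.exists_isCentral {P : LPData m n} {x₀ s₀ : Vec (Fin n)} (hx : x₀ ∈ P.primalPos)
    (hs : s₀ ∈ P.dualPos) {μ : ℝ} (hμ : 0 < μ) : ∃ z, P.IsCentral μ z := by
  set ψ : Vec (Fin n) → ℝ := fun x => ∑ i, (s₀ i * x i - μ * Real.log (x i)) with hψ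
  set c : Fin n → ℝ := fun i => μ + μ * Real.log (s₀ i / (2 * μ)) with hc
  -- The tangent bound for `log` with slope `s₀/(2μ)` leaves half of the linear term, which gives
  -- the upper sides of the box.
  have hlow : ∀ (i : Fin n) (t : ℝ), 0 < t → s₀ i * t / 2 + c i ≤ s₀ i * t - μ * Real.log t := by
    intro i t ht
    have h := mul_le_mul_of_nonneg_left
      (log_le_mul_sub (c := s₀ i / (2 * μ)) (div_pos (hs.2 i) (by positivity)) ht) hμ.le
    have e : μ * (s₀ i / (2 * μ) * t - 1 - Real.log (s₀ i / (2 * μ))) =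
        s₀ i * t / 2 - μ - μ * Real.log (s₀ i / (2 * μ)) := by
      field_simp
    rw [e] at h
    simp only [hc]
    linarith
  set G := ψ x₀ - ∑ i, c i with hG
  have hterm : ∀ x : Vec (Fin n), (∀ i, 0 < x i) → ψ x ≤ ψ x₀ → ∀ i,
      s₀ i * x i - μ * Real.log (x i) - c i ≤ G := by
    intro x hxpos hle i
    have h1 : ∑ i, (s₀ i * x i - μ * Real.log (x i) - c i) ≤ G := by
      rw [Finset.sum_sub_distrib]; exact sub_le_sub_right hle _
    refine le_trans (Finset.single_le_sum (f := fun j => s₀ j * x j - μ * Real.log (x j) - c j)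
      (fun j _ => ?_) (Finset.mem_univ i)) h1
    have h2 := hlow j _ (hxpos j)
    have h3 := mul_pos (hs.2 j) (hxpos j)
    change 0 ≤ s₀ j * x j - μ * Real.log (x j) - c j
    linarith
  set a : Fin n → ℝ := fun i => Real.exp (-(G + c i) / μ) with ha
  set b : Fin n → ℝ := fun i => 2 * G / s₀ i with hb
  set S : Set (Vec (Fin n)) := {x | x - x₀ ∈ P.W ∧ ∀ i, a i ≤ x i ∧ x i ≤ b i} with hS
  have hbox : ∀ x : Vec (Fin n), x - x₀ ∈ P.W → (∀ i, 0 < x i) → ψ x ≤ ψ x₀ → x ∈ S := by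
    intro x hxW hxpos hle
    refine ⟨hxW, fun i => ⟨?_, ?_⟩⟩
    · have h1 := hterm x hxpos hle i
      have h2 := mul_pos (hs.2 i) (hxpos i)
      rw [ha, ← Real.le_log_iff_exp_le (hxpos i), div_le_iff₀ hμ]
      linarith
    · have h1 := hterm x hxpos hle i
      have h2 := hlow i _ (hxpos i)
      rw [hb, le_div_iff₀ (hs.2 i)]
      linarith
  have hSpos : ∀ x ∈ S, ∀ i, 0 < x i := fun x hxS i => (Real.exp_pos _).trans_le (hxS.2 i).1
  have hcoord : ∀ i, Continuous fun x : Vec (Fin n) => x i := fun i => by fun_prop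
  have hclosed : IsClosed S := by
    have h1 : IsClosed {x : Vec (Fin n) | x - x₀ ∈ P.W} :=
      (Submodule.closed_of_finiteDimensional P.W).preimage (continuous_id.sub continuous_const)
    have h2 : IsClosed {x : Vec (Fin n) | ∀ i, a i ≤ x i ∧ x i ≤ b i} := by
      simp only [Set.ofPred_forall]
      exact isClosed_iInter fun i => (isClosed_le continuous_const (hcoord i)).inter
        (isClosed_le (hcoord i) continuous_const)
    exact h1.inter h2
  have hbdd : Bornology.IsBounded S := by
    rw [isBounded_iff_forall_norm_le]
    refine ⟨∑ i, |b i| * √n, fun x hxS => ?_⟩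
    rw [← Finset.sum_mul]
    refine norm_le_sqrt_card x (Finset.sum_nonneg fun i _ => abs_nonneg _) (fun i => ?_)
      (Fintype.card_fin n).le
    rw [abs_of_pos (hSpos x hxS i)]
    exact ((hxS.2 i).2.trans (le_abs_self _)).trans
      (Finset.single_le_sum (f := fun i => |b i|) (fun j _ => abs_nonneg _) (Finset.mem_univ i))
  have hcomp : IsCompact S := Metric.isCompact_of_isClosed_isBounded hclosed hbdd
  have hx₀S : x₀ ∈ S := hbox x₀ (by rw [sub_self]; exact P.W.zero_mem) hx.2 le_rfl
  have hcont : ContinuousOn ψ S := by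
    refine continuousOn_finsetSum _ fun i _ => ?_
    refine ((continuous_const.mul (hcoord i)).continuousOn).sub (continuousOn_const.mul ?_)
    exact (hcoord i).continuousOn.log fun x hxS => (hSpos x hxS i).ne'
  obtain ⟨x, hxS, hmin⟩ := hcomp.exists_isMinOn ⟨x₀, hx₀S⟩ hcont
  have hxpos := hSpos x hxS
  have hglob : ∀ y : Vec (Fin n), y - x₀ ∈ P.W → (∀ i, 0 < y i) → ψ x ≤ ψ y := by
    intro y hyW hypos
    rcases le_or_gt (ψ y) (ψ x₀) with h | h
    · exact hmin (hbox y hyW hypos h)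
    · exact (hmin hx₀S).trans h.le
  have hgrad : ∀ w ∈ P.W, ∑ i, w i * (s₀ i - μ / x i) = 0 := by
    intro w hw
    have hder : HasDerivAt (fun t : ℝ => ψ (x + t • w)) (∑ i, (s₀ i * w i - μ * (w i / x i))) 0 := by
      refine HasDerivAt.fun_sum fun i _ => ?_
      have h1 : HasDerivAt (fun t : ℝ => x i + t * w i) (w i) 0 := by
        simpa using ((hasDerivAt_id (0 : ℝ)).mul_const (w i)).const_add (x i)
      have h2 := h1.log (by simpa using (hxpos i).ne')
      simp only [zero_mul, add_zero] at h2
      exact (h1.const_mul (s₀ i)).sub (h2.const_mul μ)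
    have hloc : IsLocalMin (fun t : ℝ => ψ (x + t • w)) 0 := by
      have hev : ∀ᶠ t : ℝ in 𝓝 0, ∀ i, 0 < (x + t • w) i := by
        rw [Filter.eventually_all]
        intro i
        have hc : ContinuousAt (fun t : ℝ => (x + t • w) i) 0 := by fun_prop
        exact hc.eventually (lt_mem_nhds (by simpa using hxpos i))
      filter_upwards [hev] with t ht
      rw [zero_smul, add_zero]
      refine hglob _ ?_ ht
      have : x + t • w - x₀ = (x - x₀) + t • w := by abel
      rw [this]
      exact P.W.add_mem hxS.1 (P.W.smul_mem _ hw)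
    rw [← hloc.hasDerivAt_eq_zero hder]
    exact Finset.sum_congr rfl fun i _ => by ring
  refine ⟨(x, WithLp.toLp 2 fun i => μ / x i), hμ, P.primalPos_of_sub_mem hx hxS.1 hxpos,
    P.dualPos_of_sub_mem hs ?_ fun i => div_pos hμ (hxpos i),
    fun i => mul_div_cancel₀ _ (hxpos i).ne'⟩
  rw [Submodule.mem_orthogonal]
  intro w hw
  rw [inner_eq_sum, ← neg_eq_zero, ← Finset.sum_neg_distrib, ← hgrad w hw]
  refine Finset.sum_congr rfl fun i _ => ?_
  simp only [PiLp.sub_apply]; ring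

theorem LPData.IsCentral.gap_eq {P : LPData m n} (hn : 0 < n) {μ : ℝ} {z : Pt n}
    (h : P.IsCentral μ z) : gap z = μ := by
  have hn' : (n : ℝ) ≠ 0 := by positivity
  rw [SubspaceIPM.gap_eq, Finset.sum_congr rfl fun i _ => h.2.2.2 i]
  simp; field_simp

/-- Feasible pairs satisfy `xᵢ s'ᵢ ≤ n (μ + μ')`. -/
theorem LPData.cross_le {P : LPData m n} (hn : 0 < n) {z z' : Pt n} (hx : z.1 ∈ P.primalPos)
    (hs : z.2 ∈ P.dualPos) (hx' : z'.1 ∈ P.primalPos) (hs' : z'.2 ∈ P.dualPos) (i : Fin n) :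
    z.1 i * z'.2 i ≤ n * (gap z + gap z') ∧ z'.1 i * z.2 i ≤ n * (gap z + gap z') := by
  rw [← P.sum_cross hx hs hx' hs' hn]
  have h := Finset.single_le_sum (f := fun i => z.1 i * z'.2 i + z'.1 i * z.2 i)
    (fun j _ => (add_pos (mul_pos (hx.2 j) (hs'.2 j)) (mul_pos (hx'.2 j) (hs.2 j))).le)
    (Finset.mem_univ i)
  have h1 := mul_pos (hx.2 i) (hs'.2 i)
  have h2 := mul_pos (hx'.2 i) (hs.2 i)
  simp only at h
  constructor <;> linarith

/-- On a polarized segment the iterates are comparable: `x` on `B` and `s` on `Bᶜ`. -/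
theorem LPData.Polarized.exists_ratio_le {P : LPData m n} (hn : 0 < n) {γ μ₁ μ₀ β : ℝ}
    (hβ : β ≤ 1 / 6) (hγ : 0 < γ) (hpol : P.Polarized γ μ₁ μ₀) :
    ∃ B : Finset (Fin n), ∀ z ∈ P.N2 β, ∀ z' ∈ P.N2 β, μ₁ ≤ gap z → gap z ≤ μ₀ →
      gap z' ≤ μ₀ → (∀ i ∈ B, z'.1 i ≤ 6 * n ^ 2 / γ * z.1 i) ∧
        (∀ i ∈ Bᶜ, z'.2 i ≤ 6 * n ^ 2 / γ * z.2 i) := by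
  obtain ⟨B, hB⟩ := hpol
  refine ⟨B, fun z hz z' hz' h1 h0 h0' => ?_⟩
  have hg := (P.N2_posPt hz).gap_pos hn
  obtain ⟨zc, hzc⟩ := P.exists_isCentral hz.1 hz.2.1 hg
  obtain ⟨z0, hz0⟩ := P.exists_isCentral hz.1 hz.2.1 (hg.trans_le h0)
  have hn' : (0 : ℝ) < n := by exact_mod_cast hn
  have hpol := hB (gap z) ⟨h1, h0⟩ zc z0 (Or.inl hzc) (Or.inl hz0)
  -- The chain is `x' ≤ 2n x0 ≤ (2n/γ) xc ≤ (6n²/γ) x`, through the central points at `μ₀` and at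
  -- the gap of `z`. The outer links come from duality via `cross_le`, the middle one from
  -- polarization.
  have key : ∀ x s xc x0 s0 x' : ℝ, 0 < x → 0 < s → 0 < x0 → 0 < s0 → x0 * s0 = μ₀ →
      x' * s0 ≤ n * (gap z' + μ₀) → xc * s ≤ n * (gap z + gap z) → (1 - β) * gap z ≤ x * s →
      γ * x0 ≤ xc → x' ≤ 6 * n ^ 2 / γ * x := by
    intro x s xc x0 s0 x' hx hs hx0 hs0 e1 e2 e3 e4 e5
    have a1 : x' ≤ 2 * n * x0 := by
      refine le_of_mul_le_mul_right (e2.trans ?_) hs0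
      rw [mul_assoc, e1]
      nlinarith
    have a2 : xc ≤ 3 * n * x := by
      refine le_of_mul_le_mul_right (e3.trans ?_) hs
      have a4 : 5 / 6 * gap z ≤ x * s := le_trans (by gcongr; linarith) e4
      calc (n : ℝ) * (gap z + gap z) ≤ 3 * n * (5 / 6 * gap z) := by nlinarith [mul_pos hn' hg]
        _ ≤ 3 * n * (x * s) := by gcongr
        _ = _ := by ring
    rw [div_mul_eq_mul_div, le_div_iff₀ hγ]
    calc x' * γ ≤ 2 * n * x0 * γ := by gcongr
      _ = 2 * n * (γ * x0) := by ring
      _ ≤ 2 * n * (3 * n * x) := mul_le_mul_of_nonneg_left (e5.trans a2) (by positivity)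
      _ = 6 * n ^ 2 * x := by ring
  have hgc := hzc.gap_eq hn
  have hg0 := hz0.gap_eq hn
  constructor
  · intro i hi
    have c1 := (P.cross_le hn hz'.1 hz'.2.1 hz0.2.1 hz0.2.2.1 i).1
    have c2 := (P.cross_le hn hz.1 hz.2.1 hzc.2.1 hzc.2.2.1 i).2
    rw [hg0] at c1
    rw [hgc] at c2
    exact key _ _ _ _ _ _ (hz.1.2 i) (hz.2.1.2 i) (hz0.2.1.2 i) (hz0.2.2.1.2 i) (hz0.2.2.2 i) c1
      c2 (P.N2_mul_bounds hn hz i).1 (hpol.1 i hi)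
  · intro i hi
    have c1 := (P.cross_le hn hz'.1 hz'.2.1 hz0.2.1 hz0.2.2.1 i).2
    have c2 := (P.cross_le hn hz.1 hz.2.1 hzc.2.1 hzc.2.2.1 i).1
    rw [hg0, mul_comm] at c1
    rw [hgc, mul_comm] at c2
    exact key _ _ _ _ _ _ (hz.2.1.2 i) (hz.1.2 i) (hz0.2.2.1.2 i) (hz0.2.1.2 i)
      ((mul_comm _ _).trans (hz0.2.2.2 i)) c1 c2
      ((P.N2_mul_bounds hn hz i).1.trans (mul_comm _ _).le) (hpol.2 i hi)

/-! ### One iteration on a polarized segment -/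

theorem tau_nonneg {β : ℝ} (hβ₀ : 0 < β) (n : ℕ) : 0 ≤ tau β n := by
  unfold tau; positivity

theorem tau_mul_sqrt (hn : 0 < n) (β : ℝ) : tau β n * √n = β / 16 := by
  have : 0 < √(n : ℝ) := Real.sqrt_pos.2 (by exact_mod_cast hn)
  unfold tau; field_simp

theorem LPData.xi_bounds {P : LPData m n} (hn : 0 < n) {β : ℝ} (hβ : β ≤ 1 / 6) {z : Pt n}
    (hz : z ∈ P.N2 β) (i : Fin n) : 9 / 10 ≤ xi z i ∧ xi z i ≤ 11 / 10 := by
  have hp := P.N2_posPt hz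
  have hg := hp.gap_pos hn
  obtain ⟨h1, h2⟩ := P.N2_mul_bounds hn hz i
  have h3 := hp.xi_sq hn i
  have h4 := hp.xi_pos hn i
  have h5 : (5 / 6 : ℝ) ≤ xi z i ^ 2 := by
    rw [h3, le_div_iff₀ hg]
    exact le_trans (by gcongr; linarith) h1
  have h6 : xi z i ^ 2 ≤ 7 / 6 := by
    rw [h3, div_le_iff₀ hg]
    exact h2.trans (by gcongr; linarith)
  constructor <;> nlinarith

/-- If `Δx / x̂ = p` and `Δs / ŝ = q` then `B̃ = {i | |pᵢ| < |qᵢ|}`. -/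
theorem PosPt.mem_assocB {z : Pt n} (h : PosPt z) (hn : 0 < n) {da : Pt n} (i : Fin n) :
    i ∈ assocB z da ↔ |had (hinv (xhat z)) da.1 i| < |had (hinv (shat z)) da.2 i| := by
  have h1 := h.xi_pos hn i
  have h2 := h.xhat_pos hn i
  have h3 := h.shat_pos hn i
  have e1 : da.1 i / z.1 i = had (hinv (xhat z)) da.1 i / xi z i := by
    rw [← h.xhat_mul_xi hn i, had_apply, hinv_apply]; field_simp
  have e2 : da.2 i / z.2 i = had (hinv (shat z)) da.2 i / xi z i := by
    rw [← h.shat_mul_xi hn i, had_apply, hinv_apply]; field_simp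
  rw [assocB, Finset.mem_filter_univ, e1, e2, abs_div, abs_div, abs_of_pos h1,
    div_lt_div_iff_of_pos_right h1]

/-- After scaling, the affine direction is the orthogonal decomposition of `-ξ` along `x̂⁻¹W` and
its complement. -/
theorem PosPt.newton_zero_scaled {z : Pt n} (h : PosPt z) (hn : 0 < n) {P : LPData m n} {da : Pt n}
    (hda : P.IsNewtonDir 0 z da) :
    had (hinv (xhat z)) da.1 + had (hinv (shat z)) da.2 = - xi z := by
  ext i
  have h1 := h.xi_pos hn i
  have h2 := h.xhat_pos hn i
  have h3 := h.shat_pos hn i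
  have h4 := hda.apply_zero i
  rw [← h.xhat_mul_xi hn i, ← h.shat_mul_xi hn i] at h4
  simp only [PiLp.add_apply, had_apply, hinv_apply, PiLp.neg_apply]
  field_simp
  have h5 : (xi z i) * (shat z i * da.1 i + xhat z i * da.2 i) =
      xi z i * (-(xhat z i * shat z i * xi z i)) := by linarith
  have := mul_left_cancel₀ h1.ne' h5
  linarith

/-- Since `f + g ≈ ξ`, the orthogonal vectors `p + f` and `q + g` have a small sum, so each is
small: `p ≈ -f` and `q ≈ -g`. As `f` is small on `B` and `g` on `Bᶜ`, the affine direction reveals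
the partition. -/
theorem abs_lt_abs_of_near {K : Submodule ℝ (Vec (Fin n))} {B : Finset (Fin n)}
    {ξ p q f g : Vec (Fin n)} {ε : ℝ} (hε : ε ≤ 1 / 100) (hξ : ∀ i, 9 / 10 ≤ ξ i)
    (hp : p ∈ K) (hq : q ∈ Kᗮ) (hpq : p + q = -ξ) (hf : f ∈ K) (hg : g ∈ Kᗮ)
    (hf1 : ‖coordProj Bᶜ ξ - coordProj Bᶜ f‖ ≤ ε) (hf2 : ‖coordProj B f‖ ≤ 1 / 96)
    (hg1 : ‖coordProj B ξ - coordProj B g‖ ≤ ε) (hg2 : ‖coordProj Bᶜ g‖ ≤ 1 / 96) :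
    (∀ i ∈ B, |p i| < |q i|) ∧ ∀ i ∈ Bᶜ, |q i| < |p i| := by
  have hsum : ‖f + g - ξ‖ ≤ 2 * (ε + 1 / 96) := by
    refine (norm_le_coordProj_add B _).trans ?_
    have e1 : coordProj B (f + g - ξ) = coordProj B f - (coordProj B ξ - coordProj B g) := by
      rw [map_sub, map_add]; abel
    have e2 : coordProj Bᶜ (f + g - ξ) = coordProj Bᶜ g - (coordProj Bᶜ ξ - coordProj Bᶜ f) := by
      rw [map_sub, map_add]; abel
    rw [e1, e2]
    linarith [norm_sub_le (coordProj B f) (coordProj B ξ - coordProj B g),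
      norm_sub_le (coordProj Bᶜ g) (coordProj Bᶜ ξ - coordProj Bᶜ f)]
  have e : p + f + (q + g) = f + g - ξ := by
    rw [show p + f + (q + g) = (p + q) + (f + g) by abel, hpq]; abel
  have h1 : ‖p + f‖ ≤ 2 * (ε + 1 / 96) := by
    refine (norm_le_norm_add_of_mem_orthogonal (K.add_mem hp hf) (Kᗮ.add_mem hq hg)).trans ?_
    rw [e]; exact hsum
  have h2 : ‖q + g‖ ≤ 2 * (ε + 1 / 96) := by
    refine (norm_le_norm_add_of_mem_orthogonal (K := Kᗮ) (w := p + f) (Kᗮ.add_mem hq hg)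
      (by rw [Submodule.orthogonal_orthogonal]; exact K.add_mem hp hf)).trans ?_
    rw [add_comm, e]; exact hsum
  have hpqi : ∀ i, p i + q i = - ξ i := fun i => congrArg (fun u : Vec (Fin n) => u i) hpq
  constructor
  · intro i hi
    have h3 := (abs_apply_le_norm (coordProj B f) ⟨i, hi⟩).trans hf2
    have h4 := (abs_apply_le_norm (p + f) i).trans h1
    rw [coordProj_apply] at h3
    rw [PiLp.add_apply] at h4
    have h5 := hpqi i
    have h6 := hξ i
    rw [abs_le] at h3 h4
    have h7 : |p i| ≤ 1 / 10 := abs_le.2 ⟨by linarith, by linarith⟩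
    have h8 := (abs_le.1 h7).1
    rw [abs_of_nonpos (a := q i) (by linarith)]
    linarith
  · intro i hi
    have h3 := (abs_apply_le_norm (coordProj Bᶜ g) ⟨i, hi⟩).trans hg2
    have h4 := (abs_apply_le_norm (q + g) i).trans h2
    rw [coordProj_apply] at h3
    rw [PiLp.add_apply] at h4
    have h5 := hpqi i
    have h6 := hξ i
    rw [abs_le] at h3 h4
    have h7 : |q i| ≤ 1 / 10 := abs_le.2 ⟨by linarith, by linarith⟩
    have h8 := (abs_le.1 h7).1
    rw [abs_of_nonpos (a := p i) (by linarith)]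
    linarith

/-- A cheap subspace that cannot be enlarged contains a vector that is close to `ξ` on `I` and small
on `J`. -/
theorem exists_near_of_cone (hn : 0 < n) {W : Submodule ℝ (Vec (Fin n))} {I J : Finset (Fin n)}
    {β ρ e R ε₀ σ₀ : ℝ} {d : ℕ} (hβ₀ : 0 < β) (hβ : β ≤ 1 / 6) (hR : 0 ≤ R) (hσ₀ : 0 ≤ σ₀)
    (hστ : √n * σ₀ ≤ tau β n / n) (hε : 0 < ε₀) (he : 2 * e ≤ ε₀)
    (hρ : tau β n + (tau β n * (2 * √n) + R) * (2 / ε₀) ≤ ρ) {w ξ : Vec (Fin n)}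
    (hξ : ‖ξ‖ = √n) (hw : w ∈ W) (h1 : ‖coordProj I w + coordProj I ξ‖ ≤ e)
    (h2 : ‖coordProj J w‖ ≤ R) (h3 : ‖coordProj I w‖ ≤ 2 * √n) (hcone : Cone W I J σ₀ d)
    (hnot : ¬ Cone W I J ρ (d + 1)) :
    ∃ f ∈ W, ‖coordProj I ξ - coordProj I f‖ ≤ ε₀ ∧ ‖coordProj J f‖ ≤ 1 / 96 := by
  have hτ := tau_nonneg hβ₀ n
  have hn1 : (1 : ℝ) ≤ n := by exact_mod_cast hn
  have hn2 : (1 : ℝ) ≤ √n := Real.one_le_sqrt.2 hn1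
  have hσ : σ₀ ≤ tau β n := by
    calc σ₀ ≤ √n * σ₀ := le_mul_of_one_le_left hσ₀ hn2
      _ ≤ tau β n / n := hστ
      _ ≤ tau β n := div_le_self hτ hn1
  obtain ⟨F, hF, hd, hc⟩ := hcone.mono hσ
  have hdist := dist_le_of_not_cone hτ hR (by positivity) hε he hρ hF hd hc hw h1 h2 h3 hnot
  obtain ⟨f, hf, hfe⟩ := Submodule.mem_map.1
    (Submodule.starProjection_apply_mem (F.map (coordProj I)) (coordProj I ξ))
  refine ⟨f, hF hf, by rw [hfe]; exact hdist, (hc f hf).trans ?_⟩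
  rw [hfe]
  calc _ ≤ tau β n * ‖ξ‖ := by
        gcongr
        exact (norm_starProjection_le _ _).trans (norm_coordProj_le _ _)
    _ = β / 16 := by rw [hξ, tau_mul_sqrt hn]
    _ ≤ 1 / 96 := by linarith

theorem one_sub_llsStep_le {β ε : ℝ} (hβ₀ : 0 < β) {z d : Pt n} (hg : 0 < gap z)
    (h1 : ‖had d.1 d.2‖ ≤ β * gap z / 4) (h2 : ‖had (z.1 + d.1) (z.2 + d.2)‖ ≤ 3 * ε * gap z) :
    1 - llsStep β z d ≤ 12 * ε / β := by
  rw [llsStep, if_pos h1, sub_sub_cancel, div_le_div_iff_of_pos_right hβ₀]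
  have : ‖had (z.1 + d.1) (z.2 + d.2)‖ / gap z ≤ 3 * ε := by rwa [div_le_iff₀ hg]
  linarith

theorem norm_coordProj_had_le {I : Finset (Fin n)} {g w : Vec (Fin n)} {a b : ℝ} (ha : 0 ≤ a)
    (h : ∀ i ∈ I, |g i| ≤ a) (hw : ‖coordProj I w‖ ≤ b) : ‖coordProj I (had g w)‖ ≤ a * b :=
  (norm_sq_hadL_coordProj_le ha h).trans (by gcongr)

theorem had_comm (u v : Vec (Fin n)) : had u v = had v u := by
  ext i; simp [mul_comm]

/-- The `I`-parts of the two products that determine the step-length. -/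
theorem layered_products_le (hn : 0 < n) {I J : Finset (Fin n)} {β ε₀ : ℝ} (hβ₀ : 0 < β)
    (hβ : β ≤ 1 / 6) (hε : 0 < ε₀) (hε1 : ε₀ ≤ 1 / 100) {ξ δ δ' : Vec (Fin n)} (hξ : ‖ξ‖ = √n)
    (hξ' : ∀ i, 9 / 10 ≤ ξ i ∧ ξ i ≤ 11 / 10) (h1 : ‖coordProj I ξ + coordProj I δ‖ ≤ ε₀)
    (h2 : ‖coordProj J ξ + coordProj J δ'‖ ≤ ε₀)
    (h3 : ‖coordProj I δ'‖ ≤ tau β n * ‖coordProj J δ'‖) :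
    ‖coordProj I (had δ δ')‖ ≤ β / 8 ∧ ‖coordProj I (had (ξ + δ') (ξ + δ))‖ ≤ 6 / 5 * ε₀ := by
  have hτ := tau_nonneg hβ₀ n
  have hn1 : (1 : ℝ) ≤ √n := Real.one_le_sqrt.2 (by exact_mod_cast hn)
  have hJ : ‖coordProj J δ'‖ ≤ 101 / 100 * √n := by
    have e : coordProj J δ' = (coordProj J ξ + coordProj J δ') - coordProj J ξ := by abel
    rw [e]
    refine (norm_sub_le _ _).trans ?_
    have := norm_coordProj_le J ξ
    rw [hξ] at this
    linarith
  -- The choice of `τ` enters through `τ √n = β/16`: the side effect of a layered direction on the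
  -- other part is of order `β`.
  have hI : ‖coordProj I δ'‖ ≤ 101 / 1600 * β := by
    refine h3.trans ?_
    calc _ ≤ tau β n * (101 / 100 * √n) := by gcongr
      _ = 101 / 100 * (tau β n * √n) := by ring
      _ = 101 / 1600 * β := by rw [tau_mul_sqrt hn]; ring
  have hδ : ∀ i ∈ I, |ξ i + δ i| ≤ ε₀ := fun i hi =>
    (abs_apply_le_norm (coordProj I ξ + coordProj I δ) ⟨i, hi⟩).trans h1
  have hδ' : ∀ i ∈ I, |δ' i| ≤ 101 / 1600 * β := fun i hi =>
    (abs_apply_le_norm (coordProj I δ') ⟨i, hi⟩).trans hI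
  constructor
  · refine (norm_coordProj_had_le (a := 112 / 100) (by norm_num) (fun i hi => ?_) hI).trans
      (by linarith)
    have := abs_le.1 (hδ i hi)
    rw [abs_le]
    constructor <;> linarith [hξ' i]
  · refine norm_coordProj_had_le (by norm_num) (fun i hi => ?_) (by rw [map_add]; exact h1)
    have := abs_le.1 (hδ' i hi)
    rw [PiLp.add_apply, abs_le]
    constructor <;> linarith [hξ' i]

/-- If the affine direction has small scaled primal part, then moving `s` all the way along it
nearly cancels the products. -/
theorem PosPt.norm_had_affine_le {z da : Pt n} (h : PosPt z) (hn : 0 < n) {P : LPData m n}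
    (hda : P.IsNewtonDir 0 z da) (hξ : ∀ i, |xi z i| ≤ 11 / 10) {e : ℝ} {v : Vec (Fin n)}
    (hv : v ∈ P.Ws z) (hve : ‖v + xi z‖ ≤ e) :
    ‖had z.1 (z.2 + da.2)‖ ≤ 11 / 10 * e * gap z := by
  have hg := h.gap_pos hn
  set p := had (hinv (xhat z)) da.1 with hp
  have hpW : p ∈ P.Wx z := P.hinv_xhat_mem z hda.1
  have hqW : had (hinv (shat z)) da.2 ∈ P.Ws z := P.hinv_shat_mem z hda.2.1
  rw [h.Ws_eq hn] at hqW hv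
  -- The sum `p + (q - v)` equals `-(v + ξ)`, and `p` is orthogonal to `q - v`.
  have hpe : ‖p‖ ≤ e := by
    refine (norm_le_norm_add_of_mem_orthogonal hpW (Submodule.sub_mem _ hqW hv)).trans ?_
    rw [← add_sub_assoc, h.newton_zero_scaled hn hda, ← norm_neg,
      show -(-xi z - v) = v + xi z by abel]
    exact hve
  have e1 : had z.1 (z.2 + da.2) = -(gap z • had (xi z) p) := by
    ext i
    have h4 := hda.apply_zero i
    have h5 : z.2 i * da.1 i = gap z * (xi z i * p i) := by
      rw [hp, had_apply, hinv_apply, ← h.xhat_mul_shat hn i, ← h.shat_mul_xi hn i]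
      have := (h.xhat_pos hn i).ne'
      field_simp
    simp only [had_apply, PiLp.add_apply, PiLp.neg_apply, PiLp.smul_apply, smul_eq_mul]
    linarith
  rw [e1, norm_neg, norm_smul, Real.norm_of_nonneg hg.le, mul_comm]
  gcongr
  refine (norm_had_le (xi z) p _ (by norm_num) (fun i => ?_) hξ).trans (by gcongr)
  rw [had_apply, abs_mul]

theorem PosPt.norm_had_affine_le' {z da : Pt n} (h : PosPt z) (hn : 0 < n) {P : LPData m n}
    (hda : P.IsNewtonDir 0 z da) (hξ : ∀ i, |xi z i| ≤ 11 / 10) {e : ℝ} {w : Vec (Fin n)}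
    (hw : w ∈ P.Wx z) (hwe : ‖w + xi z‖ ≤ e) :
    ‖had (z.1 + da.1) z.2‖ ≤ 11 / 10 * e * gap z := by
  have hg := h.gap_pos hn
  set q := had (hinv (shat z)) da.2 with hq
  have hpW : had (hinv (xhat z)) da.1 ∈ P.Wx z := P.hinv_xhat_mem z hda.1
  have hqW : q ∈ P.Ws z := P.hinv_shat_mem z hda.2.1
  rw [h.Ws_eq hn] at hqW
  have hqe : ‖q‖ ≤ e := by
    refine (norm_le_norm_add_of_mem_orthogonal (K := (P.Wx z)ᗮ)
      (w := had (hinv (xhat z)) da.1 - w) hqW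
      (by rw [Submodule.orthogonal_orthogonal]; exact Submodule.sub_mem _ hpW hw)).trans ?_
    rw [← add_sub_assoc, add_comm q, h.newton_zero_scaled hn hda, ← norm_neg,
      show -(-xi z - w) = w + xi z by abel]
    exact hwe
  have e1 : had (z.1 + da.1) z.2 = -(gap z • had (xi z) q) := by
    ext i
    have h4 := hda.apply_zero i
    have h5 : z.1 i * da.2 i = gap z * (xi z i * q i) := by
      rw [hq, had_apply, hinv_apply, ← h.xhat_mul_shat hn i, ← h.xhat_mul_xi hn i]
      have := (h.shat_pos hn i).ne'
      field_simp
    simp only [had_apply, PiLp.add_apply, PiLp.neg_apply, PiLp.smul_apply, smul_eq_mul]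
    linarith
  rw [e1, norm_neg, norm_smul, Real.norm_of_nonneg hg.le, mul_comm]
  gcongr
  refine (norm_had_le (xi z) q _ (by norm_num) (fun i => ?_) hξ).trans (by gcongr)
  rw [had_apply, abs_mul]

theorem norm_eq_of_compl_empty {B : Finset (Fin n)} (hB : Bᶜ = ∅) (v : Vec (Fin n)) :
    ‖v‖ ≤ ‖coordProj B v‖ := by
  refine (norm_le_coordProj_add B v).trans ?_
  have : ‖coordProj Bᶜ v‖ = 0 := by
    have hs := norm_sq_eq_sum (coordProj Bᶜ v)
    simp only [coordProj_apply] at hs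
    have h0 : ∑ i ∈ Bᶜ, v i ^ 2 = 0 := by rw [hB, Finset.sum_empty]
    rw [Finset.sum_coe_sort Bᶜ (fun i => v i ^ 2), h0] at hs
    exact pow_eq_zero_iff (two_ne_zero) |>.1 hs
  rw [this, add_zero]

/-- If the numbers of cheap directions cannot grow in a wide range of thresholds, one iteration
reduces the gap by a large factor. -/
theorem LPData.Step.gap_le {P : LPData m n} (hn : 0 < n) {β : ℝ} (hβ₀ : 0 < β) (hβ : β ≤ 1 / 6)
    {z z' : Pt n} (hz : z ∈ P.N2 β) {B : Finset (Fin n)} {ρ e R ε₀ σ₀ : ℝ} {a b : ℕ}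
    (hR : 0 ≤ R) (hσ₀ : 0 ≤ σ₀) (hστ : √n * σ₀ ≤ tau β n / n) (hε : 0 < ε₀)
    (hε1 : ε₀ ≤ 1 / 100) (he : 2 * e ≤ ε₀)
    (hρ : tau β n + (tau β n * (2 * √n) + R) * (2 / ε₀) ≤ ρ) {w v : Vec (Fin n)}
    (hw : w ∈ P.Wx z) (hw1 : ‖coordProj Bᶜ w + coordProj Bᶜ (xi z)‖ ≤ e)
    (hw2 : ‖coordProj B w‖ ≤ R)
    (hv : v ∈ P.Ws z) (hv1 : ‖coordProj B v + coordProj B (xi z)‖ ≤ e)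
    (hv2 : ‖coordProj Bᶜ v‖ ≤ R)
    (ha : Cone (P.Wx z) Bᶜ B σ₀ a) (ha' : ¬ Cone (P.Wx z) Bᶜ B ρ (a + 1))
    (hb : Cone (P.Ws z) B Bᶜ σ₀ b) (hb' : ¬ Cone (P.Ws z) B Bᶜ ρ (b + 1))
    (hstep : P.Step β z z') : gap z' ≤ 13 * ε₀ / β * gap z := by
  have hpos := P.N2_posPt hz
  have hg := hpos.gap_pos hn
  have hξ := P.xi_bounds hn hβ hz
  have hξ' : ∀ i, |xi z i| ≤ 11 / 10 := fun i => abs_le.2 ⟨by linarith [hξ i], (hξ i).2⟩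
  have hnorm := hpos.norm_xi hn
  have hτ := tau_nonneg hβ₀ n
  have hn1 : (1 : ℝ) ≤ √n := Real.one_le_sqrt.2 (by exact_mod_cast hn)
  have hnear : ∀ (I : Finset (Fin n)) (u : Vec (Fin n)),
      ‖coordProj I u + coordProj I (xi z)‖ ≤ e → ‖coordProj I u‖ ≤ 2 * √n := by
    intro I u hu
    have h1 : coordProj I u = (coordProj I u + coordProj I (xi z)) - coordProj I (xi z) := by abel
    rw [h1]
    refine (norm_sub_le _ _).trans ?_
    have h2 := norm_coordProj_le I (xi z)
    rw [hnorm] at h2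
    linarith
  have hw3 := hnear _ _ hw1
  have hv3 := hnear _ _ hv1
  obtain ⟨da, αa, B', N', CV, CU, d, zp, hda, hαa, hB', hN', hCV, hCU, hd, hzp, hz'⟩ := hstep
  -- The partition guessed by the algorithm is the polarizing one.
  have hBB : B' = B := by
    obtain ⟨f, hf, hf1, hf2⟩ := exists_near_of_cone hn hβ₀ hβ hR hσ₀ hστ hε he hρ hnorm hw hw1 hw2
      hw3 ha ha'
    obtain ⟨g, hg', hg1, hg2⟩ := exists_near_of_cone hn hβ₀ hβ hR hσ₀ hστ hε he hρ hnorm hv hv1 hv2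
      hv3 hb hb'
    rw [hpos.Ws_eq hn] at hg'
    have hq : had (hinv (shat z)) da.2 ∈ (P.Wx z)ᗮ := by
      rw [← hpos.Ws_eq hn]; exact P.hinv_shat_mem z hda.2.1
    obtain ⟨k1, k2⟩ := abs_lt_abs_of_near hε1 (fun i => (hξ i).1) (P.hinv_xhat_mem z hda.1) hq
      (hpos.newton_zero_scaled hn hda) hf hg' hf1 hf2 hg1 hg2
    rw [hB']
    ext i
    rw [hpos.mem_assocB hn]
    refine ⟨fun hlt => ?_, k1 i⟩
    by_contra hi
    exact absurd hlt (k2 i (Finset.mem_compl.2 hi)).not_gt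
  clear hB'
  subst hBB hN'
  have hdm := hd.mem hn hpos hda rfl inf_le_right inf_le_right
  have hnext := (P.next_iterate hn hβ₀ hβ hz hda hαa hdm.1 hdm.2 hzp hz').2.2
  have he0 : 0 ≤ e := (norm_nonneg _).trans hw1
  have hbound : ‖had d.1 d.2‖ ≤ β * gap z / 4 ∧
      ‖had (z.1 + d.1) (z.2 + d.2)‖ ≤ 3 * ε₀ * gap z := by
    -- If a part is empty, `v` (respectively `w`) approximates `-ξ` in all coordinates, and a full
    -- affine step in one variable suffices.
    rcases (B'ᶜ).eq_empty_or_nonempty with hN0 | hN0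
    · rw [hd.2.1 hN0]
      constructor
      · have : had (0 : Vec (Fin n)) da.2 = 0 := by ext i; simp
        rw [this, norm_zero]; positivity
      · rw [add_zero]
        have hve : ‖v + xi z‖ ≤ e := by
          refine (norm_eq_of_compl_empty hN0 _).trans ?_
          rwa [map_add]
        refine (hpos.norm_had_affine_le hn hda hξ' hv hve).trans ?_
        exact mul_le_mul_of_nonneg_right (by linarith) hg.le
    rcases B'.eq_empty_or_nonempty with hB0 | hB0
    · rw [hd.2.2 hB0]
      constructor
      · have : had da.1 (0 : Vec (Fin n)) = 0 := by ext i; simp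
        rw [this, norm_zero]; positivity
      · rw [add_zero]
        have hwe : ‖w + xi z‖ ≤ e := by
          refine (norm_eq_of_compl_empty (B := B'ᶜ) (by rw [compl_compl, hB0]) _).trans ?_
          rwa [map_add]
        refine (hpos.norm_had_affine_le' hn hda hξ' hw hwe).trans ?_
        exact mul_le_mul_of_nonneg_right (by linarith) hg.le
    obtain ⟨δp, δd, hp, hq, rfl⟩ := hd.1 hB0 hN0
    obtain ⟨p1, p2⟩ := hp.bounds (compl_compl B') hσ₀ hτ hR (by positivity) hε he hρ hw hw1 hw2 hw3
      ha' ha hn hστ hCV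
    obtain ⟨q1, q2⟩ := hq.bounds rfl hσ₀ hτ hR (by positivity) hε he hρ hv hv1 hv2 hv3
      hb' hb hn hστ hCU
    obtain ⟨r1, r2⟩ := layered_products_le hn hβ₀ hβ hε hε1 hnorm hξ p1 q1 q2
    obtain ⟨t1, t2⟩ := layered_products_le hn hβ₀ hβ hε hε1 hnorm hξ q1 p1 p2
    rw [had_comm] at r2 t1
    have e1 : had (had (xhat z) δp) (had (shat z) δd) = gap z • had δp δd := by
      ext i
      simp only [had_apply, PiLp.smul_apply, smul_eq_mul]
      rw [← hpos.xhat_mul_shat hn i]; ring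
    have e2 : had (z.1 + had (xhat z) δp) (z.2 + had (shat z) δd) =
        gap z • had (xi z + δp) (xi z + δd) := by
      ext i
      simp only [had_apply, PiLp.add_apply, PiLp.smul_apply, smul_eq_mul]
      rw [← hpos.xhat_mul_xi hn i, ← hpos.shat_mul_xi hn i, ← hpos.xhat_mul_shat hn i]; ring
    simp only
    rw [e1, e2, norm_smul, norm_smul, Real.norm_of_nonneg hg.le]
    constructor
    · have := norm_le_coordProj_add B' (had δp δd)
      have h4 : ‖had δp δd‖ ≤ β / 4 := by linarith
      calc _ ≤ gap z * (β / 4) := by gcongr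
        _ = _ := by ring
    · have := norm_le_coordProj_add B' (had (xi z + δp) (xi z + δd))
      have h4 : ‖had (xi z + δp) (xi z + δd)‖ ≤ 3 * ε₀ := by linarith
      calc _ ≤ gap z * (3 * ε₀) := by gcongr
        _ = _ := by ring
  refine hnext.trans ?_
  have hlls := one_sub_llsStep_le hβ₀ hg hbound.1 hbound.2
  gcongr
  calc (1 - llsStep β z d) * (1 + β / 4) ≤ 12 * ε₀ / β * (1 + β / 4) := by gcongr
    _ ≤ 12 * ε₀ / β * (13 / 12) := by gcongr; linarith
    _ = _ := by ring

/-! ### Comparing two iterates -/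

/-- `z` and `z'` are comparable within a factor `K`: `x̂` on `B` and `ŝ` on `Bᶜ`. -/
def Comparable (B : Finset (Fin n)) (K : ℝ) (z z' : Pt n) : Prop :=
  (∀ i ∈ B, xhat z i ≤ K * xhat z' i) ∧ ∀ i ∈ Bᶜ, shat z i ≤ K * shat z' i

/-- Dividing by `ξ` costs a factor `(11/10)/(9/10) < 2`. -/
theorem comparable_of_le {P : LPData m n} (hn : 0 < n) {β K : ℝ} (hβ : β ≤ 1 / 6) (hK : 0 ≤ K)
    {z z' : Pt n} (hz : z ∈ P.N2 β) (hz' : z' ∈ P.N2 β) {B : Finset (Fin n)}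
    (hx : ∀ i ∈ B, z.1 i ≤ K * z'.1 i) (hs : ∀ i ∈ Bᶜ, z.2 i ≤ K * z'.2 i) :
    Comparable B (2 * K) z z' := by
  have hp := P.N2_posPt hz
  have hp' := P.N2_posPt hz'
  have key : ∀ a a' ξ ξ' : ℝ, 0 < a → 0 < a' → 9 / 10 ≤ ξ → ξ' ≤ 11 / 10 →
      a * ξ ≤ K * (a' * ξ') → a ≤ 2 * K * a' := by
    intro a a' ξ ξ' ha ha' h1 h2 h3
    have h4 : a * (9 / 10) ≤ K * (a' * (11 / 10)) :=
      le_trans (by gcongr) (h3.trans (by gcongr))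
    nlinarith [mul_nonneg hK ha'.le]
  refine ⟨fun i hi => ?_, fun i hi => ?_⟩
  · refine key _ _ _ _ (hp.xhat_pos hn i) (hp'.xhat_pos hn i) (P.xi_bounds hn hβ hz i).1
      (P.xi_bounds hn hβ hz' i).2 ?_
    rw [hp.xhat_mul_xi hn, hp'.xhat_mul_xi hn]; exact hx i hi
  · refine key _ _ _ _ (hp.shat_pos hn i) (hp'.shat_pos hn i) (P.xi_bounds hn hβ hz i).1
      (P.xi_bounds hn hβ hz' i).2 ?_
    rw [hp.shat_mul_xi hn, hp'.shat_mul_xi hn]; exact hs i hi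

/-- On the other parts of the partition the entries scale with the gap. -/
theorem Comparable.swap {B : Finset (Fin n)} {K r : ℝ} {z z' : Pt n} (hn : 0 < n)
    (h : Comparable B K z z') (hz : PosPt z) (hz' : PosPt z') (hr : gap z' = r * gap z)
    (hr0 : 0 ≤ r) :
    (∀ i ∈ Bᶜ, xhat z' i ≤ K * r * xhat z i) ∧ ∀ i ∈ B, shat z' i ≤ K * r * shat z i := by
  constructor
  · intro i hi
    have h1 := hz.xhat_pos hn i
    refine le_of_mul_le_mul_right ?_ (hz'.shat_pos hn i)
    rw [hz'.xhat_mul_shat hn, hr, ← hz.xhat_mul_shat hn i]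
    calc r * (xhat z i * shat z i) ≤ r * (xhat z i * (K * shat z' i)) := by
          gcongr; exact h.2 i hi
      _ = _ := by ring
  · intro i hi
    have h1 := hz.shat_pos hn i
    refine le_of_mul_le_mul_left ?_ (hz'.xhat_pos hn i)
    rw [hz'.xhat_mul_shat hn, hr, ← hz.xhat_mul_shat hn i]
    calc r * (xhat z i * shat z i) ≤ r * (K * xhat z' i * shat z i) := by
          gcongr; exact h.1 i hi
      _ = _ := by ring

/-- Passing from `z` to `z'` scales vectors by `x̂/x̂'`, which is at most `K` on `B` and, by
`Comparable.swap`, at least `1/(K r)` on `Bᶜ`. Directions become cheaper as the gap falls. -/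
theorem Comparable.cone_Wx {P : LPData m n} {B : Finset (Fin n)} {K r σ : ℝ} {d : ℕ}
    {z z' : Pt n} (hn : 0 < n) (h : Comparable B K z z') (hz : PosPt z) (hz' : PosPt z')
    (hK : 0 ≤ K) (hr : gap z' = r * gap z) (hr0 : 0 ≤ r) (hσ : 0 ≤ σ)
    (hc : Cone (P.Wx z) Bᶜ B σ d) : Cone (P.Wx z') Bᶜ B (K ^ 2 * r * σ) d := by
  have hsw := h.swap hn hz hz' hr hr0
  rw [← hz.map_Wx hn P, show K ^ 2 * r * σ = K * σ * (K * r) by ring]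
  refine hc.map_hadL hσ hK (by positivity)
    (fun i => div_pos (hz.xhat_pos hn i) (hz'.xhat_pos hn i)) (fun i hi => ?_) (fun i hi => ?_)
  · rw [div_le_iff₀ (hz'.xhat_pos hn i)]; exact h.1 i hi
  · rw [← mul_div_assoc, le_div_iff₀ (hz'.xhat_pos hn i), one_mul]; exact hsw.1 i hi

theorem Comparable.cone_Ws {P : LPData m n} {B : Finset (Fin n)} {K r σ : ℝ} {d : ℕ}
    {z z' : Pt n} (hn : 0 < n) (h : Comparable B K z z') (hz : PosPt z) (hz' : PosPt z')
    (hK : 0 ≤ K) (hr : gap z' = r * gap z) (hr0 : 0 ≤ r) (hσ : 0 ≤ σ)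
    (hc : Cone (P.Ws z) B Bᶜ σ d) : Cone (P.Ws z') B Bᶜ (K ^ 2 * r * σ) d := by
  have hsw := h.swap hn hz hz' hr hr0
  rw [← hz.map_Ws hn P, show K ^ 2 * r * σ = K * σ * (K * r) by ring]
  refine hc.map_hadL hσ hK (by positivity)
    (fun i => div_pos (hz.shat_pos hn i) (hz'.shat_pos hn i)) (fun i hi => ?_) (fun i hi => ?_)
  · rw [div_le_iff₀ (hz'.shat_pos hn i)]; exact h.2 i hi
  · rw [← mul_div_assoc, le_div_iff₀ (hz'.shat_pos hn i), one_mul]; exact hsw.2 i hi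

/-- The scaled difference `(x' - x) / x̂` is close to `-ξ` where `x'` is small, and bounded where `x'`
and `x` are comparable. -/
theorem scaled_diff_bounds {I J : Finset (Fin n)} {x x' u u' ξ ξ' : Vec (Fin n)} {K r : ℝ}
    (hK : 1 ≤ K) (hr : 0 ≤ r) (hu : ∀ i, 0 < u i) (hu' : ∀ i, 0 < u' i)
    (hξ : ∀ i, 9 / 10 ≤ ξ i ∧ ξ i ≤ 11 / 10) (hξ' : ∀ i, 9 / 10 ≤ ξ' i ∧ ξ' i ≤ 11 / 10)
    (hx : ∀ i, u i * ξ i = x i) (hx' : ∀ i, u' i * ξ' i = x' i)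
    (hI : ∀ i ∈ I, u' i ≤ K * r * u i) (hJ : ∀ i ∈ J, u' i ≤ K * u i) :
    ‖coordProj I (had (hinv u) (x' - x)) + coordProj I ξ‖ ≤ 2 * K * r * √n ∧
      ‖coordProj J (had (hinv u) (x' - x))‖ ≤ 2 * K * √n := by
  have hcard : ∀ I : Finset (Fin n), Fintype.card I ≤ n := fun I => by
    rw [Fintype.card_coe]
    exact (Finset.card_le_univ I).trans (Fintype.card_fin n).le
  have e : ∀ i, had (hinv u) (x' - x) i = u' i / u i * ξ' i - ξ i := fun i => by
    have := hu i
    rw [had_apply, hinv_apply, PiLp.sub_apply, ← hx, ← hx']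
    field_simp
  constructor
  · refine norm_le_sqrt_card _ (by positivity) (fun i => ?_) (hcard I)
    rw [PiLp.add_apply, coordProj_apply, coordProj_apply, e, sub_add_cancel]
    have h1 := hu i
    have h2 := hu' i
    have h3 := hξ' i
    have h4 : u' i / u i ≤ K * r := by rw [div_le_iff₀ h1]; exact hI i i.2
    rw [abs_of_nonneg (mul_nonneg (by positivity) (by linarith))]
    calc u' i / u i * ξ' i ≤ K * r * 2 := by
          have : 0 ≤ ξ' i := by linarith
          gcongr; linarith
      _ = _ := by ring
  · refine norm_le_sqrt_card _ (by positivity) (fun i => ?_) (hcard J)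
    rw [coordProj_apply, e]
    have h1 := hu i
    have h2 := hu' i
    have h3 := hξ' i
    have h5 := hξ i
    have h4 : u' i / u i ≤ K := by rw [div_le_iff₀ h1]; exact hJ i i.2
    have h6 : u' i / u i * ξ' i ≤ K * (11 / 10) := by
      have : 0 ≤ ξ' i := by linarith
      gcongr; exact h3.2
    have h7 : 0 ≤ u' i / u i * ξ' i := mul_nonneg (by positivity) (by linarith)
    rw [abs_le]
    constructor <;> linarith

/-- One iteration at `z` makes the gap comparable to that of `z'` if there are no more cheap
directions at `z'` than at `z`. -/
theorem LPData.Step.gap_le_of_not_cone {P : LPData m n} (hn : 0 < n) {β : ℝ} (hβ₀ : 0 < β)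
    (hβ : β ≤ 1 / 6) {z z' z₁ : Pt n} (hz : z ∈ P.N2 β) (hz' : z' ∈ P.N2 β) {B : Finset (Fin n)}
    {K : ℝ} (hK : 1 ≤ K) (h1 : Comparable B K z z') (h2 : Comparable B K z' z)
    (hr : 256 * K ^ 3 * n ^ 3 / β * gap z' ≤ 1 / 100 * gap z) {a b : ℕ}
    (ha : Cone (P.Wx z) Bᶜ B (tau β n / n ^ 2) a)
    (ha' : ¬ Cone (P.Wx z') Bᶜ B (tau β n / n ^ 2) (a + 1))
    (hb : Cone (P.Ws z) B Bᶜ (tau β n / n ^ 2) b)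
    (hb' : ¬ Cone (P.Ws z') B Bᶜ (tau β n / n ^ 2) (b + 1)) (hstep : P.Step β z z₁) :
    gap z₁ ≤ 13 * (256 * K ^ 3 * n ^ 3 / β) / β * gap z' := by
  have hp := P.N2_posPt hz
  have hp' := P.N2_posPt hz'
  have hg := hp.gap_pos hn
  have hg' := hp'.gap_pos hn
  set r := gap z' / gap z with hrdef
  have hrpos : 0 < r := div_pos hg' hg
  have hrg : gap z' = r * gap z := by rw [hrdef, div_mul_cancel₀ _ hg.ne']
  have hnR : (1 : ℝ) ≤ n := by exact_mod_cast hn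
  set q := √(n : ℝ) with hq
  have hq1 : 1 ≤ q := Real.one_le_sqrt.2 hnR
  have hqn : q ^ 2 = n := Real.sq_sqrt (by linarith)
  have hτ : tau β n = β / (16 * q) := rfl
  have hτ0 : 0 < tau β n := by rw [hτ]; positivity
  set κ := 256 * K ^ 3 * n ^ 3 / β with hκ
  have hκr : κ * r ≤ 1 / 100 := by
    refine le_of_mul_le_mul_right ?_ hg
    rw [mul_assoc, ← hrg]; exact hr
  set σ₀ := tau β n / n ^ 2 with hσ
  have hσ0 : 0 < σ₀ := by positivity
  -- The threshold at `z` that the transfer to `z'` turns into `σ₀`.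
  set ρ := σ₀ / (K ^ 2 * r) with hρ
  have hρσ : K ^ 2 * r * ρ = σ₀ := by rw [hρ]; field_simp
  have hna : ¬ Cone (P.Wx z) Bᶜ B ρ (a + 1) := fun hc => ha' (by
    rw [← hρσ]
    exact h1.cone_Wx hn hp hp' (by linarith) hrg hrpos.le (by positivity) hc)
  have hnb : ¬ Cone (P.Ws z) B Bᶜ ρ (b + 1) := fun hc => hb' (by
    rw [← hρσ]
    exact h1.cone_Ws hn hp hp' (by linarith) hrg hrpos.le (by positivity) hc)
  have hsw := h1.swap hn hp hp' hrg hrpos.le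
  obtain ⟨w1, w2⟩ := scaled_diff_bounds (I := Bᶜ) (J := B) hK hrpos.le (hp.xhat_pos hn)
    (hp'.xhat_pos hn) (P.xi_bounds hn hβ hz) (P.xi_bounds hn hβ hz') (hp.xhat_mul_xi hn)
    (hp'.xhat_mul_xi hn) hsw.1 h2.1
  obtain ⟨v1, v2⟩ := scaled_diff_bounds (I := B) (J := Bᶜ) hK hrpos.le (hp.shat_pos hn)
    (hp'.shat_pos hn) (P.xi_bounds hn hβ hz) (P.xi_bounds hn hβ hz') (hp.shat_mul_xi hn)
    (hp'.shat_mul_xi hn) hsw.2 h2.2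
  have hKr : K ^ 2 * n ^ 2 * r ≤ 1 / 2 := by
    have e1 : K ^ 2 * n ^ 2 * r ≤ K ^ 3 * n ^ 3 * r := by
      gcongr
      · norm_num
      · norm_num
    have e2 : 256 * (K ^ 3 * n ^ 3 * r) ≤ κ * r := by
      rw [hκ, ← mul_assoc, ← mul_assoc]
      gcongr
      rw [le_div_iff₀ hβ₀]
      have : 0 ≤ 256 * K ^ 3 * (n : ℝ) ^ 3 := by positivity
      nlinarith
    linarith
  have hfin := hstep.gap_le hn hβ₀ hβ hz (e := 2 * K * r * q) (R := 2 * K * q) (ε₀ := κ * r)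
    (ρ := ρ) (by positivity) hσ0.le ?_ (by positivity) hκr ?_ ?_
    (P.hinv_xhat_mem z (P.primalPos_sub_mem hz'.1 hz.1)) w1 w2
    (P.hinv_shat_mem z (P.dualPos_sub_mem hz'.2.1 hz.2.1)) v1 v2 ha hna hb hnb
  · refine hfin.trans (le_of_eq ?_)
    rw [hrg]; ring
  · have hqle : q ≤ n := by nlinarith
    calc q * σ₀ ≤ n * σ₀ := by gcongr
      _ = tau β n / n := by rw [hσ]; field_simp
  · rw [hκ, div_mul_eq_mul_div, le_div_iff₀ hβ₀]
    have e1 : K * q ≤ K ^ 3 * n ^ 3 := by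
      have : q ≤ n := by nlinarith
      calc K * q ≤ K * n := by gcongr
        _ ≤ K ^ 3 * n ^ 3 := by
          gcongr
          · exact le_self_pow₀ hK (by norm_num)
          · exact le_self_pow₀ hnR (by norm_num)
    have e2 : 0 ≤ K * q := by positivity
    have e3 : 2 * (2 * K * r * q) * β = (4 * β) * r * (K * q) := by ring
    rw [e3]
    calc 4 * β * r * (K * q) ≤ 256 * r * (K ^ 3 * n ^ 3) := by gcongr; linarith
      _ = _ := by ring
  · have e1 : tau β n * (2 * q) ≤ 2 * K * q := by
      rw [hτ]
      have : β / (16 * q) * (2 * q) = β / 8 := by field_simp; norm_num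
      rw [this]; nlinarith
    have e2 : tau β n ≤ ρ / 2 := by
      rw [hρ, hσ, div_div, div_div, le_div_iff₀ (by positivity)]
      have : (n : ℝ) ^ 2 * (K ^ 2 * r) * 2 ≤ 1 := by linarith
      nlinarith
    -- An equality, which dictates the choice of `κ`: at accuracy `ε₀ = κ r`, adjoining the scaled
    -- difference reaches half of the threshold `ρ`.
    have e3 : (2 * K * q + 2 * K * q) * (2 / (κ * r)) ≤ ρ / 2 := by
      rw [hρ, hσ, hκ, hτ, ← hqn]
      apply le_of_eq
      field_simp
      norm_num
    calc _ ≤ ρ / 2 + (2 * K * q + 2 * K * q) * (2 / (κ * r)) := by gcongr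
      _ ≤ ρ / 2 + ρ / 2 := by gcongr
      _ = ρ := by ring

/-! ### Counting iterations -/

theorem LPData.reachesWithin_of_goal {P : LPData m n} {β : ℝ} {goal : Pt n → Prop} {z : Pt n}
    (h : goal z) (k : ℕ) : P.ReachesWithin β goal k z := by
  cases k with
  | zero => exact h
  | succ k => exact Or.inl h

/-- The points the algorithm has to find. -/
def LPData.Goal (P : LPData m n) (β μ₁ : ℝ) (z : Pt n) : Prop :=
  gap z ≤ μ₁ ∧ (z ∈ P.N2 β ∨ (gap z = 0 ∧ z ∈ closure (P.N2 (2 * β))))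

theorem LPData.Step.outcome {P : LPData m n} (hn : 0 < n) {β : ℝ} (hβ₀ : 0 < β) (hβ : β ≤ 1 / 6)
    {z z' : Pt n} (hz : z ∈ P.N2 β) (h : P.Step β z z') :
    (z' ∈ P.N2 β ∨ (gap z' = 0 ∧ z' ∈ closure (P.N2 (2 * β)))) ∧
      gap z' ≤ (1 - β / (2 * √n)) * gap z := by
  obtain ⟨da, αa, B, N, CV, CU, d, zp, hda, hαa, -, hN, -, -, hd, hzp, hz'⟩ := h
  have hdm := hd.mem hn (P.N2_posPt hz) hda hN inf_le_right inf_le_right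
  have := P.next_iterate hn hβ₀ hβ hz hda hαa hdm.1 hdm.2 hzp hz'
  exact ⟨this.1, this.2.1⟩

/-- A next point outside `N²(β)` has gap `0 ≤ μ₁` and already meets the goal, so only points of
`N²(β)` with gap above `μ₁` need a continuation. -/
theorem LPData.reachesWithin_succ {P : LPData m n} (hn : 0 < n) {β μ₁ : ℝ} (hβ₀ : 0 < β)
    (hβ : β ≤ 1 / 6) (hμ₁ : 0 ≤ μ₁) {z : Pt n} (hz : z ∈ P.N2 β) {k : ℕ}
    (h : ∀ z' ∈ P.N2 β, P.Step β z z' → μ₁ < gap z' → gap z' ≤ (1 - β / (2 * √n)) * gap z →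
      P.ReachesWithin β (P.Goal β μ₁) k z') : P.ReachesWithin β (P.Goal β μ₁) (k + 1) z := by
  have hg := (P.N2_posPt hz).gap_pos hn
  refine Or.inr ⟨?_, P.exists_step hn hβ₀ hβ hz, fun z' hstep => ?_⟩
  · rw [inner_eq_sum, sum_eq_gap hn]
    have : (0 : ℝ) < n := by exact_mod_cast hn
    positivity
  · obtain ⟨h1, h2⟩ := hstep.outcome hn hβ₀ hβ hz
    rcases le_or_gt (gap z') μ₁ with hle | hlt
    · exact P.reachesWithin_of_goal ⟨hle, h1⟩ k
    · refine h z' ?_ hstep hlt h2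
      rcases h1 with h1 | h1
      · exact h1
      · rw [h1.1] at hlt
        exact absurd hlt hμ₁.not_gt

theorem rate_bounds (hn : 0 < n) {β : ℝ} (hβ₀ : 0 < β) (hβ : β ≤ 1 / 6) :
    0 ≤ 1 - β / (2 * √(n : ℝ)) ∧ 1 - β / (2 * √(n : ℝ)) ≤ 1 := by
  have hn1 : (1 : ℝ) ≤ √n := Real.one_le_sqrt.2 (by exact_mod_cast hn)
  have h0 : 0 ≤ β / (2 * √(n : ℝ)) := by positivity
  have h1 : β / (2 * √(n : ℝ)) ≤ β := div_le_self hβ₀.le (by linarith)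
  constructor <;> linarith

theorem LPData.reachesWithin_add {P : LPData m n} (hn : 0 < n) {β μ₁ : ℝ} (hβ₀ : 0 < β)
    (hβ : β ≤ 1 / 6) (hμ₁ : 0 ≤ μ₁) {k : ℕ} (T : ℕ) : ∀ {z : Pt n}, z ∈ P.N2 β → μ₁ < gap z →
    (∀ z' ∈ P.N2 β, μ₁ < gap z' → gap z' ≤ (1 - β / (2 * √n)) ^ T * gap z →
      P.ReachesWithin β (P.Goal β μ₁) k z') → P.ReachesWithin β (P.Goal β μ₁) (k + T) z := by
  induction T with
  | zero => exact fun hz hg h => h _ hz hg (by simp)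
  | succ T ih =>
    intro z hz hg h
    refine P.reachesWithin_succ hn hβ₀ hβ hμ₁ hz fun z₁ hz₁ _ hg₁ hle₁ => ?_
    refine ih hz₁ hg₁ fun z₂ hz₂ hg₂ hle₂ => h z₂ hz₂ hg₂ (hle₂.trans ?_)
    rw [pow_succ, mul_assoc]
    exact mul_le_mul_of_nonneg_left hle₁ (pow_nonneg (rate_bounds hn hβ₀ hβ).1 T)

/-- The number of iterations, with `T` iterations sufficing for a long decrease of the gap. -/
theorem LPData.reachesWithin_of_cone {P : LPData m n} (hn : 0 < n) {β μ₀ μ₁ K L : ℝ} (hβ₀ : 0 < β)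
    (hβ : β ≤ 1 / 6) (hμ₁ : 0 ≤ μ₁) (hK : 1 ≤ K) {B : Finset (Fin n)}
    (hcomp : ∀ z ∈ P.N2 β, ∀ z' ∈ P.N2 β, μ₁ < gap z → gap z < μ₀ → gap z' < μ₀ →
      Comparable B K z' z)
    (hL : L = 100 * (256 * K ^ 3 * n ^ 3 / β) / β) {T : ℕ}
    (hT : (1 - β / (2 * √n)) ^ T * L ≤ 1) (j : ℕ) :
    ∀ (a b : ℕ) (z : Pt n), a + b + j = 2 * n + 1 → z ∈ P.N2 β → μ₁ < gap z → gap z < μ₀ →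
      Cone (P.Wx z) Bᶜ B (tau β n / n ^ 2) a → Cone (P.Ws z) B Bᶜ (tau β n / n ^ 2) b →
      P.ReachesWithin β (P.Goal β μ₁) (j * (T + 1)) z := by
  have hrate := rate_bounds hn hβ₀ hβ
  have hσ : 0 ≤ tau β n / (n : ℝ) ^ 2 := div_nonneg (tau_nonneg hβ₀ n) (by positivity)
  set κ := 256 * K ^ 3 * n ^ 3 / β with hκ
  have hKκ : K ^ 2 ≤ κ := by
    have hnR : (1 : ℝ) ≤ n := by exact_mod_cast hn
    have h1 : K ^ 2 ≤ K ^ 3 := pow_le_pow_right₀ hK (by norm_num)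
    have h2 : K ^ 3 * 1 ≤ K ^ 3 * (n : ℝ) ^ 3 := by
      gcongr; exact one_le_pow₀ hnR
    have h3 : 0 ≤ K ^ 2 := by positivity
    rw [hκ, le_div_iff₀ hβ₀]
    nlinarith
  have hκ0 : 0 < κ := lt_of_lt_of_le (by positivity) hKκ
  have hL0 : 0 < L := by rw [hL]; positivity
  induction j with
  | zero =>
    intro a b z hab _ _ _ ha hb
    -- With no round left, `a + b = 2n + 1` contradicts `a, b ≤ n`.
    have h1 := ha.le
    have h2 := hb.le
    omega
  | succ j ih =>
    intro a b z hab hz h1 h0 ha hb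
    have hk : (j + 1) * (T + 1) = j * (T + 1) + T + 1 := by ring
    rw [hk]
    refine P.reachesWithin_succ hn hβ₀ hβ hμ₁ hz fun z₁ hz₁ hstep hg₁ hle₁ => ?_
    -- A round is one iteration, whose layered step is exploited, followed by `T` iterations of
    -- which only the guaranteed rate is used.
    refine P.reachesWithin_add hn hβ₀ hβ hμ₁ T hz₁ hg₁ fun z' hz' hg' hle' => ?_
    have hp := P.N2_posPt hz
    have hp' := P.N2_posPt hz'
    have hgz := hp.gap_pos hn
    have hgz₁ := (P.N2_posPt hz₁).gap_pos hn
    have hgz' := hp'.gap_pos hn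
    have hz₁z : gap z₁ ≤ gap z := hle₁.trans (mul_le_of_le_one_left hgz.le hrate.2)
    have hLz' : L * gap z' ≤ gap z₁ := by
      calc L * gap z' ≤ L * ((1 - β / (2 * √n)) ^ T * gap z₁) := by gcongr
        _ = (1 - β / (2 * √n)) ^ T * L * gap z₁ := by ring
        _ ≤ 1 * gap z₁ := by gcongr
        _ = gap z₁ := one_mul _
    have hκz' : κ * gap z' ≤ 1 / 100 * gap z := by
      have e : κ * gap z' = β / 100 * (L * gap z') := by rw [hL]; field_simp
      rw [e]
      have : 0 ≤ L * gap z' := by positivity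
      calc β / 100 * (L * gap z') ≤ 1 / 100 * (L * gap z') := by gcongr; linarith
        _ ≤ 1 / 100 * gap z := by gcongr; exact hLz'.trans hz₁z
    have hz'z : gap z' < μ₀ := by
      refine lt_of_le_of_lt ?_ h0
      have : (1 - β / (2 * √n)) ^ T * gap z₁ ≤ 1 * gap z₁ := by
        gcongr; exact pow_le_one₀ hrate.1 hrate.2
      linarith
    have c1 : Comparable B K z z' := hcomp z' hz' z hz hg' hz'z h0
    have c2 : Comparable B K z' z := hcomp z hz z' hz' h1 h0 hz'z
    set r := gap z' / gap z with hr
    have hr0 : 0 ≤ r := by positivity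
    have hrg : gap z' = r * gap z := by rw [hr, div_mul_cancel₀ _ hgz.ne']
    -- The gap fell by more than `K²`, so cheap directions persist at the same threshold.
    have hKr : K ^ 2 * r * (tau β n / (n : ℝ) ^ 2) ≤ tau β n / (n : ℝ) ^ 2 := by
      refine mul_le_of_le_one_left hσ ?_
      refine le_of_mul_le_mul_right ?_ hgz
      rw [mul_assoc, ← hrg]
      have : K ^ 2 * gap z' ≤ κ * gap z' := by gcongr
      linarith
    by_cases ha' : Cone (P.Wx z') Bᶜ B (tau β n / n ^ 2) (a + 1)
    · exact ih (a + 1) b z' (by omega) hz' hg' hz'z ha'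
        ((c1.cone_Ws hn hp hp' (by linarith) hrg hr0 hσ hb).mono hKr)
    by_cases hb' : Cone (P.Ws z') B Bᶜ (tau β n / n ^ 2) (b + 1)
    · exact ih a (b + 1) z' (by omega) hz' hg' hz'z
        ((c1.cone_Wx hn hp hp' (by linarith) hrg hr0 hσ ha).mono hKr) hb'
    -- If neither count grew, the first iteration alone would bring the gap to at most `13κ/β` times
    -- that of `z'`, while the next `T` iterations gained a factor `L = 100κ/β`.
    exfalso
    have hfin := hstep.gap_le_of_not_cone hn hβ₀ hβ hz hz' hK c1 c2 hκz' ha ha' hb hb'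
    rw [← hκ] at hfin
    have e : L * gap z' = 100 * (κ / β * gap z') := by rw [hL]; ring
    have e2 : 13 * κ / β * gap z' = 13 * (κ / β * gap z') := by ring
    have : 0 < κ / β * gap z' := by positivity
    linarith

end SubspaceIPM

/-! ### Assembling the iteration bound -/

theorem mainTheorem5 (β : ℝ) (hβ₀ : 0 < β) (hβ : β ≤ 1 / 6) :
    ∃ C : ℝ, 0 < C ∧
      ∀ (m n : ℕ) (P : SubspaceIPM.LPData m n) (μ₀ μ₁ γ : ℝ) (z : SubspaceIPM.Pt n),
        0 ≤ μ₁ → μ₁ < μ₀ → 0 < γ → γ ≤ 1 →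
        P.Polarized γ μ₁ μ₀ →
        z ∈ P.N2 β → μ₁ < SubspaceIPM.gap z → SubspaceIPM.gap z < μ₀ →
        ∃ k : ℕ, (k : ℝ) ≤ C * (1 + (n : ℝ) ^ (3 / 2 : ℝ) * Real.log (n / γ)) ∧
          P.ReachesWithin β
            (fun z' => SubspaceIPM.gap z' ≤ μ₁ ∧
              (z' ∈ P.N2 β ∨ (SubspaceIPM.gap z' = 0 ∧ z' ∈ closure (P.N2 (2 * β)))))
            k z := by
  -- The constant factor of `L`, since `L = M n⁹/γ³` once `K = 12n²/γ`.
  set M : ℝ := 100 * 256 * 12 ^ 3 / β ^ 2 with hM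
  have hM1 : 1 ≤ M := by
    rw [hM, le_div_iff₀ (by positivity)]
    nlinarith
  have hlogM : 0 ≤ Real.log M := Real.log_nonneg hM1
  set D : ℝ := 6 * Real.log M / β + 6 with hD
  set E : ℝ := 54 / β with hE
  have hD0 : 0 ≤ D := by positivity
  have hE0 : 0 < E := by positivity
  refine ⟨2 * D + E, by positivity, ?_⟩
  intro m n P μ₀ μ₁ γ z hμ₁ _ hγ hγ1 hpol hz hgz hgz0
  -- For `n = 0` the gap is `0/0 = 0`, which the strict lower bound excludes.
  have hn : 0 < n := SubspaceIPM.pos_of_gap_ne_zero (hμ₁.trans_lt hgz).ne'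
  have hnR : (1 : ℝ) ≤ n := by exact_mod_cast hn
  have hn0 : (0 : ℝ) < n := by linarith
  obtain ⟨B, hB⟩ := hpol.exists_ratio_le hn hβ hγ
  set K : ℝ := 2 * (6 * n ^ 2 / γ) with hK
  have hK1 : 1 ≤ K := by
    have : (1 : ℝ) ≤ n ^ 2 / γ := by
      rw [le_div_iff₀ hγ]; nlinarith
    rw [hK, mul_div_assoc]; linarith
  set L : ℝ := 100 * (256 * K ^ 3 * n ^ 3 / β) / β with hL
  have hLpos : 0 < L := by positivity
  set ℓ := Real.log (n / γ) with hℓ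
  have hLlog : Real.log L ≤ Real.log M + 9 * ℓ := by
    have e : L = M * (n ^ 9 / γ ^ 3) := by rw [hL, hK, hM]; field_simp; ring
    have h2 : (n : ℝ) ^ 9 / γ ^ 3 ≤ (n / γ) ^ 9 := by
      rw [div_pow]
      exact div_le_div_of_nonneg_left (by positivity) (by positivity)
        (pow_le_pow_of_le_one hγ.le hγ1 (by norm_num))
    rw [e, Real.log_mul (by positivity) (by positivity)]
    have h3 := Real.log_le_log (by positivity) h2
    rw [Real.log_pow] at h3
    push_cast at h3
    linarith
  set q := √(n : ℝ) with hq
  have hq1 : 1 ≤ q := Real.one_le_sqrt.2 hnR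
  have hℓ0 : Real.log n ≤ ℓ := by
    apply Real.log_le_log hn0
    rw [le_div_iff₀ hγ]; nlinarith
  have hℓ1 : 0 ≤ ℓ := (Real.log_nonneg hnR).trans hℓ0
  -- Chosen from `(1 - β/(2√n))^T ≤ exp(-Tβ/(2√n))` and `log L ≤ log M + 9 log(n/γ)`.
  set T : ℕ := ⌈2 * q / β * (Real.log M + 9 * ℓ)⌉₊ with hTdef
  have hTge : 2 * q / β * (Real.log M + 9 * ℓ) ≤ T := Nat.le_ceil _
  have hTle : (T : ℝ) ≤ 2 * q / β * (Real.log M + 9 * ℓ) + 1 :=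
    (Nat.ceil_lt_add_one (by positivity)).le
  have hT : (1 - β / (2 * q)) ^ T * L ≤ 1 := by
    have h1 : (1 - β / (2 * q)) ^ T ≤ Real.exp (-(T * (β / (2 * q)))) := by
      rw [← mul_neg, Real.exp_nat_mul]
      gcongr
      · exact (SubspaceIPM.rate_bounds hn hβ₀ hβ).1
      · have := Real.add_one_le_exp (-(β / (2 * q)))
        linarith
    have h2 : Real.log L ≤ T * (β / (2 * q)) := by
      refine hLlog.trans ?_
      calc Real.log M + 9 * ℓ = 2 * q / β * (Real.log M + 9 * ℓ) * (β / (2 * q)) := by field_simp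
        _ ≤ T * (β / (2 * q)) := by gcongr
    calc _ ≤ Real.exp (-(T * (β / (2 * q)))) * Real.exp (Real.log L) := by
          rw [Real.exp_log hLpos]; gcongr
      _ = Real.exp (Real.log L - T * (β / (2 * q))) := by rw [← Real.exp_add]; congr 1; ring
      _ ≤ 1 := Real.exp_le_one_iff.2 (by linarith)
  have hreach := P.reachesWithin_of_cone hn hβ₀ hβ hμ₁ hK1 (μ₀ := μ₀) (B := B) (L := L) (T := T)
    (fun z hz z' hz' h1 h0 h0' => by
      obtain ⟨hx, hs⟩ := hB z hz z' hz' h1.le h0.le h0'.le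
      exact SubspaceIPM.comparable_of_le hn hβ (by positivity) hz' hz hx hs) hL hT (2 * n + 1) 0 0 z
    (by omega) hz hgz hgz0 (SubspaceIPM.cone_zero _ _ _ _) (SubspaceIPM.cone_zero _ _ _ _)
  refine ⟨(2 * n + 1) * (T + 1), ?_, hreach⟩
  have hpow : (n : ℝ) ^ (3 / 2 : ℝ) = n * q := by
    rw [hq, Real.sqrt_eq_rpow, ← Real.rpow_one_add' hn0.le (by norm_num)]
    norm_num
  rw [hpow]
  -- Absorbs the terms without logarithm: `log(n/γ) ≥ log 2 > 1/2` for `n ≥ 2`, and the summand `1`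
  -- covers `n = 1`.
  have hN : n * q ≤ 1 + 2 * (n * q * ℓ) := by
    rcases Nat.lt_or_ge n 2 with h | h
    · have hn1 : n = 1 := by omega
      have : (n : ℝ) = 1 := by exact_mod_cast hn1
      have hq' : q = 1 := by rw [hq, this, Real.sqrt_one]
      have : (n : ℝ) * q = 1 := by rw [hq', this, one_mul]
      rw [this]; linarith
    · have h2 : (2 : ℝ) ≤ n := by exact_mod_cast h
      have h3 : 1 / 2 ≤ ℓ := by
        have := Real.log_le_log (by norm_num) h2
        have := Real.log_two_gt_d9
        linarith
      have h4 : 0 < n * q := by positivity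
      nlinarith
  push_cast
  calc (2 * (n : ℝ) + 1) * (T + 1)
      ≤ 3 * n * (2 * q / β * (Real.log M + 9 * ℓ) + 1 + 1) := by
        gcongr
        linarith
    _ = n * q * (6 * Real.log M / β) + 6 * n + E * (n * q * ℓ) := by rw [hE]; ring
    _ ≤ n * q * (6 * Real.log M / β) + 6 * (n * q) + E * (n * q * ℓ) := by
        gcongr; exact le_mul_of_one_le_right hn0.le hq1
    _ = D * (n * q) + E * (n * q * ℓ) := by rw [hD]; ring
    _ ≤ D * (1 + 2 * (n * q * ℓ)) + E * (n * q * ℓ) := by gcongr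
    _ ≤ (2 * D + E) * (1 + n * q * ℓ) := by
        have : 0 ≤ n * q * ℓ := by positivity
        nlinarith
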